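/- Let $\mathcal G=(V,\mathcal I,\mathcal E,\partial)$ be a finite connected graph: $V$ is the finite set of vertices, each $i$ in the finite set $\mathcal I$ of internal edges has an initial vertex $\partial^-(i)$ and a terminal vertex $\partial^+(i)$ (possibly equal, in which case $i$ is called a tadpole), and each $e$ in the finite set $\mathcal E$ of external edges has one vertex $\partial(e)$. Let $\underline a=(a_i)_{i\in\mathcal I}$ with all $a_i>0$, and put $I_i=[0,a_i]$ for $i\in\mathcal I$, $I_e=[0,\infty)$ for $e\in\mathcal E$, $\mathcal H=\bigoplus_{j\in\mathcal E\cup\mathcal I}L^2(I_j)$. Let $\mathcal K=\mathbb C^{\mathcal E}\oplus\mathbb C^{\mathcal I}\oplus\mathbb C^{\mathcal I}$ and let $\mathcal M$ be a maximal isotropic subspace of $\mathcal K\oplus\mathcal K$ with respect to the form $\omega(\phi_1\oplus\phi_2,\psi_1\oplus\psi_2)=\langle\phi_1,\psi_2\rangle-\langle\phi_2,\psi_1\rangle$. The Laplace operator $\Delta(\mathcal M,\underline a)$ on $\mathcal H$ acts as $\psi_j\mapsto\psi_j''$ on the domain of all $\psi\in\mathcal H$ such that for every edge $j$ the functions $\psi_j,\psi_j'$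 are (locally) absolutely continuous, $\psi_j''\in L^2(I_j)$, and $$\bigl(\psi_e(0),\psi_i(0),\psi_i(a_i)\bigr)_{e,i}\oplus\bigl(\psi_e'(0),\psi_i'(0),-\psi_i'(a_i)\bigr)_{e,i}\in\mathcal M .$$ The heat semigroup $\mathrm e^{t\Delta(\mathcal M,\underline a)}$, $t\ge 0$, is the strongly continuous semigroup of bounded operators on $\mathcal H$ whose infinitesimal generator is $\Delta(\mathcal M,\underline a)$. A bounded operator on $\mathcal H$ is called positivity preserving if it maps every $\psi$ with $\psi_j\ge 0$ a.e. for all edges $j$ to a function with the same property. For any such subspace (of a double $\mathbb C^n\oplus\mathbb C^n$) choose $n\times n$ matrices $A,B$ with $(A,B)$ of rank $n$, $AB^\dagger=BA^\dagger$ and $\mathcal M=\{\chi_1\oplus\chi_2: A\chi_1+B\chi_2=0\}$, and put $\mathfrak S(k;\mathcal M)=-(A+\mathrm i kB)^{-1}(A-\mathrm i kB)$ whenever $A+\mathrm i kB$ is invertible; this does not depend on the choice of $(A,B)$. Call $\mathcal M$ positive (strictly positive) if there is $\varkappa_0\ge 0$ such that for all $\varkappa\ge\varkappa_0$ the matrix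 $\mathfrak S(\mathrm i\varkappa;\mathcal M)$ is defined and all entries of $\mathbb I+\mathfrak S(\mathrm i\varkappa;\mathcal M)$ are nonnegative (positive). For $v\in V$ let $\mathcal L_v\subset\mathcal K$ be spanned by the canonical basis vectors that belong to the edge ends at $v$ (an external edge $e$ has its end at $\partial(e)$; the second and third summands of $\mathcal K$ correspond to the initial and terminal ends of the internal edges). Call $\mathcal M$ locally strictly positive if $\mathcal M=\bigoplus_{v\in V}\mathcal M(v)$ with maximal isotropic subspaces $\mathcal M(v)\subset\mathcal L_v\oplus\mathcal L_v$, and there is $\varkappa_0\ge 0$ such that for all $\varkappa\ge\varkappa_0$ and all $v\in V$ the matrix $\mathfrak S(\mathrm i\varkappa;\mathcal M(v))$ is defined and all entries of $\mathbb I+\mathfrak S(\mathrm i\varkappa;\mathcal M(v))$ are positive. Then $\Delta(\mathcal M,\underline a)$ generates exactly one strongly continuous semigroup, so that the heat semigroup is well defined, and the following holds. (i) If $\mathcal M$ is strictly positive, then $\mathrm e^{t\Delta(\mathcal M,\underline a)}$ is positivity preserving for all $t>0$. If $\mathcal I=\emptyset$, it suffices to assume that $\mathcal M$ is positive. (ii)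 If $\mathcal M$ is locally strictly positive and the graph has no tadpoles, then $\mathrm e^{t\Delta(\mathcal M,\underline a)}$ is positivity preserving for all $t>0$. -/

import Mathlib

open MeasureTheory Filter Topology
open scoped NNReal ENNReal Matrix ComplexOrder

/-- A finite graph with vertex set `V`, internal edges `I` and external edges `E` (finiteness is
imposed where the graph is used): an internal edge has an initial and a terminal vertex, possibly
equal, and an external edge has a single vertex. -/
structure QGraph (V I E : Type*) where
  /-- initial vertex of an internal edge -/
  initial : I → V
  /-- terminal vertex of an internal edge -/
  terminal : I → V
  /-- the vertex of an external edge -/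
  extVertex : E → V

/-- Two vertices are adjacent if they are the two ends of some internal edge. -/
def QGraph.Adj {V I E : Type*} (G : QGraph V I E) (v w : V) : Prop :=
  ∃ i : I, (G.initial i = v ∧ G.terminal i = w) ∨ (G.initial i = w ∧ G.terminal i = v)

/-- Any two vertices are joined by a finite sequence of successively adjacent vertices. -/
def QGraph.IsConnected {V I E : Type*} (G : QGraph V I E) : Prop :=
  ∀ v w : V, Relation.ReflTransGen G.Adj v w

/-- No internal edge is a loop. -/
def QGraph.NoTadpoles {V I E : Type*} (G : QGraph V I E) : Prop :=
  ∀ i : I, G.initial i ≠ G.terminal i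

/-- The index set of the boundary space `𝒦 = 𝒦_E ⊕ 𝒦_I⁽⁻⁾ ⊕ 𝒦_I⁽⁺⁾`: the external edges at `0`, the
internal edges at `0`, the internal edges at their terminal end. -/
abbrev EdgeEnd (I E : Type*) := E ⊕ (I ⊕ I)

/-- The vertex at which an edge end sits. -/
def QGraph.endVertex {V I E : Type*} (G : QGraph V I E) : EdgeEnd I E → V :=
  Sum.elim G.extVertex (Sum.elim G.initial G.terminal)

/-- The double `ᵈ𝒦 = 𝒦 ⊕ 𝒦` of `𝒦 = ℂⁿ`. -/
abbrev Double (n : Type*) := (n → ℂ) × (n → ℂ)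

/-- The Hermitian symplectic form `ω(p, q) = ⟨p, J q⟩` with `J = (0, 1; -1, 0)`. -/
def sympForm {n : Type*} [Fintype n] (p q : Double n) : ℂ :=
  star p.1 ⬝ᵥ q.2 - star p.2 ⬝ᵥ q.1

/-- `ω` vanishes identically on `M`. -/
def IsIsotropic {n : Type*} [Fintype n] (M : Submodule ℂ (Double n)) : Prop :=
  ∀ p ∈ M, ∀ q ∈ M, sympForm p q = 0

/-- `M` is isotropic and not properly contained in a larger isotropic subspace. -/
def IsMaximalIsotropic {n : Type*} [Fintype n] (M : Submodule ℂ (Double n)) : Prop :=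
  Maximal IsIsotropic M

/-- `𝓜(A, B) = Ker (A, B) = {(χ₁, χ₂) | A χ₁ + B χ₂ = 0}`. -/
def bcSubspace {n : Type*} [Fintype n] (A B : Matrix n n ℂ) : Submodule ℂ (Double n) :=
  LinearMap.ker (A.mulVecLin.coprod B.mulVecLin)

/-- `(A, B)` has maximal rank and `A B†` is self-adjoint. -/
def IsBoundaryCondition {n : Type*} [Fintype n] (A B : Matrix n n ℂ) : Prop :=
  (Matrix.fromCols A B).rank = Fintype.card n ∧ A * Bᴴ = B * Aᴴ

/-- `S = 𝔖(k; M)`: the matrix `-(A + i k B)⁻¹ (A - i k B)` where `(A, B)` are boundary conditions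
with `𝓜(A, B) = M` and `A + i k B` is invertible. (Two such pairs differ by an invertible factor
on the left, so that `S` does not depend on the pair.) -/
def IsScatteringMatrix {n : Type*} [Fintype n] [DecidableEq n] (k : ℂ)
    (M : Submodule ℂ (Double n)) (S : Matrix n n ℂ) : Prop :=
  ∃ A B : Matrix n n ℂ, IsBoundaryCondition A B ∧ bcSubspace A B = M ∧
    IsUnit (A + (Complex.I * k) • B) ∧
    S = -((A + (Complex.I * k) • B)⁻¹ * (A - (Complex.I * k) • B))

/-- `M` is positive: all entries of `1 + 𝔖(iϰ; M)` are nonnegative (in particular real) for all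
`ϰ ≥ ϰ₀`. -/
def IsPositiveBC {n : Type*} [Fintype n] [DecidableEq n] (M : Submodule ℂ (Double n)) : Prop :=
  ∃ κ₀ : ℝ, 0 ≤ κ₀ ∧ ∀ κ : ℝ, κ₀ ≤ κ →
    ∃ S, IsScatteringMatrix (Complex.I * κ) M S ∧ ∀ i j, 0 ≤ (1 + S) i j

/-- `M` is strictly positive: all entries of `1 + 𝔖(iϰ; M)` are positive for all `ϰ ≥ ϰ₀`. -/
def IsStrictlyPositiveBC {n : Type*} [Fintype n] [DecidableEq n]
    (M : Submodule ℂ (Double n)) : Prop :=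
  ∃ κ₀ : ℝ, 0 ≤ κ₀ ∧ ∀ κ : ℝ, κ₀ ≤ κ →
    ∃ S, IsScatteringMatrix (Complex.I * κ) M S ∧ ∀ i j, 0 < (1 + S) i j

/-- The edge ends at the vertex `v`; `ℂ` to this index set is the space `𝓛_v`. -/
abbrev QGraph.EndsAt {V I E : Type*} (G : QGraph V I E) (v : V) :=
  {h : EdgeEnd I E // G.endVertex h = v}

/-- The component in `ᵈ𝓛_v` of an element of `ᵈ𝒦 = ⨁ ᵥ ᵈ𝓛_v`. -/
def QGraph.localPart {V I E : Type*} (G : QGraph V I E) (v : V) (p : Double (EdgeEnd I E)) :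
    Double (G.EndsAt v) :=
  (fun h => p.1 h, fun h => p.2 h)

/-- `M = ⨁ ᵥ M(v)` with every `M(v)` a maximal isotropic subspace of `ᵈ𝓛_v`. -/
def QGraph.IsLocalDecomposition {V I E : Type*} [DecidableEq V] [Fintype I] [Fintype E]
    (G : QGraph V I E) (M : Submodule ℂ (Double (EdgeEnd I E)))
    (Mv : ∀ v : V, Submodule ℂ (Double (G.EndsAt v))) : Prop :=
  (∀ v, IsMaximalIsotropic (Mv v)) ∧ ∀ p, p ∈ M ↔ ∀ v, G.localPart v p ∈ Mv v

/-- `M` is locally strictly positive: it decomposes as `M = ⨁ ᵥ M(v)`, and all entries of all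
the matrices `1 + 𝔖(iϰ; M(v))` are positive for all `ϰ ≥ ϰ₀`. -/
def QGraph.IsLocallyStrictlyPositive {V I E : Type*} [DecidableEq V] [Fintype I] [DecidableEq I]
    [Fintype E] [DecidableEq E] (G : QGraph V I E)
    (M : Submodule ℂ (Double (EdgeEnd I E))) : Prop :=
  ∃ Mv : ∀ v : V, Submodule ℂ (Double (G.EndsAt v)), G.IsLocalDecomposition M Mv ∧
    ∃ κ₀ : ℝ, 0 ≤ κ₀ ∧ ∀ κ : ℝ, κ₀ ≤ κ → ∀ v : V,
      ∃ S, IsScatteringMatrix (Complex.I * κ) (Mv v) S ∧ ∀ i j, 0 < (1 + S) i j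

/-- The interval of an edge: `[0, ∞)` for an external edge, `[0, a i]` for an internal edge. -/
def edgeSet {I E : Type*} (a : I → ℝ) : E ⊕ I → Set ℝ :=
  Sum.elim (fun _ => Set.Ici 0) (fun i => Set.Icc 0 (a i))

/-- The Hilbert space `ℋ = ⨁ⱼ L²(Iⱼ)` over all edges. -/
abbrev GraphL2 {I : Type*} (E : Type*) [Fintype I] [Fintype E] (a : I → ℝ) :=
  PiLp 2 (fun j : E ⊕ I => Lp ℂ 2 (volume.restrict (edgeSet a j)))

/-- `f` belongs to `𝒟ⱼ`, with first derivative `f₁` and second derivative `f₂`, on the interval `s`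
(of the form `[0, b]` or `[0, ∞)`): `f` and `f₂` are square integrable, and `f`, `f₁` are (locally)
absolutely continuous with derivatives `f₁`, `f₂`, that is, indefinite integrals of these.
Note that `f₂` is integrable on bounded intervals, so that `f₁` is continuous on `s`. -/
structure IsSobolevTwo (s : Set ℝ) (f f₁ f₂ : ℝ → ℂ) : Prop where
  memLp : MemLp f 2 (volume.restrict s)
  memLp_second : MemLp f₂ 2 (volume.restrict s)
  eq_integral : ∀ x ∈ s, f x = f 0 + ∫ t in (0 : ℝ)..x, f₁ t
  first_eq_integral : ∀ x ∈ s, f₁ x = f₁ 0 + ∫ t in (0 : ℝ)..x, f₂ t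

/-- The boundary values `[ψ] = (ψ(ends), ψ'(ends))`, derivatives being taken in the direction
pointing into the edge. -/
def boundaryValues {I E : Type*} (a : I → ℝ) (f f₁ : E ⊕ I → ℝ → ℂ) : Double (EdgeEnd I E) :=
  (Sum.elim (fun e => f (Sum.inl e) 0)
      (Sum.elim (fun i => f (Sum.inr i) 0) (fun i => f (Sum.inr i) (a i))),
    Sum.elim (fun e => f₁ (Sum.inl e) 0)
      (Sum.elim (fun i => f₁ (Sum.inr i) 0) (fun i => -f₁ (Sum.inr i) (a i))))

/-- The graph of the Laplace operator `Δ(M, a)`: `ψ` is in the domain (that is, `ψ ∈ ⨁ⱼ 𝒟ⱼ` and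
`[ψ] ∈ M`) and `Δ(M, a) ψ = φ`, that is, `φⱼ = ψⱼ''` on every edge. -/
def LaplaceGraph {I E : Type*} [Fintype I] [Fintype E] (a : I → ℝ)
    (M : Submodule ℂ (Double (EdgeEnd I E))) (ψ φ : GraphL2 E a) : Prop :=
  ∃ f f₁ f₂ : E ⊕ I → ℝ → ℂ,
    (∀ j, IsSobolevTwo (edgeSet a j) (f j) (f₁ j) (f₂ j)) ∧
    (∀ j, (ψ j : ℝ → ℂ) =ᵐ[volume.restrict (edgeSet a j)] f j) ∧
    (∀ j, (φ j : ℝ → ℂ) =ᵐ[volume.restrict (edgeSet a j)] f₂ j) ∧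
    boundaryValues a f f₁ ∈ M

/-- `T` is the strongly continuous semigroup `T t = exp (t L)` of bounded operators whose
infinitesimal generator is the (unbounded) operator `L` with the given graph: `L ψ = φ` holds if and
only if `T t ψ` has the derivative `φ` at `t = 0+`. -/
structure IsSemigroupGeneratedBy {H : Type*} [NormedAddCommGroup H] [NormedSpace ℂ H]
    (T : ℝ≥0 → H →L[ℂ] H) (graph : H → H → Prop) : Prop where
  zero : T 0 = ContinuousLinearMap.id ℂ H
  add : ∀ s t, T (s + t) = (T s).comp (T t)
  strongly_continuous : ∀ ψ, Continuous fun t => T t ψ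
  generator : ∀ ψ φ, graph ψ φ ↔
    Tendsto (fun t : ℝ≥0 => (((t : ℝ) : ℂ)⁻¹) • (T t ψ - ψ)) (𝓝[>] 0) (𝓝 φ)

/-- `ψ ≥ 0`: on every edge, `ψⱼ(x) ≥ 0` for almost every `x`. -/
def IsNonnegative {I E : Type*} [Fintype I] [Fintype E] {a : I → ℝ} (ψ : GraphL2 E a) : Prop :=
  ∀ j, ∀ᵐ x ∂(volume.restrict (edgeSet a j)), 0 ≤ (ψ j : ℝ → ℂ) x

/-- A bounded operator maps nonnegative functions to nonnegative functions. -/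
def IsPositivityPreserving {I E : Type*} [Fintype I] [Fintype E] {a : I → ℝ}
    (T : GraphL2 E a →L[ℂ] GraphL2 E a) : Prop :=
  ∀ ψ, IsNonnegative ψ → IsNonnegative (T ψ)

/-! Green's identity turns isotropy of `M` into symmetry of the Laplacian. Maximality makes `l - Δ`
surjective for every large real `l`. Hence the Laplacian is selfadjoint and bounded above, generates
exactly one semigroup, and that semigroup is a limit of powers of rescaled resolvents (Euler's
backward formula). So it suffices that `(l - Δ)⁻¹` preserves the closed cone of nonnegative
functions for all large `l = κ²`.

Let `κ² f - f'' = η` on every edge, let `c` be the vector of values at the edge ends, and let `Λ` be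
the Dirichlet-to-Neumann matrix: `κ` on external edges, and the block with diagonal `κ coth (κ a)`
and off-diagonal `-κ / sinh (κ a)` on internal ones. The inward derivatives are `d - Λ c`, where `d`
depends only on `η`. If `η ≥ 0`, comparison with exponentials and hyperbolic sines gives `d ≥ 0`,
and gives `f ≥ 0` as soon as `c ≥ 0` (`maximum_principle_Icc`, `maximum_principle_Ici`).

It remains to deduce `c ≥ 0` from `(c, d - Λ c) ∈ M`. With `b = ∑ 1 / aᵢ`, one has `Λ = (κ + b) -
P`, where the entries of `P` lie in `[0, b]` uniformly in `κ`. Positivity of the boundary condition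
says that `(c, d' - κ' c) ∈ M` means `c = K d'` with `K = (1 + 𝔖(iκ')) / (2κ') ≥ 0`. Taking `κ' = κ
+ b` gives `c = K d + K P c`. Since `K` is of order `1 / κ'`, the nonnegative matrix `K P` has row
sums below `1` for large `κ`, and a discrete minimum principle yields `c ≥ 0`
(`HasNonnegResponse.perturb`). -/

/-! ### Scalar estimates for `exp (-t / r)`. -/

/-- The function `r ↦ exp (-t / r)` on `[0, ∞)`, with the value `0` at `r = 0` for `t > 0`. -/
noncomputable def expNegDiv (t r : ℝ) : ℝ := if t = 0 then 1 else expNegInvGlue (r / t)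

namespace expNegDiv

theorem continuous (t : ℝ) : Continuous (expNegDiv t) := by
  unfold expNegDiv
  by_cases ht : t = 0
  · simp only [ht, if_true]; exact continuous_const
  · simp only [ht, if_false]
    exact (expNegInvGlue.contDiff (n := 0)).continuous.comp (continuous_id.div_const t)

theorem zero (r : ℝ) : expNegDiv 0 r = 1 := by simp [expNegDiv]

theorem of_pos {t r : ℝ} (ht : 0 ≤ t) (hr : 0 < r) : expNegDiv t r = Real.exp (-(t / r)) := by
  rcases ht.eq_or_lt with rfl | ht
  · simp [expNegDiv]
  · have : ¬ r / t ≤ 0 := not_le.mpr (div_pos hr ht)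
    simp [expNegDiv, expNegInvGlue, ht.ne', this]

theorem apply_zero {t : ℝ} (ht : 0 < t) : expNegDiv t 0 = 0 := by
  simp [expNegDiv, expNegInvGlue, ht.ne']

theorem nonneg (t r : ℝ) : 0 ≤ expNegDiv t r := by
  unfold expNegDiv
  split_ifs
  · exact zero_le_one
  · exact expNegInvGlue.nonneg _

theorem le_one {t r : ℝ} (ht : 0 ≤ t) (hr : 0 ≤ r) : expNegDiv t r ≤ 1 := by
  rcases hr.eq_or_lt with rfl | hr
  · rcases ht.eq_or_lt with rfl | ht
    · rw [zero]
    · rw [apply_zero ht]; exact zero_le_one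
  · rw [of_pos ht hr, Real.exp_le_one_iff, neg_nonpos]; positivity

theorem add {s t r : ℝ} (hs : 0 ≤ s) (ht : 0 ≤ t) (hr : 0 ≤ r) :
    expNegDiv (s + t) r = expNegDiv s r * expNegDiv t r := by
  rcases hr.eq_or_lt with rfl | hr
  · rcases hs.eq_or_lt with rfl | hs
    · rw [zero, zero_add, one_mul]
    · rw [apply_zero hs, apply_zero (by positivity), zero_mul]
  · rw [of_pos hs hr, of_pos ht hr, of_pos (by positivity) hr, ← Real.exp_add]
    congr 1; ring

/-- The factor `r` compensates for the unbounded rate `1 / r`, by `1 - exp (-x) ≤ x`. For operators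
it gives continuity in time, uniformly on bounded sets, after composition with `R`. -/
theorem abs_mul_sub_one_le {t r : ℝ} (ht : 0 ≤ t) (hr : 0 ≤ r) :
    |r * (expNegDiv t r - 1)| ≤ t := by
  have h1 := le_one ht hr
  rw [abs_of_nonpos (mul_nonpos_of_nonneg_of_nonpos hr (by linarith))]
  rcases hr.eq_or_lt with rfl | hr
  · simpa using ht
  · rw [of_pos ht hr]
    have h2 := Real.add_one_le_exp (-(t / r))
    have h3 : r * (-(t / r)) ≤ r * (Real.exp (-(t / r)) - 1) :=
      mul_le_mul_of_nonneg_left (by linarith) hr.le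
    have h4 : r * (-(t / r)) = -t := by field_simp
    linarith

theorem abs_mul_sub_le {s t r : ℝ} (hs : 0 ≤ s) (ht : 0 ≤ t) (hr : 0 ≤ r) :
    |r * (expNegDiv s r - expNegDiv t r)| ≤ |s - t| := by
  wlog h : t ≤ s generalizing s t
  · rw [abs_sub_comm s t, ← neg_sub (expNegDiv t r), mul_neg, abs_neg]
    exact this ht hs (le_of_not_ge h)
  obtain ⟨u, rfl⟩ := exists_add_of_le h
  have hu : 0 ≤ u := by linarith
  rw [add ht hu hr, show r * (expNegDiv t r * expNegDiv u r - expNegDiv t r) =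
    expNegDiv t r * (r * (expNegDiv u r - 1)) by ring, abs_mul, abs_of_nonneg (nonneg t r),
    show |t + u - t| = u by rw [add_sub_cancel_left, abs_of_nonneg hu]]
  calc _ ≤ 1 * u := mul_le_mul (le_one ht hr) (abs_mul_sub_one_le hu hr) (abs_nonneg _) zero_le_one
    _ = u := one_mul u

/-- The second-order Taylor remainder of `exp (-t / r)`, cleared of its denominator `r²`; it yields
the derivative of the semigroup at time `0`. -/
theorem abs_sq_mul_sub_one_add_le {t r : ℝ} (ht : 0 ≤ t) (hr : 0 ≤ r) :
    |r * (r * (expNegDiv t r - 1)) + t * r| ≤ t ^ 2 := by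
  rcases hr.eq_or_lt with rfl | hr
  · simp; positivity
  · rw [of_pos ht hr]
    have hx : 0 ≤ t / r := by positivity
    have h2 := Real.add_one_le_exp (-(t / r))
    -- For `x = t / r > 1` the right side `1 + x (x - 1)` already exceeds `1`.
    have h3 : Real.exp (-(t / r)) ≤ 1 - t / r + (t / r) ^ 2 := by
      by_cases h1 : t / r ≤ 1
      · have := Real.abs_exp_sub_one_sub_id_le (x := -(t / r)) (by rwa [abs_neg, abs_of_nonneg hx])
        have := (abs_le.mp this).2
        nlinarith
      · have : Real.exp (-(t / r)) ≤ 1 := by simpa using hx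
        nlinarith
    have h4 : r * (r * (Real.exp (-(t / r)) - 1)) + t * r =
      r ^ 2 * (Real.exp (-(t / r)) - 1 + t / r) := by field_simp
    have h5 : t ^ 2 = r ^ 2 * (t / r) ^ 2 := by field_simp
    rw [h4, h5, abs_of_nonneg (mul_nonneg (by positivity) (by linarith))]
    exact mul_le_mul_of_nonneg_left (by linarith) (by positivity)

end expNegDiv

/-- The error of the approximation of `exp (-n y)` by `(1 + y) ^ (-n)` for even `n`. -/
theorem abs_inv_one_add_pow_sub_exp_le {y : ℝ} (hy : 0 ≤ y) {m : ℕ} (hm : 0 < m) :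
    |((1 + y)⁻¹) ^ (2 * m) - Real.exp (-y) ^ (2 * m)| ≤ 2 / m := by
  have hm' : (0 : ℝ) < m := by exact_mod_cast hm
  have hb0 : 0 ≤ Real.exp (-y) := (Real.exp_pos _).le
  have hab : Real.exp (-y) ≤ (1 + y)⁻¹ := by
    rw [Real.exp_neg]
    exact inv_anti₀ (by positivity) (by linarith [Real.add_one_le_exp y])
  have ha0 : 0 ≤ (1 + y)⁻¹ := by positivity
  -- Uses `exp (-y) ≥ 1 - y` and `(1 + y)⁻¹ - (1 - y) = y² / (1 + y)`.
  have hdiff : (1 + y)⁻¹ - Real.exp (-y) ≤ y ^ 2 * (1 + y)⁻¹ := by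
    have := Real.add_one_le_exp (-y)
    have h : (1 + y)⁻¹ = y ^ 2 * (1 + y)⁻¹ + (1 - y) := by field_simp; ring
    linarith
  rw [abs_of_nonneg (sub_nonneg.mpr (pow_le_pow_left₀ hb0 hab _))]
  have hpow : (1 + y)⁻¹ ^ (2 * m) - Real.exp (-y) ^ (2 * m) ≤
      (2 * m) * ((1 + y)⁻¹ ^ (2 * m - 1) * ((1 + y)⁻¹ - Real.exp (-y))) := by
    have := (le_abs_self _).trans (abs_pow_sub_pow_le (1 + y)⁻¹ (Real.exp (-y)) (2 * m))
    rw [abs_of_nonneg (sub_nonneg.mpr hab), abs_of_nonneg ha0, abs_of_nonneg hb0,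
      max_eq_left hab] at this
    refine this.trans_eq ?_
    push_cast; ring
  -- Bernoulli for the exponent `m`, then squared: this is where evenness helps, since `(m y)²`
  -- absorbs the factor `y²` of the error.
  have hlow : (m * y) ^ 2 ≤ (1 + y) ^ (2 * m) := by
    have := one_add_mul_le_pow (a := y) (by linarith) m
    rw [mul_comm 2 m, pow_mul]
    exact pow_le_pow_left₀ (by positivity) (by linarith) 2
  calc _ ≤ _ := hpow
    _ ≤ (2 * m) * ((1 + y)⁻¹ ^ (2 * m - 1) * (y ^ 2 * (1 + y)⁻¹)) := by gcongr
    _ = (2 * m) * (y ^ 2 * (1 + y)⁻¹ ^ (2 * m)) := by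
        obtain ⟨k, hk⟩ : ∃ k, 2 * m = k + 1 := ⟨2 * m - 1, by omega⟩
        rw [hk, Nat.add_sub_cancel, pow_succ]; ring
    _ ≤ 2 / m := by
        rw [inv_pow, ← div_eq_mul_inv, le_div_iff₀ hm']
        have : y ^ 2 / (1 + y) ^ (2 * m) * (m : ℝ) ^ 2 ≤ 1 := by
          rw [div_mul_eq_mul_div, div_le_one (by positivity)]
          linarith [hlow, mul_pow (m : ℝ) y 2, mul_comm (y ^ 2) ((m : ℝ) ^ 2)]
        nlinarith

/-- With `μ = 2m / t`, the base `μ r / (μ r + 1)` equals `(1 + y)⁻¹` for `y = t / (2 m r)`. At `r =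
0` both terms vanish, so the bound is uniform in `r ≥ 0`. -/
theorem expNegDiv.abs_pow_sub_le {t r : ℝ} (ht : 0 < t) (hr : 0 ≤ r) {m : ℕ} (hm : 0 < m) :
    |(2 * m / t * (r / (2 * m / t * r + 1))) ^ (2 * m) - expNegDiv t r| ≤ 2 / m := by
  have hm' : (0 : ℝ) < m := by exact_mod_cast hm
  rcases hr.eq_or_lt with rfl | hr
  · simp only [apply_zero ht, zero_div, mul_zero, sub_zero]
    rw [zero_pow (by omega), abs_zero]; positivity
  · have h := abs_inv_one_add_pow_sub_exp_le (y := t / r / (2 * m)) (by positivity) hm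
    rw [of_pos ht.le hr]
    convert h using 3
    · congr 1; field_simp
    · rw [← Real.exp_nat_mul]; congr 1; push_cast; field_simp

/-! ### Resolvents of a symmetric operator with surjective `l - L`. -/

section ResolventGraph

variable {H : Type*} [NormedAddCommGroup H] [InnerProductSpace ℂ H]

/-- The graph of a symmetric operator, such that `l - L` is surjective for all real `l ≥ l₀`. -/
structure IsSelfAdjointGraph (graph : H → H → Prop) (l₀ : ℝ) : Prop where
  add : ∀ {ψ φ ψ' φ'}, graph ψ φ → graph ψ' φ' → graph (ψ + ψ') (φ + φ')
  smul : ∀ (c : ℂ) {ψ φ}, graph ψ φ → graph (c • ψ) (c • φ)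
  symm : ∀ {ψ φ ψ' φ'}, graph ψ φ → graph ψ' φ' → inner ℂ φ ψ' = inner ℂ ψ φ'
  eq_zero : ∀ {φ}, graph 0 φ → φ = 0
  solvable : ∀ l : ℝ, l₀ ≤ l → ∀ η, ∃ ψ, graph ψ ((l : ℂ) • ψ - η)

/-- `R` is the bounded inverse of `l - L`. -/
def IsResolventAt (graph : H → H → Prop) (l : ℝ) (R : H →L[ℂ] H) : Prop :=
  ∀ ψ φ, graph ψ φ ↔ ψ = R ((l : ℂ) • ψ - φ)

namespace IsSelfAdjointGraph

variable {graph : H → H → Prop} {l₀ : ℝ}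

theorem sub (h : IsSelfAdjointGraph graph l₀) {ψ φ ψ' φ' : H} (h₁ : graph ψ φ)
    (h₂ : graph ψ' φ') : graph (ψ - ψ') (φ - φ') := by
  have := h.add h₁ (h.smul (-1) h₂)
  simpa [sub_eq_add_neg] using this

/-- By symmetry the kernel of `l - L` is orthogonal to its range, which is the whole space. -/
theorem injective (h : IsSelfAdjointGraph graph l₀) {l : ℝ} (hl : l₀ ≤ l) {ψ : H}
    (hψ : graph ψ ((l : ℂ) • ψ)) : ψ = 0 := by
  obtain ⟨ψ', hψ'⟩ := h.solvable l hl ψ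
  have := h.symm hψ hψ'
  rw [inner_sub_right, inner_smul_left, inner_smul_right, Complex.conj_ofReal] at this
  exact (inner_self_eq_zero (𝕜 := ℂ)).mp (by linear_combination this)

/-- The inverse of `l - L` is defined everywhere and symmetric, hence bounded by Hellinger–Toeplitz.
-/
theorem exists_resolvent [CompleteSpace H] (h : IsSelfAdjointGraph graph l₀) {l : ℝ}
    (hl : l₀ ≤ l) : ∃ R : H →L[ℂ] H, IsSelfAdjoint R ∧ IsResolventAt graph l R := by
  choose r hr using h.solvable l hl
  have uniq : ∀ {ψ η}, graph ψ ((l : ℂ) • ψ - η) → ψ = r η := by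
    intro ψ η hψ
    have := h.sub hψ (hr η)
    rw [show (l : ℂ) • ψ - η - ((l : ℂ) • r η - η) = (l : ℂ) • (ψ - r η) by module] at this
    exact sub_eq_zero.mp (h.injective hl this)
  let rl : H →ₗ[ℂ] H :=
    { toFun := r
      map_add' := fun x y => by
        refine (uniq ?_).symm
        have := h.add (hr x) (hr y)
        rwa [show (l : ℂ) • r x - x + ((l : ℂ) • r y - y) =
          (l : ℂ) • (r x + r y) - (x + y) by module] at this
      map_smul' := fun c x => by
        refine (uniq ?_).symm
        have := h.smul c (hr x)
        rwa [show c • ((l : ℂ) • r x - x) = (l : ℂ) • (c • r x) - c • x by module] at this }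
  have hsymm : rl.IsSymmetric := by
    intro x y
    have := h.symm (hr x) (hr y)
    rw [inner_sub_right, inner_sub_left, inner_smul_left, inner_smul_right,
      Complex.conj_ofReal] at this
    change inner ℂ (r x) y = inner ℂ x (r y)
    linear_combination this
  refine ⟨⟨rl, hsymm.continuous⟩, ?_, fun ψ φ => ⟨fun hψ => ?_, fun hψ => ?_⟩⟩
  · rw [ContinuousLinearMap.isSelfAdjoint_iff_isSymmetric]
    exact hsymm
  · refine uniq (η := (l : ℂ) • ψ - φ) ?_
    rwa [sub_sub_cancel]
  · have := hr ((l : ℂ) • ψ - φ)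
    change ψ = r _ at hψ
    rwa [← hψ, sub_sub_cancel] at this

theorem resolvent_injective (h : IsSelfAdjointGraph graph l₀) {l : ℝ} {R : H →L[ℂ] H}
    (hR : IsResolventAt graph l R) {η : H} (hη : R η = 0) : η = 0 := by
  have : graph 0 (-η) := (hR _ _).mpr (by simp [hη])
  simpa using h.eq_zero this

/-- A point `r < 0` would correspond to the value `l₀ - 1 / r > l₀` of the spectral parameter, at
which `l - L` is invertible. -/
theorem spectrum_nonneg [CompleteSpace H] (h : IsSelfAdjointGraph graph l₀) {R : H →L[ℂ] H}
    (hR : IsResolventAt graph l₀ R) {r : ℝ} (hr : r ∈ spectrum ℝ R) : 0 ≤ r := by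
  by_contra! hneg
  apply hr
  -- This `μ` makes `r - R = r (1 + μ R)`. The resolvent identities `h1` and `h2` say that `1 - μ
  -- R'` is the two-sided inverse of `1 + μ R`.
  set μ : ℝ := -r⁻¹ with hμ
  have hμ0 : 0 < μ := by rw [hμ, neg_pos]; exact inv_lt_zero.mpr hneg
  obtain ⟨R', -, hR'⟩ := h.exists_resolvent (l := l₀ + μ) (by linarith)
  have h1 : ∀ η, R' η = R (η - (μ : ℂ) • R' η) := by
    intro η
    have : graph (R' η) (((l₀ + μ : ℝ) : ℂ) • R' η - η) := (hR' _ _).mpr (by rw [sub_sub_cancel])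
    have := (hR _ _).mp this
    rw [show (l₀ : ℂ) • R' η - (((l₀ + μ : ℝ) : ℂ) • R' η - η) = η - (μ : ℂ) • R' η by
      push_cast; module] at this
    exact this
  have h2 : ∀ η, R η = R' (η + (μ : ℂ) • R η) := by
    intro η
    have : graph (R η) ((l₀ : ℂ) • R η - η) := (hR _ _).mpr (by rw [sub_sub_cancel])
    have := (hR' _ _).mp this
    rw [show ((l₀ + μ : ℝ) : ℂ) • R η - ((l₀ : ℂ) • R η - η) = η + (μ : ℂ) • R η by
      push_cast; module] at this
    exact this
  have hu : IsUnit (1 + (μ : ℂ) • R) := by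
    refine isUnit_iff_exists.mpr ⟨1 - (μ : ℂ) • R', ?_, ?_⟩
    · ext η
      have := h1 η
      simp only [map_sub, map_smul] at this
      simp only [mul_apply_eq_comp, add_apply,
        sub_apply, one_apply_eq_self,
        smul_apply, map_sub, map_smul]
      linear_combination (norm := module) (-(μ : ℂ)) • this
    · ext η
      have := h2 η
      simp only [map_add, map_smul] at this
      simp only [mul_apply_eq_comp, add_apply,
        sub_apply, one_apply_eq_self,
        smul_apply, map_add, map_smul]
      linear_combination (norm := module) (μ : ℂ) • this
  have hr0 : (r : ℂ) ≠ 0 := by exact_mod_cast hneg.ne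
  have : (algebraMap ℝ (H →L[ℂ] H)) r - R = (r : ℂ) • (1 + (μ : ℂ) • R) := by
    ext η
    simp only [Algebra.algebraMap_eq_smul_one, sub_apply,
      smul_apply, one_apply_eq_self,
      add_apply, smul_add, smul_smul]
    have : (r : ℂ) * (μ : ℂ) = -1 := by
      rw [hμ]; push_cast; field_simp
    rw [this, neg_one_smul, sub_eq_add_neg, Complex.coe_smul]
  rw [spectrum.mem_resolventSet_iff, this]
  exact hu.smul (Units.mk0 (r : ℂ) hr0)

end IsSelfAdjointGraph

end ResolventGraph

/-! ### The semigroup `exp (-t R⁻¹)` by continuous functional calculus. -/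

section ExpSemigroup

variable {H : Type*} [NormedAddCommGroup H] [InnerProductSpace ℂ H] [CompleteSpace H]

/-- The orthogonal complement of the range is the kernel of the adjoint, here of `R` itself. -/
theorem IsSelfAdjoint.denseRange_of_injective {R : H →L[ℂ] H} (hR : IsSelfAdjoint R)
    (hinj : ∀ η, R η = 0 → η = 0) : DenseRange R := by
  have h1 : (LinearMap.range R.toLinearMap)ᗮ = ⊥ := by
    rw [ContinuousLinearMap.orthogonal_range, hR.adjoint_eq]
    exact LinearMap.ker_eq_bot'.mpr hinj
  have h2 := (Submodule.topologicalClosure_eq_top_iff).mpr h1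
  have h3 := Submodule.dense_iff_topologicalClosure_eq_top.mpr h2
  exact h3

-- Uniformly bounded operators need only be controlled on a dense set; below, strong limits are
-- checked on the range of `R`.
omit [CompleteSpace H] in
theorem tendsto_zero_of_bounded_of_denseRange {ι : Type*} {l : Filter ι} {A : ι → H →L[ℂ] H}
    {C : ℝ} (hC : ∀ᶠ i in l, ‖A i‖ ≤ C) {R : H →L[ℂ] H} (hR : DenseRange R)
    (h : ∀ η, Tendsto (fun i => A i (R η)) l (𝓝 0)) (ψ : H) :
    Tendsto (fun i => A i ψ) l (𝓝 0) := by
  rw [Metric.tendsto_nhds]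
  intro ε hε
  obtain ⟨η, hη⟩ := hR.exists_dist_lt ψ (ε := ε / (2 * (|C| + 1))) (by positivity)
  filter_upwards [hC, Metric.tendsto_nhds.mp (h η) (ε / 2) (by positivity)] with i hi1 hi2
  rw [dist_zero_right] at hi2 ⊢
  have h1 : A i ψ = A i (ψ - R η) + A i (R η) := by rw [← map_add]; congr 1; abel
  have h2 : ‖A i (ψ - R η)‖ ≤ (|C| + 1) * (ε / (2 * (|C| + 1))) := by
    refine (A i).le_of_opNorm_le_of_le (hi1.trans ?_) ?_
    · linarith [le_abs_self C]
    · rw [← dist_eq_norm]; exact hη.le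
  have h3 : (|C| + 1) * (ε / (2 * (|C| + 1))) = ε / 2 := by field_simp
  rw [h1]
  linarith [norm_add_le (A i (ψ - R η)) (A i (R η))]

/-- The contraction semigroup `exp (-t R⁻¹)`. -/
noncomputable def expNegInv (R : H →L[ℂ] H) (t : ℝ) : H →L[ℂ] H := cfc (expNegDiv t) R

namespace expNegInv

variable {R : H →L[ℂ] H}

theorem zero (hR : IsSelfAdjoint R) : expNegInv R 0 = 1 := by
  have : expNegDiv 0 = fun _ => 1 := funext expNegDiv.zero
  rw [expNegInv, this, cfc_const_one ℝ R]

variable (hR : IsSelfAdjoint R) (hpos : ∀ r ∈ spectrum ℝ R, 0 ≤ r)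
include hR hpos

omit hR in
theorem add {s t : ℝ} (hs : 0 ≤ s) (ht : 0 ≤ t) :
    expNegInv R (s + t) = expNegInv R s * expNegInv R t := by
  unfold expNegInv
  rw [← cfc_mul (expNegDiv s) (expNegDiv t) R (expNegDiv.continuous s).continuousOn
    (expNegDiv.continuous t).continuousOn]
  exact cfc_congr fun r hr => expNegDiv.add hs ht (hpos r hr)

omit hR in
theorem norm_le_one {t : ℝ} (ht : 0 ≤ t) : ‖expNegInv R t‖ ≤ 1 := by
  refine norm_cfc_le zero_le_one fun r hr => ?_
  rw [Real.norm_eq_abs, abs_of_nonneg (expNegDiv.nonneg t r)]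
  exact expNegDiv.le_one ht (hpos r hr)

omit hpos in
theorem mul_sub_eq (s t : ℝ) : R * (expNegInv R s - expNegInv R t) =
    cfc (fun r => r * (expNegDiv s r - expNegDiv t r)) R := by
  have hs := expNegDiv.continuous s
  have ht := expNegDiv.continuous t
  rw [cfc_mul (fun r => r) (fun r => expNegDiv s r - expNegDiv t r) R, cfc_id' ℝ R,
    cfc_sub (expNegDiv s) (expNegDiv t) R hs.continuousOn ht.continuousOn]
  · rfl

theorem norm_mul_sub_le {s t : ℝ} (hs : 0 ≤ s) (ht : 0 ≤ t) :
    ‖R * (expNegInv R s - expNegInv R t)‖ ≤ |s - t| := by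
  rw [mul_sub_eq hR]
  exact norm_cfc_le (abs_nonneg _) fun r hr => expNegDiv.abs_mul_sub_le hs ht (hpos r hr)

omit hpos in
theorem commute (t : ℝ) : R * expNegInv R t = expNegInv R t * R := by
  have ht := expNegDiv.continuous t
  have := cfc_commute_cfc (fun r => r) (expNegDiv t) R
  rw [cfc_id' ℝ R] at this
  exact this

theorem continuous_apply (hd : DenseRange R) (ψ : H) :
    Continuous fun t : ℝ≥0 => expNegInv R t ψ := by
  rw [continuous_iff_continuousAt]
  intro t₀
  have key := tendsto_zero_of_bounded_of_denseRange (l := 𝓝 t₀) (C := 2)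
    (A := fun t : ℝ≥0 => expNegInv R t - expNegInv R t₀) (R := R) ?_ hd ?_ ψ
  · have := key.add_const (expNegInv R t₀ ψ)
    simpa [ContinuousAt] using this
  · filter_upwards with t
    have h1 := norm_le_one hpos t.coe_nonneg
    have h2 := norm_le_one hpos t₀.coe_nonneg
    exact (norm_sub_le _ _).trans (by linarith)
  · intro η
    have hlim : Tendsto (fun t : ℝ≥0 => |(t : ℝ) - t₀| * ‖η‖) (𝓝 t₀) (𝓝 0) := by
      have : Continuous fun t : ℝ≥0 => |(t : ℝ) - t₀| * ‖η‖ := by fun_prop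
      simpa using this.tendsto t₀
    refine squeeze_zero_norm (fun t => ?_) hlim
    have : (expNegInv R t - expNegInv R t₀) (R η) =
        (R * (expNegInv R t - expNegInv R t₀)) η := by
      rw [mul_sub, commute hR, commute hR, ← sub_mul]; rfl
    rw [this]
    exact ContinuousLinearMap.le_of_opNorm_le _ (norm_mul_sub_le hR hpos t.coe_nonneg t₀.coe_nonneg) η

/-- After multiplication by `R` the difference quotients have norm at most `1`, so the limit exists
for every vector, including those outside the domain of the generator. -/
theorem tendsto_mul_sub_one (hd : DenseRange R) (ψ : H) :
    Tendsto (fun t : ℝ≥0 => (((t : ℝ) : ℂ)⁻¹) • R (expNegInv R t ψ - ψ)) (𝓝[>] 0) (𝓝 (-ψ)) := by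
  have key := tendsto_zero_of_bounded_of_denseRange (l := 𝓝[>] (0 : ℝ≥0)) (C := 2)
    (A := fun t : ℝ≥0 => (((t : ℝ) : ℂ)⁻¹) • (R * (expNegInv R t - expNegInv R 0)) + 1)
    (R := R) ?_ hd ?_ ψ
  · have := key.add_const (-ψ)
    simpa [zero hR] using this
  · filter_upwards [self_mem_nhdsWithin] with t ht
    have ht : (0 : ℝ) < t := ht
    have h1 := norm_mul_sub_le hR hpos t.coe_nonneg le_rfl
    rw [sub_zero, abs_of_pos ht] at h1
    refine (norm_add_le _ _).trans ?_
    have h2 : ‖(((t : ℝ) : ℂ)⁻¹) • (R * (expNegInv R t - expNegInv R 0))‖ ≤ 1 := by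
      rw [norm_smul, norm_inv, Complex.norm_real, Real.norm_eq_abs, abs_of_pos ht,
        inv_mul_le_iff₀ ht, mul_one]
      exact h1
    have h3 : ‖(1 : H →L[ℂ] H)‖ ≤ 1 := ContinuousLinearMap.norm_id_le
    linarith
  · intro η
    have hlim : Tendsto (fun t : ℝ≥0 => (t : ℝ) * ‖η‖) (𝓝[>] 0) (𝓝 0) := by
      have : Continuous fun t : ℝ≥0 => (t : ℝ) * ‖η‖ := by fun_prop
      simpa using (this.tendsto 0).mono_left nhdsWithin_le_nhds
    refine squeeze_zero_norm' ?_ hlim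
    filter_upwards [self_mem_nhdsWithin] with t ht
    have ht : (0 : ℝ) < t := ht
    have hop : (R * (R * (expNegInv R t - expNegInv R 0)) + (t : ℝ) • R) =
        cfc (fun r => r * (r * (expNegDiv t r - 1)) + t * r) R := by
      have hc := expNegDiv.continuous (t : ℝ)
      rw [cfc_add R (fun r => r * (r * (expNegDiv t r - 1))) (fun r => t * r),
        cfc_const_mul_id (t : ℝ) R, mul_sub_eq hR,
        cfc_mul (fun r => r) (fun r => r * (expNegDiv t r - 1)) R, cfc_id' ℝ R]
      simp only [expNegDiv.zero]
    have hnorm : ‖R * (R * (expNegInv R t - expNegInv R 0)) + (t : ℝ) • R‖ ≤ (t : ℝ) ^ 2 := by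
      rw [hop]
      exact norm_cfc_le (by positivity)
        fun r hr => expNegDiv.abs_sq_mul_sub_one_add_le ht.le (hpos r hr)
    have heq : ((((t : ℝ) : ℂ)⁻¹) • (R * (expNegInv R t - expNegInv R 0)) + 1) (R η) =
        (((t : ℝ) : ℂ)⁻¹) • ((R * (R * (expNegInv R t - expNegInv R 0)) + (t : ℝ) • R) η) := by
      have hc : R * (R * (expNegInv R t - expNegInv R 0)) =
          R * (expNegInv R t - expNegInv R 0) * R := by
        rw [mul_assoc, sub_mul, ← commute hR, ← commute hR, ← mul_sub]
      rw [hc]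
      simp only [add_apply, smul_apply, smul_add, one_apply_eq_self, mul_apply_eq_comp]
      rw [← Complex.coe_smul (t : ℝ), smul_smul, inv_mul_cancel₀ (by exact_mod_cast ht.ne'),
        one_smul]
    rw [heq, norm_smul, norm_inv, Complex.norm_real, Real.norm_eq_abs, abs_of_pos ht,
      inv_mul_le_iff₀ ht]
    exact (ContinuousLinearMap.le_of_opNorm_le _ hnorm η).trans_eq (by ring)

/-- The generator of `exp (-t R⁻¹)` is `-R⁻¹`. -/
theorem tendsto_slope_iff (hd : DenseRange R) (ψ φ : H) :
    Tendsto (fun t : ℝ≥0 => (((t : ℝ) : ℂ)⁻¹) • (expNegInv R t ψ - ψ)) (𝓝[>] 0) (𝓝 φ) ↔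
      ψ = -R φ := by
  have hne : (𝓝[>] (0 : ℝ≥0)).NeBot := inferInstance
  constructor
  · intro h
    -- Applying `R` to the convergent difference quotients forces `R φ = -ψ`.
    have h1 := (R.continuous.tendsto φ).comp h
    have h2 := tendsto_mul_sub_one hR hpos hd ψ
    have := tendsto_nhds_unique (h1.congr fun t => by simp) h2
    rw [this, neg_neg]
  · rintro rfl
    have h2 := (tendsto_mul_sub_one hR hpos hd φ).neg
    rw [neg_neg] at h2
    refine h2.congr fun t => ?_
    have : R (expNegInv R t φ) = expNegInv R t (R φ) := DFunLike.congr_fun (commute hR t) φ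
    simp only [map_sub, map_neg, this, ← smul_neg]
    congr 1; abel

/-- Euler's formula, in operator norm. The hypothesis on `P` is the resolvent identity and makes `P
μ` the function `r / (μ r + 1)` of `R`, so the uniform scalar error `2 / m` transfers through the
spectrum. -/
theorem tendsto_resolvent_pow {t : ℝ} (ht : 0 < t) {P : ℝ → H →L[ℂ] H}
    (hP : ∀ μ, 0 < μ → P μ = R - (μ : ℂ) • (R * P μ)) :
    Tendsto (fun m : ℕ => (((2 * m / t : ℝ) : ℂ) • P (2 * m / t)) ^ (2 * m)) atTop
      (𝓝 (expNegInv R t)) := by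
  have hlim : Tendsto (fun m : ℕ => (2 : ℝ) / m) atTop (𝓝 0) :=
    tendsto_const_div_atTop_nhds_zero_nat 2
  rw [tendsto_iff_norm_sub_tendsto_zero]
  refine squeeze_zero' (Eventually.of_forall fun _ => norm_nonneg _) ?_ hlim
  filter_upwards [eventually_gt_atTop 0] with m hm
  have hm' : (0 : ℝ) < m := by exact_mod_cast hm
  set μ : ℝ := 2 * m / t with hμ
  have hμ0 : 0 < μ := by positivity
  have hne : ∀ r ∈ spectrum ℝ R, μ * r + 1 ≠ 0 := fun r hr => by
    have := mul_nonneg hμ0.le (hpos r hr); positivity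
  have hcont : ContinuousOn (fun r : ℝ => r / (μ * r + 1)) (spectrum ℝ R) :=
    ContinuousOn.div (by fun_prop) (by fun_prop) hne
  have hPc : P μ = cfc (fun r : ℝ => r / (μ * r + 1)) R := by
    set Q := cfc (fun r : ℝ => r / (μ * r + 1)) R with hQ
    have hleft : cfc (fun r : ℝ => (μ * r + 1)⁻¹) R * (1 + μ • R) = 1 := by
      have h1 : (1 + μ • R) = cfc (fun r : ℝ => 1 + μ * r) R := by
        rw [cfc_add R (fun _ => 1) (fun r => μ * r), cfc_const_one ℝ R, cfc_const_mul_id μ R]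
      -- The denominator does not vanish on the spectrum, so the inverse of `1 + μ R` lies in the
      -- functional calculus.
      rw [h1, ← cfc_mul (fun r : ℝ => (μ * r + 1)⁻¹) (fun r => 1 + μ * r) R (ContinuousOn.inv₀ (by fun_prop) hne)]
      conv_rhs => rw [← cfc_const_one ℝ R]
      refine cfc_congr fun r hr => ?_
      have := hne r hr
      field_simp
      ring
    have hQ' : Q = cfc (fun r : ℝ => (μ * r + 1)⁻¹) R * R := by
      have := cfc_mul (fun r : ℝ => (μ * r + 1)⁻¹) (fun r => r) R
        (ContinuousOn.inv₀ (by fun_prop) hne)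
      rw [cfc_id' ℝ R] at this
      rw [← this, hQ]
      exact cfc_congr fun r _ => by ring
    have hPe : (1 + μ • R) * P μ = R := by
      have := hP μ hμ0
      rw [add_mul, one_mul, smul_mul_assoc, ← Complex.coe_smul μ]
      nth_rewrite 1 [this]
      abel
    calc P μ = cfc (fun r : ℝ => (μ * r + 1)⁻¹) R * ((1 + μ • R) * P μ) := by
            rw [← mul_assoc, hleft, one_mul]
      _ = Q := by rw [hPe, hQ']
  have hpow : ((μ : ℂ) • P μ) ^ (2 * m) =
      cfc (fun r : ℝ => (μ * (r / (μ * r + 1))) ^ (2 * m)) R := by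
    rw [cfc_pow (fun r : ℝ => μ * (r / (μ * r + 1))) (2 * m) R (continuousOn_const.mul hcont),
      cfc_const_mul μ _ R hcont, ← hPc, Complex.coe_smul]
  rw [hpow, expNegInv, ← cfc_sub (fun r : ℝ => (μ * (r / (μ * r + 1))) ^ (2 * m))
    (expNegDiv t) R ((continuousOn_const.mul hcont).pow _) (expNegDiv.continuous t).continuousOn]
  exact norm_cfc_le (by positivity) fun r hr => expNegDiv.abs_pow_sub_le ht (hpos r hr) hm

end expNegInv

end ExpSemigroup

/-! ### Generation, uniqueness and invariant cones. -/

section Generation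

variable {H : Type*} [NormedAddCommGroup H] [InnerProductSpace ℂ H]

theorem hasDerivWithinAt_norm_sq_complex {w : ℝ → H} {w' : H} {s : ℝ} {S : Set ℝ}
    (h : HasDerivWithinAt w w' S s) :
    HasDerivWithinAt (fun s => ‖w s‖ ^ 2) (2 * (inner ℂ w' (w s)).re) S s := by
  let : InnerProductSpace ℝ H := InnerProductSpace.complexToReal
  have h1 : (inner ℝ (w s) w' : ℝ) = (inner ℂ w' (w s)).re := by
    rw [real_inner_comm]; rfl
  rw [← h1]
  exact HasDerivWithinAt.norm_sq h

/-- Gronwall: `exp (-2 l₀ s) ‖w s‖²` has nonpositive right derivative and starts at `0`. Right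
derivatives are what the definition of the generator supplies. -/
theorem eq_zero_of_dissipative {l₀ : ℝ} {w w' : ℝ → H} (hcont : Continuous w)
    (hderiv : ∀ s : ℝ, 0 ≤ s → HasDerivWithinAt w (w' s) (Set.Ici s) s)
    (hdiss : ∀ s, (inner ℂ (w' s) (w s)).re ≤ l₀ * ‖w s‖ ^ 2) (h0 : w 0 = 0) {t : ℝ}
    (ht : 0 ≤ t) : w t = 0 := by
  have hle := image_le_of_deriv_right_le_deriv_boundary (a := 0) (b := t)
    (f := fun s => Real.exp (-(2 * l₀) * s) * ‖w s‖ ^ 2)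
    (f' := fun s => Real.exp (-(2 * l₀) * s) * (-(2 * l₀)) * ‖w s‖ ^ 2 +
      Real.exp (-(2 * l₀) * s) * (2 * (inner ℂ (w' s) (w s)).re))
    (B := fun _ => 0) (B' := fun _ => 0)
    (Continuous.continuousOn (by fun_prop)) ?_ ?_ continuousOn_const
    (fun x _ => hasDerivWithinAt_const _ _ _) ?_
    (Set.right_mem_Icc.mpr ht)
  · have h0 : ‖w t‖ ^ 2 ≤ 0 := by
      have := Real.exp_pos (-(2 * l₀) * t)
      by_contra! hc
      exact absurd hle (not_le.mpr (mul_pos this hc))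
    rw [← norm_eq_zero]
    exact pow_eq_zero_iff two_ne_zero |>.mp (le_antisymm h0 (by positivity))
  · intro s hs
    have h1 : HasDerivWithinAt (fun s : ℝ => Real.exp (-(2 * l₀) * s))
        (Real.exp (-(2 * l₀) * s) * (-(2 * l₀))) (Set.Ici s) s := by
      have := ((hasDerivAt_id s).const_mul (-(2 * l₀))).exp
      simpa using this.hasDerivWithinAt
    exact h1.mul (hasDerivWithinAt_norm_sq_complex (hderiv s hs.1))
  · simp [h0]
  · intro s _
    have h1 := hdiss s
    have h3 := Real.exp_pos (-(2 * l₀) * s)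
    have h4 : Real.exp (-(2 * l₀) * s) * (-(2 * l₀)) * ‖w s‖ ^ 2 +
      Real.exp (-(2 * l₀) * s) * (2 * (inner ℂ (w' s) (w s)).re) =
      2 * Real.exp (-(2 * l₀) * s) * ((inner ℂ (w' s) (w s)).re - l₀ * ‖w s‖ ^ 2) := by ring
    simp only [h4]
    exact mul_nonpos_of_nonneg_of_nonpos (by positivity) (by linarith)

namespace IsSemigroupGeneratedBy

variable {graph : H → H → Prop} {T : ℝ≥0 → H →L[ℂ] H}

theorem graph_apply (hT : IsSemigroupGeneratedBy T graph) {ψ φ : H} (h : graph ψ φ) (s : ℝ≥0) :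
    graph (T s ψ) (T s φ) := by
  rw [hT.generator] at h ⊢
  refine (((T s).continuous.tendsto φ).comp h).congr fun t => ?_
  have : T t (T s ψ) = T s (T t ψ) := by
    rw [← ContinuousLinearMap.comp_apply, ← ContinuousLinearMap.comp_apply, ← hT.add, ← hT.add,
      add_comm]
  simp [this]

theorem hasDerivWithinAt (hT : IsSemigroupGeneratedBy T graph) {ψ φ : H} (h : graph ψ φ) {s : ℝ}
    (hs : 0 ≤ s) :
    HasDerivWithinAt (fun s : ℝ => T s.toNNReal ψ) (T s.toNNReal φ) (Set.Ici s) s := by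
  have h' := hT.graph_apply h s.toNNReal
  rw [hT.generator] at h'
  rw [hasDerivWithinAt_iff_tendsto_slope, show Set.Ici s \ {s} = Set.Ioi s by
    ext; simp [lt_iff_le_and_ne]]
  have hmap : Tendsto (fun x : ℝ => (x - s).toNNReal) (𝓝[>] s) (𝓝[>] 0) := by
    refine tendsto_nhdsWithin_iff.mpr ⟨?_, ?_⟩
    · have : Continuous fun x : ℝ => (x - s).toNNReal := by fun_prop
      simpa using (this.tendsto s).mono_left nhdsWithin_le_nhds
    · filter_upwards [self_mem_nhdsWithin] with x hx
      simpa using hx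
  refine (h'.comp hmap).congr' ?_
  filter_upwards [self_mem_nhdsWithin] with x hx
  have hx : s < x := hx
  have h1 : x.toNNReal = (x - s).toNNReal + s.toNNReal := by
    rw [← Real.toNNReal_add (by linarith) hs, sub_add_cancel]
  have h2 : (((x - s).toNNReal : ℝ) : ℂ)⁻¹ = ((x - s)⁻¹ : ℝ) := by
    rw [Real.coe_toNNReal _ (by linarith), Complex.ofReal_inv]
  simp only [Function.comp, slope, vsub_eq_sub]
  rw [h2, h1, hT.add, ContinuousLinearMap.comp_apply, Complex.coe_smul]

/-- The difference of two orbits that start at the same vector of the domain solves the dissipative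
equation with zero initial value; density of the domain then gives equality everywhere. -/
theorem unique {l₀ : ℝ} (hdense : Dense {ψ | ∃ φ, graph ψ φ})
    (hsub : ∀ {ψ φ ψ' φ'}, graph ψ φ → graph ψ' φ' → graph (ψ - ψ') (φ - φ'))
    (hdiss : ∀ {ψ φ}, graph ψ φ → (inner ℂ φ ψ).re ≤ l₀ * ‖ψ‖ ^ 2)
    {T' : ℝ≥0 → H →L[ℂ] H} (hT : IsSemigroupGeneratedBy T graph)
    (hT' : IsSemigroupGeneratedBy T' graph) : T = T' := by
  have key : ∀ ψ φ, graph ψ φ → ∀ t, T t ψ = T' t ψ := by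
    intro ψ φ h t
    have := eq_zero_of_dissipative (l₀ := l₀)
      (w := fun s : ℝ => T s.toNNReal ψ - T' s.toNNReal ψ)
      (w' := fun s : ℝ => T s.toNNReal φ - T' s.toNNReal φ)
      (((hT.strongly_continuous ψ).comp continuous_real_toNNReal).sub
        ((hT'.strongly_continuous ψ).comp continuous_real_toNNReal))
      (fun s hs => (hT.hasDerivWithinAt h hs).sub (hT'.hasDerivWithinAt h hs))
      (fun s => hdiss (hsub (hT.graph_apply h _) (hT'.graph_apply h _)))
      (by simp [hT.zero, hT'.zero]) t.coe_nonneg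
    simpa [sub_eq_zero] using this
  funext t
  refine DFunLike.coe_injective ?_
  exact (T t).continuous.ext_on hdense (T' t).continuous fun ψ ⟨φ, h⟩ => key ψ φ h t

end IsSemigroupGeneratedBy

namespace IsSelfAdjointGraph

variable [CompleteSpace H] {graph : H → H → Prop} {l₀ : ℝ}

/-- Since `L = l₀ - R⁻¹`, the semigroup is `exp (l₀ t) exp (-t R⁻¹)`. The product rule at `t = 0`
moves the generator by `l₀`, and multiplication by `exp (-l₀ t)` undoes this for the converse. -/
theorem isSemigroupGeneratedBy_expNegInv (h : IsSelfAdjointGraph graph l₀) {R : H →L[ℂ] H}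
    (hsa : IsSelfAdjoint R) (hR : IsResolventAt graph l₀ R) :
    IsSemigroupGeneratedBy (fun t => (Real.exp (l₀ * t) : ℂ) • expNegInv R t) graph := by
  have hpos : ∀ r ∈ spectrum ℝ R, 0 ≤ r := fun r hr => h.spectrum_nonneg hR hr
  have hd := hsa.denseRange_of_injective fun η => h.resolvent_injective hR
  refine ⟨?_, fun s t => ?_, fun ψ => ?_, fun ψ φ => ?_⟩
  · simp [expNegInv.zero hsa]; rfl
  · ext ψ
    simp only [NNReal.coe_add, expNegInv.add hpos s.coe_nonneg t.coe_nonneg, smul_apply,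
      ContinuousLinearMap.comp_apply, mul_apply_eq_comp, map_smul, smul_smul]
    rw [mul_add, Real.exp_add, Complex.ofReal_mul, mul_comm (Complex.ofReal _)]
  · have h1 := expNegInv.continuous_apply hsa hpos hd ψ
    have h2 : Continuous fun t : ℝ≥0 => ((Real.exp (l₀ * t) : ℝ) : ℂ) := by fun_prop
    exact h2.smul h1
  · have hexp : Tendsto (fun t : ℝ≥0 => ((Real.exp (l₀ * t) : ℝ) : ℂ)) (𝓝[>] 0) (𝓝 1) := by
      have h2 : Continuous fun t : ℝ≥0 => ((Real.exp (l₀ * t) : ℝ) : ℂ) := by fun_prop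
      simpa using (h2.tendsto 0).mono_left nhdsWithin_le_nhds
    have hexp' : Tendsto (fun t : ℝ≥0 => ((Real.exp (-(l₀ * t)) : ℝ) : ℂ)) (𝓝[>] 0) (𝓝 1) := by
      have h2 : Continuous fun t : ℝ≥0 => ((Real.exp (-(l₀ * t)) : ℝ) : ℂ) := by fun_prop
      simpa using (h2.tendsto 0).mono_left nhdsWithin_le_nhds
    have hslope : Tendsto (fun t : ℝ≥0 => ((t : ℝ) : ℂ)⁻¹ * ((Real.exp (l₀ * t) : ℝ) - 1 : ℂ))
        (𝓝[>] 0) (𝓝 l₀) := by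
      have h1 : HasDerivAt (fun x : ℝ => Real.exp (l₀ * x)) l₀ 0 := by
        simpa using ((hasDerivAt_id (0 : ℝ)).const_mul l₀).exp
      have h2 := hasDerivAt_iff_tendsto_slope.mp h1
      have hmap : Tendsto (fun t : ℝ≥0 => (t : ℝ)) (𝓝[>] 0) (𝓝[≠] 0) := by
        refine tendsto_nhdsWithin_iff.mpr ⟨?_, ?_⟩
        · simpa using (NNReal.continuous_coe.tendsto 0).mono_left nhdsWithin_le_nhds
        · filter_upwards [self_mem_nhdsWithin] with t ht
          have : 0 < t := ht
          simpa using this.ne'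
      have h3 := (Complex.continuous_ofReal.tendsto l₀).comp (h2.comp hmap)
      refine h3.congr fun t => ?_
      simp [slope]
    have heq : ∀ t : ℝ≥0, (((t : ℝ) : ℂ)⁻¹) • (((Real.exp (l₀ * t) : ℝ) : ℂ) • expNegInv R t ψ - ψ) =
        ((Real.exp (l₀ * t) : ℝ) : ℂ) • ((((t : ℝ) : ℂ)⁻¹) • (expNegInv R t ψ - ψ)) +
        (((t : ℝ) : ℂ)⁻¹ * ((Real.exp (l₀ * t) : ℝ) - 1 : ℂ)) • ψ := fun t => by module
    have hiff := expNegInv.tendsto_slope_iff hsa hpos hd ψ (φ - (l₀ : ℂ) • ψ)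
    rw [hR, show (l₀ : ℂ) • ψ - φ = -(φ - (l₀ : ℂ) • ψ) by abel, map_neg, ← hiff]
    simp only [smul_apply, heq]
    constructor
    · intro hlim
      have := (hexp.smul hlim).add (hslope.smul_const ψ)
      simpa using this
    · intro hlim
      have := hexp'.smul (hlim.sub (hslope.smul_const ψ))
      rw [one_smul] at this
      refine this.congr fun t => ?_
      rw [add_sub_cancel_right, smul_smul, ← Complex.ofReal_mul, ← Real.exp_add]
      simp

/-- Nonnegativity of `R`, tested on the vector `(l₀ - L) ψ`. -/
theorem dissipative (h : IsSelfAdjointGraph graph l₀) {ψ φ : H} (hψ : graph ψ φ) :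
    (inner ℂ φ ψ).re ≤ l₀ * ‖ψ‖ ^ 2 := by
  obtain ⟨R, hsa, hR⟩ := h.exists_resolvent le_rfl
  have hnn : 0 ≤ R := by
    have := StarOrderedRing.nonneg_iff_spectrum_nonneg (R := ℝ) R hsa
    exact this.mpr fun r hr => h.spectrum_nonneg hR hr
  have hp := (ContinuousLinearMap.nonneg_iff_isPositive R).mp hnn
  have h1 := hp.inner_nonneg_right ((l₀ : ℂ) • ψ - φ)
  rw [← (hR ψ φ).mp hψ, inner_sub_left, inner_smul_left, Complex.conj_ofReal,
    inner_self_eq_norm_sq_to_K] at h1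
  have h2 := (Complex.le_def.mp h1).1
  simp only [Complex.zero_re, Complex.sub_re] at h2
  have h3 : ((l₀ : ℂ) * ((‖ψ‖ : ℝ) : ℂ) ^ 2).re = l₀ * ‖ψ‖ ^ 2 := by
    rw [← Complex.ofReal_pow, ← Complex.ofReal_mul, Complex.ofReal_re]
  have h4 : ((l₀ : ℂ) * (RCLike.ofReal ‖ψ‖ : ℂ) ^ 2).re = l₀ * ‖ψ‖ ^ 2 := h3
  linarith

/-- A selfadjoint operator that is bounded above generates exactly one semigroup. -/
theorem existsUnique_semigroup (h : IsSelfAdjointGraph graph l₀) :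
    ∃! T : ℝ≥0 → H →L[ℂ] H, IsSemigroupGeneratedBy T graph := by
  obtain ⟨R, hsa, hR⟩ := h.exists_resolvent le_rfl
  refine ⟨_, h.isSemigroupGeneratedBy_expNegInv hsa hR, fun T hT => ?_⟩
  refine IsSemigroupGeneratedBy.unique (l₀ := l₀) ?_ h.sub h.dissipative hT
    (h.isSemigroupGeneratedBy_expNegInv hsa hR)
  refine (hsa.denseRange_of_injective fun η => h.resolvent_injective hR).mono ?_
  rintro _ ⟨η, rfl⟩
  exact ⟨(l₀ : ℂ) • R η - η, (hR _ _).mpr (by rw [sub_sub_cancel])⟩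

/-- The semigroup leaves a closed cone invariant if the resolvents do. -/
theorem semigroup_mem_cone (h : IsSelfAdjointGraph graph l₀) {T : ℝ≥0 → H →L[ℂ] H}
    (hT : IsSemigroupGeneratedBy T graph) {C : Set H} (hC : IsClosed C)
    (hsmul : ∀ c : ℝ, 0 ≤ c → ∀ ψ ∈ C, (c : ℂ) • ψ ∈ C) {l₁ : ℝ}
    (hres : ∀ l : ℝ, l₁ ≤ l → ∀ ψ η, graph ψ ((l : ℂ) • ψ - η) → η ∈ C → ψ ∈ C)
    {t : ℝ≥0} (ht : 0 < t) {ψ : H} (hψ : ψ ∈ C) : T t ψ ∈ C := by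
  obtain ⟨R, hsa, hR⟩ := h.exists_resolvent le_rfl
  rw [h.existsUnique_semigroup.unique hT (h.isSemigroupGeneratedBy_expNegInv hsa hR)]
  refine hsmul _ (Real.exp_pos _).le _ ?_
  have hpos : ∀ r ∈ spectrum ℝ R, 0 ≤ r := fun r hr => h.spectrum_nonneg hR hr
  -- The zero operator at `μ ≤ 0` only makes the choice total; Euler's formula uses `μ = 2m / t >
  -- 0`.
  have hex : ∀ μ : ℝ, ∃ P : H →L[ℂ] H, 0 < μ → IsResolventAt graph (l₀ + μ) P := by
    intro μ
    by_cases hμ : 0 < μ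
    · obtain ⟨P, -, hP⟩ := h.exists_resolvent (l := l₀ + μ) (by linarith)
      exact ⟨P, fun _ => hP⟩
    · exact ⟨0, fun h => absurd h hμ⟩
  choose P hP using hex
  have hgraph : ∀ μ, 0 < μ → ∀ η, graph (P μ η) (((l₀ + μ : ℝ) : ℂ) • P μ η - η) :=
    fun μ hμ η => (hP μ hμ _ _).mpr (by rw [sub_sub_cancel])
  have hPR : ∀ μ, 0 < μ → P μ = R - (μ : ℂ) • (R * P μ) := by
    intro μ hμ
    ext η
    have := (hR _ _).mp (hgraph μ hμ η)
    rw [show (l₀ : ℂ) • P μ η - (((l₀ + μ : ℝ) : ℂ) • P μ η - η) = η - (μ : ℂ) • P μ η by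
      push_cast; module, map_sub, map_smul] at this
    exact this
  have ht' : (0 : ℝ) < t := ht
  have hlim := expNegInv.tendsto_resolvent_pow hsa hpos ht' hPR
  have hlim' : Tendsto (fun m : ℕ => ((((2 * m / t : ℝ) : ℂ) • P (2 * m / t)) ^ (2 * m)) ψ) atTop
      (𝓝 (expNegInv R t ψ)) :=
    ((ContinuousLinearMap.apply ℂ H ψ).continuous.tendsto _).comp hlim
  refine hC.mem_of_tendsto hlim' ?_
  have hμlim : Tendsto (fun m : ℕ => (2 * m / t : ℝ)) atTop atTop :=
    (tendsto_natCast_atTop_atTop.const_mul_atTop (by norm_num : (0 : ℝ) < 2)).atTop_div_const ht'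
  -- For these `m` the parameter `l₀ + 2m / t` is at least `l₁`, so every factor of the power maps
  -- the cone into itself.
  filter_upwards [hμlim.eventually_ge_atTop (l₁ - l₀), hμlim.eventually_gt_atTop 0] with m hm hm0
  have hstep : ∀ η ∈ C, (((2 * m / t : ℝ) : ℂ) • P (2 * m / t)) η ∈ C := fun η hη =>
    hsmul _ hm0.le _ (hres _ (by linarith) _ η (hgraph _ hm0 η) hη)
  generalize 2 * m = n
  induction n with
  | zero => simpa using hψ
  | succ n ih =>
    rw [pow_succ']
    exact hstep _ ih

end IsSelfAdjointGraph

end Generation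

/-! ### Linear algebra of isotropic subspaces and their response matrices. -/

section BoundaryConditions

variable {n : Type*} [Fintype n]

theorem sympForm_add_smul (p q p' q' : Double n) (x y : ℂ) :
    sympForm (p + x • q) (p' + y • q') = sympForm p p' + y * sympForm p q' +
      star x * sympForm q p' + star x * y * sympForm q q' := by
  simp only [sympForm, Prod.fst_add, Prod.snd_add, Prod.smul_fst, Prod.smul_snd, star_add,
    star_smul, add_dotProduct, dotProduct_add, smul_dotProduct, dotProduct_smul, smul_eq_mul]
  ring

theorem sympForm_swap (p q : Double n) : sympForm q p = -star (sympForm p q) := by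
  rw [sympForm, sympForm, star_sub, ← Matrix.star_dotProduct, ← Matrix.star_dotProduct, neg_sub]

theorem re_star_dotProduct_comm (c d : n → ℂ) : (star c ⬝ᵥ d).re = (star d ⬝ᵥ c).re := by
  rw [Matrix.star_dotProduct, Complex.star_def, Complex.conj_re]

theorem re_star_dotProduct_self (c : n → ℂ) : (star c ⬝ᵥ c).re = ∑ h, ‖c h‖ ^ 2 := by
  simp [dotProduct, ← Complex.normSq_eq_norm_sq, Complex.normSq_apply]

theorem norm_star_dotProduct_mulVec_le {b : ℝ} {P : Matrix n n ℝ}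
    (hb : ∀ h k, |P h k| ≤ b) (c : n → ℂ) :
    ‖star c ⬝ᵥ (P.map Complex.ofReal *ᵥ c)‖ ≤ Fintype.card n * b * ∑ h, ‖c h‖ ^ 2 := by
  have h1 : ∀ h k, ‖c h‖ * (b * ‖c k‖) ≤ b * ((‖c h‖ ^ 2 + ‖c k‖ ^ 2) / 2) := by
    intro h k
    have hb0 : 0 ≤ b := (abs_nonneg _).trans (hb h k)
    nlinarith [mul_nonneg hb0 (sq_nonneg (‖c h‖ - ‖c k‖))]
  calc ‖star c ⬝ᵥ (P.map Complex.ofReal *ᵥ c)‖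
      ≤ ∑ h, ‖c h‖ * ∑ k, b * ‖c k‖ := by
        refine (norm_sum_le _ _).trans (Finset.sum_le_sum fun h _ => ?_)
        rw [norm_mul, Pi.star_apply, norm_star]
        refine mul_le_mul_of_nonneg_left ?_ (norm_nonneg _)
        refine (norm_sum_le _ _).trans (Finset.sum_le_sum fun k _ => ?_)
        rw [norm_mul]
        refine mul_le_mul_of_nonneg_right ?_ (norm_nonneg _)
        exact (Complex.norm_real _).trans_le (hb h k)
    _ ≤ ∑ h, ∑ k, b * ((‖c h‖ ^ 2 + ‖c k‖ ^ 2) / 2) := by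
        refine Finset.sum_le_sum fun h _ => ?_
        rw [Finset.mul_sum]
        exact Finset.sum_le_sum fun k _ => h1 h k
    _ = Fintype.card n * b * ∑ h, ‖c h‖ ^ 2 := by
        simp only [← Finset.mul_sum, ← Finset.sum_div, Finset.sum_add_distrib, Finset.sum_const,
          Finset.card_univ, nsmul_eq_mul]
        ring

/-- The form `⟨χ₁, χ₂⟩` is bounded below on an isotropic subspace. -/
theorem IsIsotropic.exists_lower_bound {M : Submodule ℂ (Double n)} (hM : IsIsotropic M) :
    ∃ l : ℝ, 0 ≤ l ∧ ∀ p ∈ M, -(l * ∑ h, ‖p.1 h‖ ^ 2) ≤ (star p.1 ⬝ᵥ p.2).re := by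
  let π : M →ₗ[ℂ] (n → ℂ) := (LinearMap.fst ℂ _ _).comp M.subtype
  -- A linear lift of the first component back into `M`, extended to all of `ℂⁿ`. Pairing `p` with
  -- the lift of `p.1`, isotropy gives `⟨p.2, p.1⟩ = ⟨p.1, L p.1⟩`, so the form depends on `p.1`
  -- alone and is bounded by the norm of `L`.
  obtain ⟨g, hg⟩ := π.rangeRestrict.exists_rightInverse_of_surjective π.range_rangeRestrict
  obtain ⟨g', hg'⟩ := LinearMap.exists_extend g
  let L : (n → ℂ) →ₗ[ℂ] (n → ℂ) := ((LinearMap.snd ℂ _ _).comp M.subtype).comp g'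
  have hL : ∀ p ∈ M, (p.1, L p.1) ∈ M := by
    intro p hp
    have h1 : p.1 ∈ LinearMap.range π := ⟨⟨p, hp⟩, rfl⟩
    have h2 : g' p.1 = g ⟨p.1, h1⟩ := by rw [← hg']; rfl
    have h3 : π (g' p.1) = p.1 := by
      rw [h2]
      exact congrArg Subtype.val (LinearMap.congr_fun hg ⟨p.1, h1⟩)
    have h4 : (p.1, L p.1) = (g' p.1 : Double n) := Prod.ext h3.symm rfl
    rw [h4]
    exact (g' p.1).2
  let L' := LinearMap.toContinuousLinearMap L
  refine ⟨Fintype.card n * ‖L'‖, by positivity, fun p hp => ?_⟩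
  have h1 := hM p hp _ (hL p hp)
  rw [sympForm, sub_eq_zero] at h1
  rw [re_star_dotProduct_comm, ← h1, neg_le]
  have hsup : ‖p.1‖ ^ 2 ≤ ∑ h, ‖p.1 h‖ ^ 2 := by
    have hs : 0 ≤ ∑ h, ‖p.1 h‖ ^ 2 := Finset.sum_nonneg fun _ _ => by positivity
    rw [← Real.le_sqrt (norm_nonneg _) hs, pi_norm_le_iff_of_nonneg (Real.sqrt_nonneg _)]
    intro h
    rw [Real.le_sqrt (norm_nonneg _) hs]
    exact Finset.single_le_sum (f := fun h => ‖p.1 h‖ ^ 2) (fun _ _ => by positivity)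
      (Finset.mem_univ h)
  calc -(star p.1 ⬝ᵥ L p.1).re ≤ ‖star p.1 ⬝ᵥ L p.1‖ := by
        rw [← Complex.neg_re, ← norm_neg]; exact Complex.re_le_norm _
    _ ≤ ∑ h : n, ‖p.1‖ * (‖L'‖ * ‖p.1‖) := by
        refine (norm_sum_le _ _).trans (Finset.sum_le_sum fun h _ => ?_)
        rw [norm_mul, Pi.star_apply, norm_star]
        exact mul_le_mul (norm_le_pi_norm p.1 h)
          ((norm_le_pi_norm (L p.1) h).trans (L'.le_opNorm p.1)) (norm_nonneg _) (norm_nonneg _)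
    _ = Fintype.card n * ‖L'‖ * ‖p.1‖ ^ 2 := by
        rw [Finset.sum_const, Finset.card_univ, nsmul_eq_mul]; ring
    _ ≤ _ := mul_le_mul_of_nonneg_left hsup (by positivity)

/-- If `χ₁ ⊕ χ₂ ↦ χ₂ + Q χ₁` were not onto, some `e ≠ 0` would be orthogonal to its range. Then `(e,
-Q e)` is `ω`-orthogonal to `M`, and to itself because `Q` is symmetric; maximality puts it in `M`,
against the injectivity hypothesis. -/
theorem IsMaximalIsotropic.exists_mem [DecidableEq n] {M : Submodule ℂ (Double n)}
    (hM : IsMaximalIsotropic M) (Q : (n → ℂ) →ₗ[ℂ] (n → ℂ))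
    (hsymm : ∀ c c', star c ⬝ᵥ Q c' = star (Q c) ⬝ᵥ c')
    (hinj : ∀ c, (c, -Q c) ∈ M → c = 0) (d : n → ℂ) : ∃ c, (c, d - Q c) ∈ M := by
  let Φ : M →ₗ[ℂ] (n → ℂ) :=
    (LinearMap.snd ℂ _ _ + Q.comp (LinearMap.fst ℂ _ _)).comp M.subtype
  suffices hr : LinearMap.range Φ = ⊤ by
    obtain ⟨p, hp⟩ := LinearMap.range_eq_top.mp hr d
    refine ⟨p.1.1, ?_⟩
    have : p.1.2 + Q p.1.1 = d := hp
    rw [← this, add_sub_cancel_right]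
    exact p.2
  by_contra hne
  obtain ⟨f, hf0, hf⟩ := Submodule.exists_le_ker_of_lt_top _ (lt_top_iff_ne_top.mpr hne)
  let e : n → ℂ := fun i => star (f (fun j => if i = j then 1 else 0))
  have hfe : ∀ x, f x = star e ⬝ᵥ x := fun x => by
    rw [LinearMap.pi_apply_eq_sum_univ f x]
    simp [e, dotProduct, mul_comm]
  have horth : ∀ p ∈ M, sympForm (e, -Q e) p = 0 := by
    intro p hp
    have h1 : f (p.2 + Q p.1) = 0 := hf ⟨⟨p, hp⟩, rfl⟩
    rw [hfe, dotProduct_add, hsymm] at h1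
    simpa [sympForm] using h1
  have hself : sympForm (e, -Q e) (e, -Q e) = 0 := by
    simp [sympForm, hsymm]
  have hiso : IsIsotropic (M ⊔ Submodule.span ℂ {((e, -Q e) : Double n)}) := by
    intro p hp q hq
    obtain ⟨p', hp', p'', hp'', rfl⟩ := Submodule.mem_sup.mp hp
    obtain ⟨q', hq', q'', hq'', rfl⟩ := Submodule.mem_sup.mp hq
    obtain ⟨x, rfl⟩ := Submodule.mem_span_singleton.mp hp''
    obtain ⟨y, rfl⟩ := Submodule.mem_span_singleton.mp hq''
    rw [sympForm_add_smul, hM.prop p' hp' q' hq', horth q' hq', hself,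
      sympForm_swap (e, -Q e) p', horth p' hp']
    simp
  have hmem : ((e, -Q e) : Double n) ∈ M :=
    hM.le_of_ge hiso le_sup_left
      (Submodule.mem_sup_right (Submodule.mem_span_singleton_self _))
  have he := hinj e hmem
  apply hf0
  refine LinearMap.ext fun x => ?_
  simp [hfe, he]

/-- Solvability of the boundary equations for a large multiple of the identity, perturbed by a
bounded symmetric matrix. -/
theorem IsMaximalIsotropic.exists_solution [DecidableEq n] {M : Submodule ℂ (Double n)}
    (hM : IsMaximalIsotropic M) (b : ℝ) :
    ∃ κ₀ : ℝ, ∀ κ, κ₀ ≤ κ → ∀ P : Matrix n n ℝ, P.IsSymm → (∀ h k, |P h k| ≤ b) →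
      ∀ d, ∃ c, (c, d - ((κ : ℂ) • c - P.map Complex.ofReal *ᵥ c)) ∈ M := by
  obtain ⟨l, hl0, hl⟩ := hM.prop.exists_lower_bound
  -- For `(c, -Q c) ∈ M` the lower bound reads `-l |c|² ≤ -κ |c|² + Re ⟨c, P c⟩`, and the last term
  -- is at most `n b |c|²`; this threshold leaves `|c|² ≤ 0`.
  refine ⟨l + Fintype.card n * b + 1, fun κ hκ P hP hb d => ?_⟩
  let Q : (n → ℂ) →ₗ[ℂ] (n → ℂ) :=
    (κ : ℂ) • LinearMap.id - (P.map Complex.ofReal).mulVecLin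
  have hQ : ∀ c, Q c = (κ : ℂ) • c - P.map Complex.ofReal *ᵥ c := fun c => rfl
  have hPH : (P.map Complex.ofReal)ᴴ = P.map Complex.ofReal := by
    ext h k
    simp [Matrix.conjTranspose_apply, hP.apply]
  refine hM.exists_mem Q (fun c c' => ?_) (fun c hc => ?_) d
  · rw [hQ, hQ, star_sub, star_smul, dotProduct_sub, sub_dotProduct, dotProduct_smul,
      smul_dotProduct, Matrix.star_mulVec, hPH, Matrix.dotProduct_mulVec]
    simp
  · have h1 := hl _ hc
    have h2 := norm_star_dotProduct_mulVec_le hb c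
    have h3 := (Complex.re_le_norm _).trans h2
    simp only [hQ, neg_sub, dotProduct_sub, dotProduct_smul, Complex.sub_re, smul_eq_mul,
      Complex.re_ofReal_mul, re_star_dotProduct_self] at h1
    have h4 : 0 ≤ ∑ h, ‖c h‖ ^ 2 := Finset.sum_nonneg fun _ _ => by positivity
    have h5 : ∑ h, ‖c h‖ ^ 2 ≤ 0 := by nlinarith
    have h6 := (Finset.sum_eq_zero_iff_of_nonneg fun h _ => by positivity).mp (le_antisymm h5 h4)
    ext h
    simpa using h6 h (Finset.mem_univ h)

/-- `(c, d - κ c) ∈ M` if and only if `c = K d` for a matrix `K` with nonnegative entries. -/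
def HasNonnegResponse (M : Submodule ℂ (Double n)) (κ : ℝ) : Prop :=
  ∃ K : Matrix n n ℝ, (∀ h k, 0 ≤ K h k) ∧
    ∀ c d, (c, d - (κ : ℂ) • c) ∈ M ↔ c = K.map Complex.ofReal *ᵥ d

/-- At `k = iκ` the invertible matrix is `N = A - κ B`, and `N (1 + 𝔖) = N - (A + κ B) = -2κ B`.
Multiplying the right-hand equation by `N` turns it into `A c + B (d - κ c) = 0`. -/
theorem IsScatteringMatrix.mem_iff [DecidableEq n] {M : Submodule ℂ (Double n)} {κ : ℝ}
    (hκ : 0 < κ) {S : Matrix n n ℂ} (hS : IsScatteringMatrix (Complex.I * κ) M S) (c d : n → ℂ) :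
    (c, d - (κ : ℂ) • c) ∈ M ↔ (2 * κ : ℂ) • c = (1 + S) *ᵥ d := by
  obtain ⟨A, B, -, rfl, hu, rfl⟩ := hS
  have hI : Complex.I * (Complex.I * κ) = -(κ : ℂ) := by
    rw [← mul_assoc, Complex.I_mul_I, neg_one_mul]
  rw [hI] at hu ⊢
  set N := A + (-(κ : ℂ)) • B with hN
  have hκ' : (2 * κ : ℂ) ≠ 0 := by
    have : (κ : ℂ) ≠ 0 := by exact_mod_cast hκ.ne'
    simpa using this
  have hdet : IsUnit N.det := (Matrix.isUnit_iff_isUnit_det N).mp hu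
  have h1 : N * (1 + -(N⁻¹ * (A - (-(κ : ℂ)) • B))) = -((2 * κ : ℂ) • B) := by
    rw [mul_add, mul_one, mul_neg, ← mul_assoc, Matrix.mul_nonsing_inv _ hdet, one_mul, hN]
    module
  have h2 : (2 * κ : ℂ) • c = (1 + -(N⁻¹ * (A - (-(κ : ℂ)) • B))) *ᵥ d ↔
      N *ᵥ ((2 * κ : ℂ) • c) = N *ᵥ ((1 + -(N⁻¹ * (A - (-(κ : ℂ)) • B))) *ᵥ d) :=
    (Matrix.mulVec_injective_of_isUnit hu).eq_iff.symm
  rw [h2, Matrix.mulVec_mulVec, h1, Matrix.neg_mulVec, Matrix.smul_mulVec, Matrix.mulVec_smul,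
    ← smul_neg, (smul_right_injective _ hκ').eq_iff]
  simp only [bcSubspace, LinearMap.mem_ker, LinearMap.coprod_apply, Matrix.mulVecLin_apply, hN,
    Matrix.mulVec_sub, Matrix.mulVec_smul, Matrix.add_mulVec, Matrix.smul_mulVec]
  constructor <;> intro h
  · linear_combination (norm := module) h
  · linear_combination (norm := module) h

theorem hasNonnegResponse_of_isScatteringMatrix [DecidableEq n] {M : Submodule ℂ (Double n)}
    {κ : ℝ} (hκ : 0 < κ) {S : Matrix n n ℂ} (hS : IsScatteringMatrix (Complex.I * κ) M S)
    (hpos : ∀ i j, 0 ≤ (1 + S) i j) : HasNonnegResponse M κ := by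
  refine ⟨Matrix.of fun i j => ((1 + S) i j).re / (2 * κ), fun h k => ?_, fun c d => ?_⟩
  · exact div_nonneg (Complex.le_def.mp (hpos h k)).1 (by positivity)
  · have hκ' : (2 * κ : ℂ) ≠ 0 := by
      have : (κ : ℂ) ≠ 0 := by exact_mod_cast hκ.ne'
      simpa using this
    have h1 : 1 + S = (2 * κ : ℂ) •
        (Matrix.of fun i j => ((1 + S) i j).re / (2 * κ)).map Complex.ofReal := by
      ext i j
      have h2 : (1 + S) i j = (((1 + S) i j).re : ℂ) :=
        Complex.eq_re_of_ofReal_le (r := 0) (by simpa using hpos i j)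
      rw [Matrix.smul_apply, Matrix.map_apply, Matrix.of_apply, h2]
      push_cast [Complex.ofReal_re]
      rw [smul_eq_mul, mul_div_cancel₀ _ hκ']
    rw [hS.mem_iff hκ, h1, Matrix.smul_mulVec, (smul_right_injective _ hκ').eq_iff, ← h1]

/-- Discrete minimum principle: at an index `m` where `r` is smallest, `r m < 0` would give `(X r) m
≥ (∑ X m k) r m > r m`. -/
theorem nonneg_of_mulVec_le {X : Matrix n n ℝ} (hX : ∀ h k, 0 ≤ X h k)
    (hrow : ∀ h, ∑ k, X h k < 1) {r : n → ℝ} (hr : ∀ h, (X *ᵥ r) h ≤ r h) (h : n) : 0 ≤ r h := by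
  have : Nonempty n := ⟨h⟩
  obtain ⟨m, hm⟩ := Finite.exists_min r
  refine le_trans ?_ (hm h)
  by_contra! hneg
  have h1 : (∑ k, X m k) * r m ≤ (X *ᵥ r) m := by
    rw [Finset.sum_mul]
    exact Finset.sum_le_sum fun k _ => mul_le_mul_of_nonneg_left (hm k) (hX m k)
  have := hr m
  have := hrow m
  nlinarith

/-- Moving `P c` to the data gives `c = K P c + K d`. The entries of `K` are at most `1 / (κ - l)`,
so for large `κ` the row sums of `K P` are below `1` and the minimum principle applies. -/
theorem HasNonnegResponse.perturb [DecidableEq n] {M : Submodule ℂ (Double n)}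
    (hM : IsMaximalIsotropic M) (b : ℝ) :
    ∃ κ₀ : ℝ, ∀ κ, κ₀ ≤ κ → HasNonnegResponse M κ →
      ∀ P : Matrix n n ℝ, (∀ h k, 0 ≤ P h k) → (∀ h k, P h k ≤ b) →
      ∀ c d, (c, d - ((κ : ℂ) • c - P.map Complex.ofReal *ᵥ c)) ∈ M →
        (∀ h, 0 ≤ d h) → ∀ h, 0 ≤ c h := by
  obtain ⟨l, hl0, hl⟩ := hM.prop.exists_lower_bound
  -- Makes the row sum bound `n² |b| / (κ - l)` for `K P` strictly less than `1`.
  refine ⟨l + Fintype.card n * (Fintype.card n * |b|) + 1, fun κ hκ hresp P hP hPb c d hc hd => ?_⟩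
  obtain ⟨K, hK, hKM⟩ := hresp
  obtain ⟨N, hN⟩ : ∃ N : ℝ, (Fintype.card n : ℝ) = N := ⟨_, rfl⟩
  rw [hN] at hκ
  have hN0 : 0 ≤ N := hN ▸ Nat.cast_nonneg _
  have hκl : 0 < κ - l := by
    have : 0 ≤ N * (N * |b|) := by positivity
    linarith
  have hKb : ∀ h k, K h k ≤ (κ - l)⁻¹ := by
    intro h k
    let e : n → ℂ := Pi.single k 1
    set f : n → ℂ := K.map Complex.ofReal *ᵥ e with hf
    have hfh : ∀ h, f h = K h k := fun h => by simp [hf, e]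
    -- Testing the lower bound on the column `f = K e` gives `(κ - l) |f|² ≤ K k k`. This bounds the
    -- diagonal entry first, and then every entry of the column.
    have h1 := hl _ ((hKM f e).mpr rfl)
    have h2 : (star f ⬝ᵥ e).re = K k k := by simp [e, hfh]
    simp only [dotProduct_sub, dotProduct_smul, Complex.sub_re, smul_eq_mul,
      Complex.re_ofReal_mul, re_star_dotProduct_self, h2] at h1
    have h3 : ∀ h, K h k ^ 2 ≤ ∑ h, ‖f h‖ ^ 2 := fun h => by
      have : ‖f h‖ ^ 2 = K h k ^ 2 := by
        rw [hfh, Complex.norm_real, Real.norm_eq_abs, sq_abs]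
      rw [← this]
      exact Finset.single_le_sum (f := fun h => ‖f h‖ ^ 2) (fun _ _ => by positivity)
        (Finset.mem_univ h)
    have h4 : ∀ h, (κ - l) * K h k ^ 2 ≤ K k k := fun h => by nlinarith [h3 h]
    have h5 : K k k ≤ (κ - l)⁻¹ := by
      rw [← mul_one (_⁻¹), le_inv_mul_iff₀ hκl]
      by_contra! hc
      nlinarith [h4 k, hK k k]
    refine abs_le_of_sq_le_sq' ?_ (by positivity) |>.2
    refine le_of_mul_le_mul_left ((h4 h).trans (h5.trans_eq ?_)) hκl
    field_simp
  set X := K * P with hX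
  have hX0 : ∀ h k, 0 ≤ X h k := fun h k =>
    Finset.sum_nonneg fun l _ => mul_nonneg (hK h l) (hP l k)
  have hXrow : ∀ h, ∑ k, X h k < 1 := by
    intro h
    have h1 : ∀ k, X h k ≤ N * ((κ - l)⁻¹ * |b|) := fun k => by
      calc X h k ≤ ∑ _l : n, (κ - l)⁻¹ * |b| := Finset.sum_le_sum fun l _ =>
            mul_le_mul (hKb h l) ((hPb l k).trans (le_abs_self b)) (hP l k) (by positivity)
        _ = N * ((κ - l)⁻¹ * |b|) := by
            rw [Finset.sum_const, Finset.card_univ, nsmul_eq_mul, hN]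
    calc ∑ k, X h k ≤ ∑ _k : n, N * ((κ - l)⁻¹ * |b|) := Finset.sum_le_sum fun k _ => h1 k
      _ = (κ - l)⁻¹ * (N * (N * |b|)) := by
          rw [Finset.sum_const, Finset.card_univ, nsmul_eq_mul, hN]; ring
      _ < 1 := by
          rw [inv_mul_lt_iff₀ hκl]; linarith
  have hceq : c = X.map Complex.ofReal *ᵥ c + K.map Complex.ofReal *ᵥ d := by
    have h1 : d - ((κ : ℂ) • c - P.map Complex.ofReal *ᵥ c) =
        (d + P.map Complex.ofReal *ᵥ c) - (κ : ℂ) • c := by abel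
    rw [h1, hKM] at hc
    rw [Matrix.mulVec_add, Matrix.mulVec_mulVec] at hc
    have h2 : K.map Complex.ofReal * P.map Complex.ofReal = X.map Complex.ofReal :=
      (Matrix.map_mul (f := Complex.ofRealHom)).symm
    rw [h2, add_comm] at hc
    exact hc
  have hdre : ∀ h, 0 ≤ (d h).re ∧ (d h).im = 0 := fun h =>
    ⟨(Complex.le_def.mp (hd h)).1, (Complex.le_def.mp (hd h)).2.symm⟩
  have hre : ∀ h, (c h).re = (X *ᵥ fun k => (c k).re) h + (K *ᵥ fun k => (d k).re) h := by
    intro h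
    have := congrArg Complex.re (congrFun hceq h)
    simpa [Matrix.mulVec, dotProduct] using this
  have him : ∀ h, (c h).im = (X *ᵥ fun k => (c k).im) h := by
    intro h
    have := congrArg Complex.im (congrFun hceq h)
    simpa [Matrix.mulVec, dotProduct, (hdre _).2] using this
  intro h
  have h1 := nonneg_of_mulVec_le hX0 hXrow (r := fun k => (c k).re) (fun h => by
    rw [hre h]
    have : 0 ≤ (K *ᵥ fun k => (d k).re) h :=
      Finset.sum_nonneg fun k _ => mul_nonneg (hK h k) (hdre k).1
    linarith) h
  -- The data are real, so both `Im c` and `-Im c` are fixed by `X`; both are therefore nonnegative,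
  -- and `c` is real.
  have h2 := nonneg_of_mulVec_le hX0 hXrow (r := fun k => (c k).im) (fun h => (him h).ge) h
  have h3 := nonneg_of_mulVec_le hX0 hXrow (r := -fun k => (c k).im) (fun h => by
    rw [Matrix.mulVec_neg, Pi.neg_apply, Pi.neg_apply, him h]) h
  simp only [Pi.neg_apply] at h3
  exact Complex.le_def.mpr ⟨h1, by simp; linarith⟩

theorem IsPositiveBC.eventually_hasNonnegResponse [DecidableEq n] {M : Submodule ℂ (Double n)}
    (h : IsPositiveBC M) : ∀ᶠ κ in atTop, HasNonnegResponse M κ := by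
  obtain ⟨κ₀, -, h⟩ := h
  filter_upwards [eventually_ge_atTop κ₀, eventually_gt_atTop 0] with κ h1 h2
  obtain ⟨S, hS, hpos⟩ := h κ h1
  exact hasNonnegResponse_of_isScatteringMatrix h2 hS hpos

theorem IsStrictlyPositiveBC.isPositiveBC [DecidableEq n] {M : Submodule ℂ (Double n)}
    (h : IsStrictlyPositiveBC M) : IsPositiveBC M := by
  obtain ⟨κ₀, h0, h⟩ := h
  refine ⟨κ₀, h0, fun κ hκ => ?_⟩
  obtain ⟨S, hS, hpos⟩ := h κ hκ
  exact ⟨S, hS, fun i j => (hpos i j).le⟩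

end BoundaryConditions

/-- The response matrices of the vertices assemble to a block-diagonal one, with zero entries
between ends at different vertices. -/
theorem QGraph.IsLocallyStrictlyPositive.eventually_hasNonnegResponse {V I E : Type*}
    [DecidableEq V] [Fintype I] [DecidableEq I] [Fintype E] [DecidableEq E] {G : QGraph V I E}
    {M : Submodule ℂ (Double (EdgeEnd I E))} (h : G.IsLocallyStrictlyPositive M) :
    ∀ᶠ κ in atTop, HasNonnegResponse M κ := by
  obtain ⟨Mv, ⟨-, hdec⟩, κ₀, -, h⟩ := h
  filter_upwards [eventually_ge_atTop κ₀, eventually_gt_atTop 0] with κ h1 h2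
  have hloc : ∀ v, HasNonnegResponse (Mv v) κ := fun v => by
    obtain ⟨S, hS, hpos⟩ := h κ h1 v
    exact hasNonnegResponse_of_isScatteringMatrix h2 hS fun i j => (hpos i j).le
  choose K hK hKM using hloc
  refine ⟨Matrix.of fun h k => if hk : G.endVertex k = G.endVertex h then
    K (G.endVertex h) ⟨h, rfl⟩ ⟨k, hk⟩ else 0, fun h k => ?_, fun c d => ?_⟩
  · rw [Matrix.of_apply]
    split_ifs
    · exact hK _ _ _
    · exact le_rfl
  · rw [hdec]
    have hv : ∀ v, G.localPart v (c, d - (κ : ℂ) • c) ∈ Mv v ↔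
        (fun h : G.EndsAt v => c h) = (K v).map Complex.ofReal *ᵥ fun k : G.EndsAt v => d k :=
      fun v => hKM v (fun h => c h) (fun h => d h)
    have hsum : ∀ h, ((Matrix.of fun h k => if hk : G.endVertex k = G.endVertex h then
        K (G.endVertex h) ⟨h, rfl⟩ ⟨k, hk⟩ else 0).map Complex.ofReal *ᵥ d) h =
        ((K (G.endVertex h)).map Complex.ofReal *ᵥ
          fun k : G.EndsAt (G.endVertex h) => d k) ⟨h, rfl⟩ := by
      intro h
      simp only [Matrix.mulVec, dotProduct, Matrix.map_apply, Matrix.of_apply]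
      rw [← Fintype.sum_subtype_add_sum_subtype (fun k => G.endVertex k = G.endVertex h)]
      rw [add_eq_left.mpr]
      · refine Finset.sum_congr rfl fun k _ => ?_
        rw [dif_pos k.2]
      · refine Finset.sum_eq_zero fun k _ => ?_
        rw [dif_neg k.2, Complex.ofReal_zero, zero_mul]
    simp only [hv]
    constructor
    · intro hc
      funext h
      rw [hsum, ← hc]
    · rintro hc v
      funext ⟨h, hh⟩
      subst hh
      rw [← hsum, ← hc]

/-! ### Calculus of indefinite integrals and Sobolev functions. -/

/-- On `[0, b]`, the function `F` is an indefinite integral of the integrable function `φ`. -/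
structure IsIndefiniteIntegral (b : ℝ) (F φ : ℝ → ℂ) : Prop where
  integrable : IntervalIntegrable φ volume 0 b
  eq_integral : ∀ x ∈ Set.Icc 0 b, F x = F 0 + ∫ t in (0 : ℝ)..x, φ t

theorem AbsolutelyContinuousOnInterval.const {b : ℝ} (c : ℂ) :
    AbsolutelyContinuousOnInterval (fun _ => c) 0 b :=
  (contDiffOn_const (n := 1)).absolutelyContinuousOnInterval

theorem AbsolutelyContinuousOnInterval.congr_on {b : ℝ} {F G : ℝ → ℂ}
    (hF : AbsolutelyContinuousOnInterval F 0 b) (h : ∀ x ∈ Set.uIcc 0 b, G x = F x) :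
    AbsolutelyContinuousOnInterval G 0 b := by
  rw [absolutelyContinuousOnInterval_iff] at hF ⊢
  intro ε hε
  obtain ⟨δ, hδ, hF⟩ := hF ε hε
  refine ⟨δ, hδ, fun E hE hlt => ?_⟩
  have := hF E hE hlt
  refine lt_of_eq_of_lt (Finset.sum_congr rfl fun i hi => ?_) this
  rw [h _ (hE.1 i hi).1, h _ (hE.1 i hi).2]

/-- Real and imaginary parts are treated separately and recombined with the constant factors `1` and
`Complex.I`. -/
theorem absolutelyContinuousOnInterval_integral {b : ℝ} {φ : ℝ → ℂ}
    (hφ : IntervalIntegrable φ volume 0 b) :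
    AbsolutelyContinuousOnInterval (fun x => ∫ t in (0 : ℝ)..x, φ t) 0 b := by
  have hre : IntervalIntegrable (fun t => (φ t).re) volume 0 b :=
    ⟨hφ.1.re, hφ.2.re⟩
  have him : IntervalIntegrable (fun t => (φ t).im) volume 0 b :=
    ⟨hφ.1.im, hφ.2.im⟩
  have h1 := hre.absolutelyContinuousOnInterval_intervalIntegral (c := 0) Set.left_mem_uIcc
  have h2 := him.absolutelyContinuousOnInterval_intervalIntegral (c := 0) Set.left_mem_uIcc
  have h3 := (h1.smul (AbsolutelyContinuousOnInterval.const (b := b) (1 : ℂ))).add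
    (h2.smul (AbsolutelyContinuousOnInterval.const (b := b) Complex.I))
  refine h3.congr_on fun x hx => ?_
  have hx' : IntervalIntegrable φ volume 0 x :=
    hφ.mono_set (Set.uIcc_subset_uIcc Set.left_mem_uIcc hx)
  have h4 := intervalIntegral.integral_ofReal (a := 0) (b := x) (μ := volume)
    (f := fun t => (φ t).re)
  have h5 := intervalIntegral.integral_ofReal (a := 0) (b := x) (μ := volume)
    (f := fun t => (φ t).im)
  simp only [Pi.add_apply, Pi.smul_apply', Complex.real_smul, mul_one]
  rw [← h4, ← h5, ← intervalIntegral.integral_mul_const,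
    ← intervalIntegral.integral_add]
  · simp only [Complex.re_add_im]
  · exact ⟨hx'.1.re.ofReal, hx'.2.re.ofReal⟩
  · exact IntervalIntegrable.mul_const ⟨hx'.1.im.ofReal, hx'.2.im.ofReal⟩ _

namespace IsIndefiniteIntegral

variable {b : ℝ} {F G φ γ : ℝ → ℂ}

theorem mono (h : IsIndefiniteIntegral b F φ) {x : ℝ} (hx : x ∈ Set.Icc 0 b) :
    IsIndefiniteIntegral x F φ where
  integrable := h.integrable.mono_set
    (by rw [Set.uIcc_of_le hx.1, Set.uIcc_of_le (hx.1.trans hx.2)]; exact Set.Icc_subset_Icc_right hx.2)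
  eq_integral y hy := h.eq_integral y ⟨hy.1, hy.2.trans hx.2⟩

theorem continuousOn (h : IsIndefiniteIntegral b F φ) : ContinuousOn F (Set.Icc 0 b) := by
  rcases le_or_gt 0 b with hb | hb
  · have h1 := intervalIntegral.continuousOn_primitive_interval
      (μ := volume) (f := φ) (a := 0) (b := b) (by
        rw [Set.uIcc_of_le hb, integrableOn_Icc_iff_integrableOn_Ioc,
          ← intervalIntegrable_iff_integrableOn_Ioc_of_le hb]
        exact h.integrable)
    rw [Set.uIcc_of_le hb] at h1
    exact (continuousOn_const.add h1).congr fun x hx => h.eq_integral x hx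
  · rw [Set.Icc_eq_empty (not_le.mpr hb)]; exact continuousOn_empty _

theorem intervalIntegrable (h : IsIndefiniteIntegral b F φ) (hb : 0 ≤ b) :
    IntervalIntegrable F volume 0 b :=
  ContinuousOn.intervalIntegrable (by rw [Set.uIcc_of_le hb]; exact h.continuousOn)

theorem integral_eq (h : IsIndefiniteIntegral b F φ) (hb : 0 ≤ b) :
    F b = F 0 + ∫ t in (0 : ℝ)..b, φ t := h.eq_integral b (Set.right_mem_Icc.mpr hb)

theorem congr (h : IsIndefiniteIntegral b F φ) (hb : 0 ≤ b) (hF : Set.EqOn G F (Set.Icc 0 b))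
    (hφ : ∀ᵐ x, x ∈ Set.Icc 0 b → γ x = φ x) : IsIndefiniteIntegral b G γ := by
  refine ⟨h.integrable.congr_ae ?_, fun x hx => ?_⟩
  · rw [Set.uIoc_of_le hb, Filter.EventuallyEq, ae_restrict_iff' measurableSet_Ioc]
    filter_upwards [hφ] with x hx hx' using (hx (Set.Ioc_subset_Icc_self hx')).symm
  · rw [hF hx, hF (Set.left_mem_Icc.mpr hb), h.eq_integral x hx]
    congr 1
    refine intervalIntegral.integral_congr_ae ?_
    filter_upwards [hφ] with y hy hy'
    rw [Set.uIoc_of_le hx.1] at hy'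
    exact (hy ⟨hy'.1.le, hy'.2.trans hx.2⟩).symm

theorem of_hasDerivAt (hF : ∀ x, HasDerivAt F (φ x) x) (hφ : Continuous φ) :
    IsIndefiniteIntegral b F φ where
  integrable := hφ.intervalIntegrable _ _
  eq_integral x _ := by
    rw [intervalIntegral.integral_eq_sub_of_hasDerivAt (fun y _ => hF y)
      (hφ.intervalIntegrable _ _), add_sub_cancel]

theorem add (hF : IsIndefiniteIntegral b F φ) (hG : IsIndefiniteIntegral b G γ) :
    IsIndefiniteIntegral b (fun x => F x + G x) (fun x => φ x + γ x) where
  integrable := hF.integrable.add hG.integrable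
  eq_integral x hx := by
    rw [intervalIntegral.integral_add (hF.mono hx).integrable (hG.mono hx).integrable,
      hF.eq_integral x hx, hG.eq_integral x hx]
    ring

theorem const_mul (hF : IsIndefiniteIntegral b F φ) (c : ℂ) :
    IsIndefiniteIntegral b (fun x => c * F x) (fun x => c * φ x) where
  integrable := hF.integrable.const_mul c
  eq_integral x hx := by
    rw [intervalIntegral.integral_const_mul, hF.eq_integral x hx, mul_add]

theorem conj (hF : IsIndefiniteIntegral b F φ) :
    IsIndefiniteIntegral b (fun x => star (F x)) (fun x => star (φ x)) where
  integrable := ⟨Complex.conjCLE.toContinuousLinearMap.integrable_comp hF.integrable.1,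
    Complex.conjCLE.toContinuousLinearMap.integrable_comp hF.integrable.2⟩
  eq_integral x hx := by
    rw [hF.eq_integral x hx, star_add]
    simp only [intervalIntegral, Complex.star_def, map_sub, integral_conj]

/-- The product rule. -/
theorem mul (hb : 0 ≤ b) (hF : IsIndefiniteIntegral b F φ) (hG : IsIndefiniteIntegral b G γ) :
    IsIndefiniteIntegral b (fun x => F x * G x) (fun x => φ x * G x + F x * γ x) := by
  have hint : IntervalIntegrable (fun x => φ x * G x + F x * γ x) volume 0 b := by
    have hu : Set.uIcc 0 b = Set.Icc 0 b := Set.uIcc_of_le hb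
    exact (hF.integrable.mul_continuousOn (hu ▸ hG.continuousOn)).add
      (hG.integrable.continuousOn_mul (hu ▸ hF.continuousOn))
  have hint' := hint
  refine ⟨hint, fun x hx => ?_⟩
  have hacF := absolutelyContinuousOnInterval_integral hF.integrable
  have hacG := absolutelyContinuousOnInterval_integral hG.integrable
  have hacFG := absolutelyContinuousOnInterval_integral hint
  -- The product minus the integral of its formal derivative is absolutely continuous with
  -- derivative zero almost everywhere, hence constant.
  have hac := (((AbsolutelyContinuousOnInterval.const (b := b) (F 0)).add hacF).smul
    ((AbsolutelyContinuousOnInterval.const (b := b) (G 0)).add hacG)).sub hacFG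
  obtain ⟨C, hC⟩ := hac.const_of_ae_hasDerivAt_zero (by
    filter_upwards [hF.integrable.ae_hasDerivAt_integral, hG.integrable.ae_hasDerivAt_integral,
      hint.ae_hasDerivAt_integral] with y h1 h2 h3 hy
    have h1 := h1 hy 0 Set.left_mem_uIcc
    have h2 := h2 hy 0 Set.left_mem_uIcc
    have h3 := h3 hy 0 Set.left_mem_uIcc
    rw [Set.uIcc_of_le hb] at hy
    have := ((h1.const_add (F 0)).mul (h2.const_add (G 0))).sub h3
    rw [← hF.eq_integral y hy, ← hG.eq_integral y hy, sub_self] at this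
    exact this)
  rw [Set.uIcc_of_le hb] at hC
  have h0 := hC 0 (Set.left_mem_Icc.mpr hb)
  have hx' := hC x hx
  have h0' : (F 0 + ∫ t in (0 : ℝ)..0, φ t) * (G 0 + ∫ t in (0 : ℝ)..0, γ t) -
    ∫ t in (0 : ℝ)..0, (φ t * G t + F t * γ t) = C := h0
  have hx'' : (F 0 + ∫ t in (0 : ℝ)..x, φ t) * (G 0 + ∫ t in (0 : ℝ)..x, γ t) -
    ∫ t in (0 : ℝ)..x, (φ t * G t + F t * γ t) = C := hx'
  simp only [intervalIntegral.integral_same, add_zero, sub_zero] at h0'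
  rw [← hF.eq_integral x hx, ← hG.eq_integral x hx] at hx''
  rw [h0', ← hx'', sub_add_cancel]

/-- By Lebesgue differentiation `φ` is the derivative of its primitive at almost every interior
point, and that primitive vanishes near each of these. -/
theorem ae_eq_zero (hF : IsIndefiniteIntegral b F φ) (h0 : ∀ x ∈ Set.Icc 0 b, F x = 0) :
    ∀ᵐ x, x ∈ Set.Icc 0 b → φ x = 0 := by
  rcases lt_or_ge b 0 with hb | hb
  · simp [Set.Icc_eq_empty (not_le.mpr hb)]
  have hne0 : ∀ᵐ x : ℝ, x ≠ 0 := by simp [ae_iff, measure_singleton]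
  have hneb : ∀ᵐ x : ℝ, x ≠ b := by simp [ae_iff, measure_singleton]
  filter_upwards [hF.integrable.ae_hasDerivAt_integral, hne0, hneb] with x hx h1 h2 hxb
  have hd := hx (by rwa [Set.uIcc_of_le hb]) 0 Set.left_mem_uIcc
  have hz : (fun x => ∫ t in (0 : ℝ)..x, φ t) =ᶠ[𝓝 x] fun _ => 0 := by
    have : Set.Icc 0 b ∈ 𝓝 x :=
      Icc_mem_nhds (lt_of_le_of_ne hxb.1 h1.symm) (lt_of_le_of_ne hxb.2 h2)
    filter_upwards [this] with y hy
    have := hF.eq_integral y hy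
    rw [h0 y hy, h0 0 (Set.left_mem_Icc.mpr hb), zero_add] at this
    exact this.symm
  exact hd.unique ((hasDerivAt_const x 0).congr_of_eventuallyEq hz)

/-- Green's identity on a bounded interval. -/
theorem wronskian (hb : 0 ≤ b) {f f₁ f₂ g g₁ g₂ : ℝ → ℂ} (hf : IsIndefiniteIntegral b f f₁)
    (hf₁ : IsIndefiniteIntegral b f₁ f₂) (hg : IsIndefiniteIntegral b g g₁)
    (hg₁ : IsIndefiniteIntegral b g₁ g₂) :
    IsIndefiniteIntegral b (fun x => f₁ x * g x - f x * g₁ x)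
      (fun x => f₂ x * g x - f x * g₂ x) := by
  have h := (hf₁.mul hb hg).add ((hf.mul hb hg₁).const_mul (-1))
  refine h.congr hb (fun x _ => ?_) (ae_of_all _ fun x _ => ?_)
  · ring
  · ring

end IsIndefiniteIntegral

theorem MeasureTheory.MemLp.intervalIntegrable {s : Set ℝ} {φ : ℝ → ℂ} {b : ℝ}
    (h : MemLp φ 2 (volume.restrict s)) (hb0 : 0 ≤ b) (hb : Set.Icc 0 b ⊆ s) :
    IntervalIntegrable φ volume 0 b := by
  rw [intervalIntegrable_iff_integrableOn_Ioc_of_le hb0]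
  have h1 : MemLp φ 2 (volume.restrict (Set.Ioc 0 b)) :=
    h.mono_measure (Measure.restrict_mono (Set.Ioc_subset_Icc_self.trans hb) le_rfl)
  exact h1.integrable one_le_two

namespace IsSobolevTwo

variable {s : Set ℝ} {f f₁ f₂ g g₁ g₂ : ℝ → ℂ}

theorem first_isIndefiniteIntegral (h : IsSobolevTwo s f f₁ f₂) {b : ℝ} (hb0 : 0 ≤ b)
    (hb : Set.Icc 0 b ⊆ s) : IsIndefiniteIntegral b f₁ f₂ :=
  ⟨h.memLp_second.intervalIntegrable hb0 hb, fun x hx => h.first_eq_integral x (hb hx)⟩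

theorem isIndefiniteIntegral (h : IsSobolevTwo s f f₁ f₂) {b : ℝ} (hb0 : 0 ≤ b)
    (hb : Set.Icc 0 b ⊆ s) : IsIndefiniteIntegral b f f₁ :=
  ⟨(h.first_isIndefiniteIntegral hb0 hb).intervalIntegrable hb0, fun x hx => h.eq_integral x (hb hx)⟩

theorem of_isIndefiniteIntegral (hf : MemLp f 2 (volume.restrict s))
    (hf₂ : MemLp f₂ 2 (volume.restrict s))
    (h : ∀ x ∈ s, 0 ≤ x ∧ IsIndefiniteIntegral x f f₁ ∧ IsIndefiniteIntegral x f₁ f₂) :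
    IsSobolevTwo s f f₁ f₂ :=
  ⟨hf, hf₂, fun x hx => (h x hx).2.1.integral_eq (h x hx).1,
    fun x hx => (h x hx).2.2.integral_eq (h x hx).1⟩

theorem add (hs : ∀ x ∈ s, 0 ≤ x ∧ Set.Icc 0 x ⊆ s) (hf : IsSobolevTwo s f f₁ f₂)
    (hg : IsSobolevTwo s g g₁ g₂) :
    IsSobolevTwo s (fun x => f x + g x) (fun x => f₁ x + g₁ x) (fun x => f₂ x + g₂ x) :=
  of_isIndefiniteIntegral (hf.memLp.add hg.memLp) (hf.memLp_second.add hg.memLp_second)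
    fun x hx => ⟨(hs x hx).1,
      (hf.isIndefiniteIntegral (hs x hx).1 (hs x hx).2).add
        (hg.isIndefiniteIntegral (hs x hx).1 (hs x hx).2),
      (hf.first_isIndefiniteIntegral (hs x hx).1 (hs x hx).2).add
        (hg.first_isIndefiniteIntegral (hs x hx).1 (hs x hx).2)⟩

theorem const_mul (hs : ∀ x ∈ s, 0 ≤ x ∧ Set.Icc 0 x ⊆ s) (hf : IsSobolevTwo s f f₁ f₂) (c : ℂ) :
    IsSobolevTwo s (fun x => c * f x) (fun x => c * f₁ x) (fun x => c * f₂ x) :=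
  of_isIndefiniteIntegral (hf.memLp.const_mul c) (hf.memLp_second.const_mul c)
    fun x hx => ⟨(hs x hx).1,
      (hf.isIndefiniteIntegral (hs x hx).1 (hs x hx).2).const_mul c,
      (hf.first_isIndefiniteIntegral (hs x hx).1 (hs x hx).2).const_mul c⟩

theorem conj (hs : ∀ x ∈ s, 0 ≤ x ∧ Set.Icc 0 x ⊆ s) (hf : IsSobolevTwo s f f₁ f₂) :
    IsSobolevTwo s (fun x => star (f x)) (fun x => star (f₁ x)) (fun x => star (f₂ x)) :=
  of_isIndefiniteIntegral hf.memLp.star hf.memLp_second.star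
    fun x hx => ⟨(hs x hx).1,
      (hf.isIndefiniteIntegral (hs x hx).1 (hs x hx).2).conj,
      (hf.first_isIndefiniteIntegral (hs x hx).1 (hs x hx).2).conj⟩

theorem of_hasDerivAt (hs : ∀ x ∈ s, 0 ≤ x) (hf : ∀ x, HasDerivAt f (f₁ x) x)
    (hf₁ : ∀ x, HasDerivAt f₁ (f₂ x) x) (hc : Continuous f₂)
    (h0 : MemLp f 2 (volume.restrict s)) (h2 : MemLp f₂ 2 (volume.restrict s)) :
    IsSobolevTwo s f f₁ f₂ := by
  have hc₁ : Continuous f₁ := continuous_iff_continuousAt.mpr fun x => (hf₁ x).continuousAt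
  exact of_isIndefiniteIntegral h0 h2 fun x hx =>
    ⟨hs x hx, .of_hasDerivAt hf hc₁, .of_hasDerivAt hf₁ hc⟩

/-- Vanishing almost everywhere upgrades to vanishing everywhere by continuity, for `f` and then for
`f₁`. This makes the Laplacian single-valued on classes of functions. -/
theorem second_ae_eq_zero (h : IsSobolevTwo s f f₁ f₂) {b : ℝ} (hb0 : 0 < b)
    (hb : Set.Icc 0 b ⊆ s) (h0 : ∀ᵐ x ∂volume.restrict s, f x = 0) :
    ∀ᵐ x, x ∈ Set.Icc 0 b → f₂ x = 0 := by
  have hi := h.isIndefiniteIntegral hb0.le hb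
  have hi₁ := h.first_isIndefiniteIntegral hb0.le hb
  have e0 : Set.EqOn f (fun _ => 0) (Set.Icc 0 b) :=
    Measure.eqOn_Icc_of_ae_eq volume hb0.ne
      (ae_mono (Measure.restrict_mono hb le_rfl) h0) hi.continuousOn continuousOn_const
  have e1 : Set.EqOn f₁ (fun _ => 0) (Set.Icc 0 b) :=
    Measure.eqOn_Icc_of_ae_eq volume hb0.ne
      ((ae_restrict_iff' measurableSet_Icc).mpr (hi.ae_eq_zero e0)) hi₁.continuousOn
      continuousOn_const
  exact hi₁.ae_eq_zero e1

end IsSobolevTwo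

theorem intervalIntegral_mul_nonneg {c d : ℝ} (hcd : c ≤ d) {η : ℝ → ℂ} {w : ℝ → ℝ}
    (hw : ∀ x ∈ Set.Icc c d, 0 ≤ w x) (hη : ∀ᵐ x, x ∈ Set.Icc c d → 0 ≤ η x) :
    0 ≤ ∫ t in c..d, (w t : ℂ) * η t := by
  rw [intervalIntegral.integral_of_le hcd]
  refine integral_nonneg_of_ae ((ae_restrict_iff' measurableSet_Ioc).mpr ?_)
  filter_upwards [hη] with x hx hx'
  have hx' := Set.Ioc_subset_Icc_self hx'
  exact mul_nonneg (Complex.zero_le_real.mpr (hw x hx')) (hx hx')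

/-! ### Maximum principle on a bounded interval. -/

section MaximumPrinciple

variable {b κ : ℝ} {f f₁ f₂ : ℝ → ℂ}

/-- The Wronskian of a solution of `f'' ≤ κ² f` with a nonnegative solution of `w'' = κ² w`
decreases. -/
theorem wronskian_sub_nonneg (hf : IsIndefiniteIntegral b f f₁)
    (hf₁ : IsIndefiniteIntegral b f₁ f₂)
    {w w₁ : ℝ → ℝ} (hw : ∀ x, HasDerivAt w (w₁ x) x) (hw₁ : ∀ x, HasDerivAt w₁ (κ ^ 2 * w x) x)
    {c d : ℝ} (hc : 0 ≤ c) (hcd : c ≤ d) (hd : d ≤ b)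
    (hη : ∀ᵐ x, x ∈ Set.Icc c d → 0 ≤ (κ : ℂ) ^ 2 * f x - f₂ x)
    (hpos : ∀ x ∈ Set.Icc c d, 0 ≤ w x) :
    0 ≤ (f₁ c * w c - f c * w₁ c) - (f₁ d * w d - f d * w₁ d) := by
  have hb : 0 ≤ b := hc.trans (hcd.trans hd)
  have hwc : Continuous w := continuous_iff_continuousAt.mpr fun x => (hw x).continuousAt
  have hw₁c : Continuous w₁ := continuous_iff_continuousAt.mpr fun x => (hw₁ x).continuousAt
  have h1 : IsIndefiniteIntegral b (fun x => (w x : ℂ)) (fun x => (w₁ x : ℂ)) :=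
    .of_hasDerivAt (fun x => (hw x).ofReal_comp) (by fun_prop)
  have h2 : IsIndefiniteIntegral b (fun x => (w₁ x : ℂ)) (fun x => ((κ ^ 2 * w x : ℝ) : ℂ)) :=
    .of_hasDerivAt (fun x => (hw₁ x).ofReal_comp) (by fun_prop)
  have hW := IsIndefiniteIntegral.wronskian hb hf hf₁ h1 h2
  have hWc := hW.eq_integral c ⟨hc, hcd.trans hd⟩
  have hWd := hW.eq_integral d ⟨hc.trans hcd, hd⟩
  have hsub := intervalIntegral.integral_interval_sub_left
    (hW.mono ⟨hc.trans hcd, hd⟩).integrable (hW.mono ⟨hc, hcd.trans hd⟩).integrable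
  have hpos' := intervalIntegral_mul_nonneg hcd hpos hη
  have heq : ∫ t in c..d, (w t : ℂ) * ((κ : ℂ) ^ 2 * f t - f₂ t) =
      -∫ t in c..d, (f₂ t * w t - f t * ((κ ^ 2 * w t : ℝ) : ℂ)) := by
    rw [← intervalIntegral.integral_neg]
    refine intervalIntegral.integral_congr fun t _ => ?_
    push_cast
    ring
  rw [heq, ← hsub] at hpos'
  rw [hWc, hWd]
  convert hpos' using 1
  ring

theorem hasDerivAt_sinh_mul (κ x : ℝ) :
    HasDerivAt (fun x => Real.sinh (κ * x)) (κ * Real.cosh (κ * x)) x := by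
  have := ((hasDerivAt_id' x).const_mul κ).sinh
  simpa [mul_comm] using this

theorem hasDerivAt_cosh_mul (κ x : ℝ) :
    HasDerivAt (fun x => κ * Real.cosh (κ * x)) (κ ^ 2 * Real.sinh (κ * x)) x := by
  have := (((hasDerivAt_id' x).const_mul κ).cosh).const_mul κ
  exact this.congr_deriv (by ring)

theorem hasDerivAt_sinh_mul_sub (κ a x : ℝ) :
    HasDerivAt (fun x => Real.sinh (κ * (a - x))) (-(κ * Real.cosh (κ * (a - x)))) x := by
  have := (((hasDerivAt_id' x).const_sub a).const_mul κ).sinh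
  exact this.congr_deriv (by ring)

theorem hasDerivAt_cosh_mul_sub (κ a x : ℝ) :
    HasDerivAt (fun x => -(κ * Real.cosh (κ * (a - x)))) (κ ^ 2 * Real.sinh (κ * (a - x))) x := by
  have := ((((hasDerivAt_id' x).const_sub a).const_mul κ).cosh.const_mul κ).neg
  exact this.congr_deriv (by ring)

/-- The maximum principle on a bounded interval, with the signs of the normal derivatives. -/
theorem maximum_principle_Icc {a : ℝ} (ha : 0 < a) (hκ : 0 < κ)
    (hf : IsIndefiniteIntegral a f f₁) (hf₁ : IsIndefiniteIntegral a f₁ f₂)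
    (hη : ∀ᵐ x, x ∈ Set.Icc 0 a → 0 ≤ (κ : ℂ) ^ 2 * f x - f₂ x) :
    0 ≤ f₁ 0 + ((κ * Real.cosh (κ * a) / Real.sinh (κ * a) : ℝ) : ℂ) * f 0 -
        ((κ / Real.sinh (κ * a) : ℝ) : ℂ) * f a ∧
      0 ≤ -f₁ a + ((κ * Real.cosh (κ * a) / Real.sinh (κ * a) : ℝ) : ℂ) * f a -
        ((κ / Real.sinh (κ * a) : ℝ) : ℂ) * f 0 ∧
      (0 ≤ f 0 → 0 ≤ f a → ∀ x ∈ Set.Icc 0 a, 0 ≤ f x) := by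
  have hsa : 0 < Real.sinh (κ * a) := Real.sinh_pos_iff.mpr (by positivity)
  have hsa' : ((Real.sinh (κ * a) : ℝ) : ℂ) ≠ 0 := by exact_mod_cast hsa.ne'
  have hs1 : ∀ x, 0 ≤ x → 0 ≤ Real.sinh (κ * x) := fun x hx =>
    Real.sinh_nonneg_iff.mpr (by positivity)
  -- Wronskian comparison on `[0, x]` with the solution vanishing at `0`; `e2` uses `[x, a]` and the
  -- solution vanishing at `a`. At the far endpoints these are the two derivative inequalities.
  have e1 : ∀ x ∈ Set.Icc 0 a, 0 ≤ ((κ * Real.cosh (κ * x) : ℝ) : ℂ) * f x -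
      ((Real.sinh (κ * x) : ℝ) : ℂ) * f₁ x - κ * f 0 := by
    intro x hx
    have := wronskian_sub_nonneg hf hf₁ (hasDerivAt_sinh_mul κ) (hasDerivAt_cosh_mul κ)
      le_rfl hx.1 hx.2 (hη.mono fun y hy hy' => hy ⟨hy'.1, hy'.2.trans hx.2⟩)
      (fun y hy => hs1 y hy.1)
    convert this using 1
    simp; ring
  have e2 : ∀ x ∈ Set.Icc 0 a, 0 ≤ ((κ * Real.cosh (κ * (a - x)) : ℝ) : ℂ) * f x +
      ((Real.sinh (κ * (a - x)) : ℝ) : ℂ) * f₁ x - κ * f a := by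
    intro x hx
    have := wronskian_sub_nonneg hf hf₁ (hasDerivAt_sinh_mul_sub κ a)
      (hasDerivAt_cosh_mul_sub κ a)
      hx.1 hx.2 le_rfl (hη.mono fun y hy hy' => hy ⟨hx.1.trans hy'.1, hy'.2⟩)
      (fun y hy => hs1 _ (by linarith [hy.2]))
    convert this using 1
    simp; ring
  have hinv : (0 : ℂ) ≤ ((Real.sinh (κ * a))⁻¹ : ℝ) := Complex.zero_le_real.mpr (by positivity)
  refine ⟨?_, ?_, fun h0 ha' x hx => ?_⟩
  · have := mul_nonneg hinv (e2 0 (Set.left_mem_Icc.mpr ha.le))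
    convert this using 1
    rw [sub_zero]
    push_cast at hsa' ⊢
    field_simp
    ring
  · have := mul_nonneg hinv (e1 a (Set.right_mem_Icc.mpr ha.le))
    convert this using 1
    push_cast at hsa' ⊢
    field_simp
    ring
  · have hk : (0 : ℂ) ≤ (κ : ℂ) := Complex.zero_le_real.mpr hκ.le
    have hx1 : (0 : ℂ) ≤ (Real.sinh (κ * (a - x)) : ℝ) :=
      Complex.zero_le_real.mpr (hs1 _ (by linarith [hx.2]))
    have hx2 : (0 : ℂ) ≤ (Real.sinh (κ * x) : ℝ) := Complex.zero_le_real.mpr (hs1 _ hx.1)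
    have hκi : (0 : ℂ) ≤ ((κ * Real.sinh (κ * a))⁻¹ : ℝ) :=
      Complex.zero_le_real.mpr (by positivity)
    -- The weights eliminate `f₁ x`, and the addition formula for `sinh` collects the coefficient of
    -- `f x`: `sinh (κ a) f x ≥ sinh (κ (a - x)) f 0 + sinh (κ x) f a`.
    have := mul_nonneg hκi (add_nonneg (add_nonneg (mul_nonneg hx1 (e1 x hx))
      (mul_nonneg hx2 (e2 x hx))) (add_nonneg (mul_nonneg (mul_nonneg hk h0) hx1)
      (mul_nonneg (mul_nonneg hk ha') hx2)))
    convert this using 1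
    have hadd : Real.sinh (κ * a) = Real.sinh (κ * x) * Real.cosh (κ * (a - x)) +
        Real.cosh (κ * x) * Real.sinh (κ * (a - x)) := by
      rw [← Real.sinh_add]; congr 1; ring
    have hadd' : ((Real.sinh (κ * a) : ℝ) : ℂ) = (Real.sinh (κ * x) : ℝ) *
        (Real.cosh (κ * (a - x)) : ℝ) + (Real.cosh (κ * x) : ℝ) *
        (Real.sinh (κ * (a - x)) : ℝ) := by
      exact_mod_cast hadd
    have hk' : (κ : ℂ) ≠ 0 := by exact_mod_cast hκ.ne'
    rw [Complex.ofReal_inv, eq_inv_mul_iff_mul_eq₀ (by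
      rw [Complex.ofReal_mul]; exact mul_ne_zero hk' hsa'), Complex.ofReal_mul, hadd',
      Complex.ofReal_mul, Complex.ofReal_mul]
    ring

end MaximumPrinciple

/-! ### Decay, Green's identity and maximum principle on the half-line. -/

section HalfLine

theorem memLp_two_Ici_of_bounded {φ : ℝ → ℂ} (hc : ∀ X, 0 ≤ X → ContinuousOn φ (Set.Icc 0 X))
    {C : ℝ} (hC : ∀ X, 0 ≤ X → ∫ t in (0 : ℝ)..X, ‖φ t‖ ^ 2 ≤ C) :
    MemLp φ 2 (volume.restrict (Set.Ici 0)) := by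
  have hcont : ContinuousOn φ (Set.Ici 0) := by
    intro x hx
    have h1 := hc (x + 1) (by linarith [Set.mem_Ici.mp hx]) x ⟨hx, by linarith⟩
    refine h1.mono_of_mem_nhdsWithin ?_
    have : Set.Ici 0 ∩ Set.Iio (x + 1) ∈ 𝓝[Set.Ici 0] x :=
      inter_mem_nhdsWithin _ (Iio_mem_nhds (by linarith))
    exact mem_of_superset this fun y hy => ⟨hy.1, hy.2.le⟩
  rw [memLp_two_iff_integrable_sq_norm (hcont.aestronglyMeasurable measurableSet_Ici)]
  change IntegrableOn _ _ _
  rw [integrableOn_Ici_iff_integrableOn_Ioi]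
  refine integrableOn_Ioi_of_intervalIntegral_norm_bounded (b := fun X : ℝ => X) (l := atTop) C 0
    (fun X => ?_) tendsto_id ?_
  · have : ContinuousOn (fun x => ‖φ x‖ ^ 2) (Set.Icc 0 X) :=
      (hcont.mono Set.Icc_subset_Ici_self).norm.pow 2
    exact this.integrableOn_Icc.mono_set Set.Ioc_subset_Icc_self
  · filter_upwards [eventually_ge_atTop 0] with X hX
    simpa using hC X hX

theorem MeasureTheory.MemLp.integrable_mul_Ici {φ γ : ℝ → ℂ}
    (hφ : MemLp φ 2 (volume.restrict (Set.Ici 0))) (hγ : MemLp γ 2 (volume.restrict (Set.Ici 0))) :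
    IntegrableOn (fun x => φ x * γ x) (Set.Ici 0) :=
  MemLp.integrable_mul hφ hγ

theorem integral_norm_le_of_integrableOn_Ici {φ : ℝ → ℂ} (hφ : IntegrableOn φ (Set.Ici 0)) {X : ℝ}
    (hX : 0 ≤ X) : ‖∫ t in (0 : ℝ)..X, φ t‖ ≤ ∫ t in Set.Ici (0 : ℝ), ‖φ t‖ := by
  rw [intervalIntegral.integral_of_le hX]
  exact (norm_integral_le_integral_norm _).trans
    (setIntegral_mono_set hφ.norm (ae_of_all _ fun _ => norm_nonneg _)
      (Set.Ioc_subset_Icc_self.trans Set.Icc_subset_Ici_self).eventuallyLE)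

theorem eq_zero_of_tendsto_of_integrableOn_Ici {φ : ℝ → ℂ} (hφ : IntegrableOn φ (Set.Ici 0)) {l : ℂ}
    (hl : Tendsto φ atTop (𝓝 l)) : l = 0 := by
  refine IntegrableAtFilter.eq_zero_of_tendsto (μ := volume) ⟨Set.Ici 0, Ici_mem_atTop 0, hφ⟩ ?_ hl
  intro s hs
  obtain ⟨c, hc⟩ := mem_atTop_sets.mp hs
  exact measure_mono_top (fun x hx => hc x hx : Set.Ici c ⊆ s) Real.volume_Ici

namespace IsSobolevTwo

variable {f f₁ f₂ g g₁ g₂ : ℝ → ℂ}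

/-- Integrating `(f̄ f₁)' = |f₁|² + f̄ f₂` shows that, were `∫ |f₁|²` unbounded, `Re (f̄ f₁) =
(|f|²)' / 2` would eventually be at least `1`. Then `|f|²` would grow linearly, contradicting square
integrability. -/
theorem memLp_first (h : IsSobolevTwo (Set.Ici 0) f f₁ f₂) :
    MemLp f₁ 2 (volume.restrict (Set.Ici 0)) := by
  have hi : ∀ {X}, 0 ≤ X → IsIndefiniteIntegral X f f₁ := fun hX =>
    h.isIndefiniteIntegral hX Set.Icc_subset_Ici_self
  have hi₁ : ∀ {X}, 0 ≤ X → IsIndefiniteIntegral X f₁ f₂ := fun hX =>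
    h.first_isIndefiniteIntegral hX Set.Icc_subset_Ici_self
  have hff₂ : IntegrableOn (fun x => star (f x) * f₂ x) (Set.Ici 0) :=
    h.memLp.star.integrable_mul_Ici h.memLp_second
  have hsq : IntegrableOn (fun x => ‖f x‖ ^ 2) (Set.Ici 0) :=
    (memLp_two_iff_integrable_sq_norm h.memLp.1).mp h.memLp
  set B := ∫ t in Set.Ici (0 : ℝ), ‖star (f t) * f₂ t‖
  set c := (star (f 0) * f₁ 0).re
  have hint1 : ∀ {X}, 0 ≤ X → IntervalIntegrable (fun t => ‖f₁ t‖ ^ 2) volume 0 X := fun hX =>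
    ContinuousOn.intervalIntegrable (by
      rw [Set.uIcc_of_le hX]; exact (hi₁ hX).continuousOn.norm.pow 2)
  have key : ∀ X, 0 ≤ X →
      c + (∫ t in (0 : ℝ)..X, ‖f₁ t‖ ^ 2) - B ≤ (star (f X) * f₁ X).re := by
    intro X hX
    have h1 := ((hi hX).conj.mul hX (hi₁ hX)).integral_eq hX
    have h2 : IntervalIntegrable (fun t => star (f t) * f₂ t) volume 0 X :=
      (intervalIntegrable_iff_integrableOn_Ioc_of_le hX).mpr
        (hff₂.mono_set (Set.Ioc_subset_Icc_self.trans Set.Icc_subset_Ici_self))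
    have h3 : ∫ t in (0 : ℝ)..X, (star (f₁ t) * f₁ t + star (f t) * f₂ t) =
        ((∫ t in (0 : ℝ)..X, ‖f₁ t‖ ^ 2 : ℝ) : ℂ) + ∫ t in (0 : ℝ)..X, star (f t) * f₂ t := by
      rw [← intervalIntegral.integral_ofReal, ← intervalIntegral.integral_add _ h2]
      · refine intervalIntegral.integral_congr fun t _ => ?_
        simp [← Complex.normSq_eq_conj_mul_self, Complex.normSq_eq_norm_sq]
      · exact ⟨(hint1 hX).1.ofReal, (hint1 hX).2.ofReal⟩
    have h4 := integral_norm_le_of_integrableOn_Ici hff₂ hX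
    have h5 := (abs_le.mp (Complex.abs_re_le_norm (∫ t in (0 : ℝ)..X, star (f t) * f₂ t))).1
    rw [h1, h3, Complex.add_re, Complex.add_re, Complex.ofReal_re]
    linarith
  have hgrow : ∀ X Y, 0 ≤ X → X ≤ Y → (∀ t ∈ Set.Icc X Y, 1 ≤ (star (f t) * f₁ t).re) →
      2 * (Y - X) ≤ ‖f Y‖ ^ 2 := by
    intro X Y hX hXY hle
    have hY := hX.trans hXY
    have hp := (hi hY).conj.mul hY (hi hY)
    have h1 := hp.eq_integral Y ⟨hY, le_rfl⟩
    have h2 := hp.eq_integral X ⟨hX, hXY⟩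
    have h3 := intervalIntegral.integral_interval_sub_left hp.integrable
      (hp.mono ⟨hX, hXY⟩).integrable
    have h4 : ∀ t, (star (f₁ t) * f t + star (f t) * f₁ t) =
        ((2 * (star (f t) * f₁ t).re : ℝ) : ℂ) := by
      intro t
      apply Complex.ext
      · simp; ring
      · simp; ring
    simp only [h4] at h1 h2 h3
    rw [intervalIntegral.integral_ofReal] at h1 h2 h3
    rw [intervalIntegral.integral_ofReal, intervalIntegral.integral_ofReal] at h3
    have h5 : ∀ t, star (f t) * f t = ((‖f t‖ ^ 2 : ℝ) : ℂ) := fun t => by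
      simp [← Complex.normSq_eq_conj_mul_self, Complex.normSq_eq_norm_sq]
    rw [h5, h5] at h1 h2
    norm_cast at h1 h2 h3
    have hci : IntervalIntegrable (fun t => 2 * (star (f t) * f₁ t).re) volume X Y := by
      refine ContinuousOn.intervalIntegrable ?_
      rw [Set.uIcc_of_le hXY]
      have c1 : ContinuousOn (fun t => star (f t) * f₁ t) (Set.Icc X Y) :=
        ((hi hY).conj.continuousOn.mul (hi₁ hY).continuousOn).mono
          (Set.Icc_subset_Icc_left hX)
      exact continuousOn_const.mul (Complex.continuous_re.comp_continuousOn c1)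
    have h6 := intervalIntegral.integral_mono_on hXY
      (intervalIntegrable_const (c := (2 : ℝ))) hci (fun t ht => by linarith [hle t ht])
    rw [intervalIntegral.integral_const, smul_eq_mul] at h6
    have h7 : 0 ≤ ‖f X‖ ^ 2 := by positivity
    linarith
  -- Beyond this value of the integral, `key` gives `Re (f̄ f₁) ≥ 1`.
  refine memLp_two_Ici_of_bounded (fun X hX => (hi₁ hX).continuousOn) (C := B - c + 1) ?_
  by_contra! hcon
  obtain ⟨X₀, hX₀, hlarge⟩ := hcon
  have hone : ∀ X, X₀ ≤ X → 1 ≤ (star (f X) * f₁ X).re := by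
    intro X hX
    have hX0 := hX₀.trans hX
    have h1 := key X hX0
    have h2 : ∫ t in (0 : ℝ)..X₀, ‖f₁ t‖ ^ 2 ≤ ∫ t in (0 : ℝ)..X, ‖f₁ t‖ ^ 2 :=
      intervalIntegral.integral_mono_interval le_rfl hX₀ hX (ae_of_all _ fun t => by positivity)
        (hint1 hX0)
    linarith
  have hbig : ∀ X, X₀ + 1 ≤ X → 1 ≤ ‖f X‖ ^ 2 := by
    intro X hX
    have := hgrow X₀ X hX₀ (by linarith) fun t ht => hone t ht.1
    linarith
  have hconst : IntegrableOn (fun _ : ℝ => (1 : ℝ)) (Set.Ici (X₀ + 1)) := by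
    refine Integrable.mono' (hsq.mono_set (Set.Ici_subset_Ici.mpr (by linarith)))
      aestronglyMeasurable_const ?_
    refine (ae_restrict_iff' measurableSet_Ici).mpr (ae_of_all _ fun x hx => ?_)
    rw [norm_one]
    exact hbig x hx
  rw [integrableOn_const_iff] at hconst
  simp at hconst

/-- The Wronskian has an integrable derivative, so it converges; being integrable itself, it can
only converge to `0`. -/
theorem wronskian_tendsto_zero (hf : IsSobolevTwo (Set.Ici 0) f f₁ f₂)
    (hg : IsSobolevTwo (Set.Ici 0) g g₁ g₂) :
    Tendsto (fun x => f₁ x * g x - f x * g₁ x) atTop (𝓝 0) := by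
  have hW : ∀ X, 0 ≤ X → IsIndefiniteIntegral X (fun x => f₁ x * g x - f x * g₁ x)
      (fun x => f₂ x * g x - f x * g₂ x) := fun X hX =>
    IsIndefiniteIntegral.wronskian hX
      (hf.isIndefiniteIntegral hX Set.Icc_subset_Ici_self)
      (hf.first_isIndefiniteIntegral hX Set.Icc_subset_Ici_self)
      (hg.isIndefiniteIntegral hX Set.Icc_subset_Ici_self)
      (hg.first_isIndefiniteIntegral hX Set.Icc_subset_Ici_self)
  have hint : IntegrableOn (fun x => f₂ x * g x - f x * g₂ x) (Set.Ici 0) :=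
    (hf.memLp_second.integrable_mul_Ici hg.memLp).sub (hf.memLp.integrable_mul_Ici hg.memLp_second)
  have hWint : IntegrableOn (fun x => f₁ x * g x - f x * g₁ x) (Set.Ici 0) :=
    (hf.memLp_first.integrable_mul_Ici hg.memLp).sub (hf.memLp.integrable_mul_Ici hg.memLp_first)
  have hlim : Tendsto (fun x => f₁ x * g x - f x * g₁ x) atTop
      (𝓝 ((f₁ 0 * g 0 - f 0 * g₁ 0) + ∫ x in Set.Ioi (0 : ℝ), (f₂ x * g x - f x * g₂ x))) := by
    have h1 := (intervalIntegral_tendsto_integral_Ioi 0 (hint.mono_set Set.Ioi_subset_Ici_self)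
      tendsto_id).const_add (f₁ 0 * g 0 - f 0 * g₁ 0)
    refine h1.congr' ?_
    filter_upwards [eventually_ge_atTop 0] with X hX
    exact ((hW X hX).integral_eq hX).symm
  have := eq_zero_of_tendsto_of_integrableOn_Ici hWint hlim
  rwa [this] at hlim

/-- Green's identity on the half-line. -/
theorem wronskian_integral (hf : IsSobolevTwo (Set.Ici 0) f f₁ f₂)
    (hg : IsSobolevTwo (Set.Ici 0) g g₁ g₂) :
    ∫ x in Set.Ici (0 : ℝ), (f₂ x * g x - f x * g₂ x) = f 0 * g₁ 0 - f₁ 0 * g 0 := by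
  have hint : IntegrableOn (fun x => f₂ x * g x - f x * g₂ x) (Set.Ici 0) :=
    (hf.memLp_second.integrable_mul_Ici hg.memLp).sub (hf.memLp.integrable_mul_Ici hg.memLp_second)
  have h1 := (intervalIntegral_tendsto_integral_Ioi 0 (hint.mono_set Set.Ioi_subset_Ici_self)
    tendsto_id).const_add (f₁ 0 * g 0 - f 0 * g₁ 0)
  have h2 := tendsto_nhds_unique (h1.congr' ?_) (hf.wronskian_tendsto_zero hg)
  · rw [integral_Ici_eq_integral_Ioi]
    linear_combination h2
  · filter_upwards [eventually_ge_atTop 0] with X hX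
    exact ((IsIndefiniteIntegral.wronskian hX
      (hf.isIndefiniteIntegral hX Set.Icc_subset_Ici_self)
      (hf.first_isIndefiniteIntegral hX Set.Icc_subset_Ici_self)
      (hg.isIndefiniteIntegral hX Set.Icc_subset_Ici_self)
      (hg.first_isIndefiniteIntegral hX Set.Icc_subset_Ici_self)).integral_eq hX).symm

end IsSobolevTwo

theorem hasDerivAt_exp_mul (κ x : ℝ) :
    HasDerivAt (fun x => Real.exp (κ * x)) (κ * Real.exp (κ * x)) x := by
  have := ((hasDerivAt_id' x).const_mul κ).exp
  exact this.congr_deriv (by ring)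

theorem memLp_exp_neg {κ : ℝ} (hκ : 0 < κ) :
    MemLp (fun x : ℝ => ((Real.exp (-κ * x) : ℝ) : ℂ)) 2 (volume.restrict (Set.Ici 0)) := by
  rw [memLp_two_iff_integrable_sq_norm (by fun_prop)]
  change IntegrableOn _ _ _
  rw [integrableOn_Ici_iff_integrableOn_Ioi]
  refine (integrableOn_exp_mul_Ioi (a := -(2 * κ)) (by linarith) 0).congr_fun (fun x _ => ?_)
    measurableSet_Ioi
  simp only [Complex.norm_real, Real.norm_eq_abs, Real.abs_exp, ← Real.exp_nat_mul]
  congr 1; push_cast; ring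

theorem isSobolevTwo_exp_neg {κ : ℝ} (hκ : 0 < κ) :
    IsSobolevTwo (Set.Ici 0) (fun x : ℝ => ((Real.exp (-κ * x) : ℝ) : ℂ))
      (fun x => -κ * ((Real.exp (-κ * x) : ℝ) : ℂ))
      (fun x => κ ^ 2 * ((Real.exp (-κ * x) : ℝ) : ℂ)) := by
  have hd : ∀ x, HasDerivAt (fun x : ℝ => ((Real.exp (-κ * x) : ℝ) : ℂ))
      (-κ * ((Real.exp (-κ * x) : ℝ) : ℂ)) x := fun x => by
    have := (hasDerivAt_exp_mul (-κ) x).ofReal_comp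
    push_cast at this ⊢
    exact this
  refine .of_hasDerivAt (fun x hx => hx) hd (fun x => ?_) (by fun_prop) (memLp_exp_neg hκ)
    ((memLp_exp_neg hκ).const_mul _)
  exact ((hd x).const_mul (-κ : ℂ)).congr_deriv (by ring)

/-- The maximum principle on the half-line, with the sign of the normal derivative. -/
theorem maximum_principle_Ici {κ : ℝ} (hκ : 0 < κ) {f f₁ f₂ : ℝ → ℂ}
    (hf : IsSobolevTwo (Set.Ici 0) f f₁ f₂)
    (hη : ∀ᵐ x, x ∈ Set.Ici (0 : ℝ) → 0 ≤ (κ : ℂ) ^ 2 * f x - f₂ x) :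
    0 ≤ f₁ 0 + κ * f 0 ∧ (0 ≤ f 0 → ∀ x, 0 ≤ x → 0 ≤ f x) := by
  -- Comparison with `exp (-κ x)` on `[c, d]`; the boundary term at `d` disappears as `d → ∞`.
  have hW : ∀ c, 0 ≤ c → 0 ≤ f₁ c + κ * f c := by
    intro c hc
    have hlim := (hf.wronskian_tendsto_zero (isSobolevTwo_exp_neg hκ)).const_sub
      (f₁ c * (Real.exp (-κ * c) : ℝ) - f c * (-κ * (Real.exp (-κ * c) : ℝ)))
    have h1 : 0 ≤ f₁ c * (Real.exp (-κ * c) : ℝ) - f c * (-κ * (Real.exp (-κ * c) : ℝ)) := by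
      rw [sub_zero] at hlim
      refine ge_of_tendsto hlim ?_
      filter_upwards [eventually_ge_atTop c] with d hd
      have h2 := wronskian_sub_nonneg (κ := κ)
        (hf.isIndefiniteIntegral (hc.trans hd) Set.Icc_subset_Ici_self)
        (hf.first_isIndefiniteIntegral (hc.trans hd) Set.Icc_subset_Ici_self)
        (hasDerivAt_exp_mul (-κ))
        (fun x => ((hasDerivAt_exp_mul (-κ) x).const_mul (-κ)).congr_deriv
          (show _ = κ ^ 2 * Real.exp (-κ * x) by ring)) hc hd le_rfl
        (hη.mono fun y hy hy' => hy (hc.trans hy'.1)) (fun y _ => (Real.exp_pos _).le)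
      convert h2 using 1
      push_cast
      ring
    have h3 := mul_nonneg (Complex.zero_le_real.mpr (Real.exp_pos (κ * c)).le) h1
    convert h3 using 1
    have h4 : ((Real.exp (κ * c) : ℝ) : ℂ) * ((Real.exp (-κ * c) : ℝ) : ℂ) = 1 := by
      rw [← Complex.ofReal_mul, ← Real.exp_add]; simp
    linear_combination (-(f₁ c) - κ * f c) * h4
  refine ⟨by simpa using hW 0 le_rfl, fun h0 x hx => ?_⟩
  have hexp : IsIndefiniteIntegral x (fun x => ((Real.exp (κ * x) : ℝ) : ℂ))
      (fun x => ((κ * Real.exp (κ * x) : ℝ) : ℂ)) :=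
    .of_hasDerivAt (fun y => (hasDerivAt_exp_mul κ y).ofReal_comp) (by fun_prop)
  -- Now `(exp (κ x) f)' = exp (κ x) (f₁ + κ f) ≥ 0`, so nonnegativity propagates from `0`.
  have h1 := (hexp.mul hx (hf.isIndefiniteIntegral hx Set.Icc_subset_Ici_self)).integral_eq hx
  have h2 : 0 ≤ ∫ t in (0 : ℝ)..x, ((Real.exp (κ * t) : ℝ) : ℂ) * (f₁ t + κ * f t) :=
    intervalIntegral_mul_nonneg hx (fun t _ => (Real.exp_pos _).le)
      (ae_of_all _ fun t ht => hW t ht.1)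
  have h3 : 0 ≤ ((Real.exp (κ * x) : ℝ) : ℂ) * f x := by
    rw [h1]
    refine add_nonneg (by simpa using h0) ?_
    convert h2 using 1
    refine intervalIntegral.integral_congr fun t _ => ?_
    push_cast
    ring
  have h4 := mul_nonneg (Complex.zero_le_real.mpr (Real.exp_pos (-κ * x)).le) h3
  convert h4 using 1
  have h5 : ((Real.exp (-κ * x) : ℝ) : ℂ) * ((Real.exp (κ * x) : ℝ) : ℂ) = 1 := by
    rw [← Complex.ofReal_mul, ← Real.exp_add]; simp
  rw [← mul_assoc, h5, one_mul]

end HalfLine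

/-! ### Solvability on a single edge. -/

section Existence

/-- Energy estimate: `|y + ζ / μ|² ≥ 0` gives `|y|² ≤ μ⁻¹ (|y|²)' + μ⁻² |ζ|²`. Only the boundary
term needs an upper bound; its sign settles this for decaying solutions, and boundedness of `y` for
growing exponents. -/
theorem memLp_of_first_order {μ : ℝ} (hμ : μ ≠ 0) {y ζ : ℝ → ℂ}
    (hy : ∀ X, 0 ≤ X → IsIndefiniteIntegral X y (fun t => μ * y t + ζ t))
    (hζ : MemLp ζ 2 (volume.restrict (Set.Ici 0))) {C : ℝ}
    (hC : ∀ X, 0 ≤ X → (‖y X‖ ^ 2 - ‖y 0‖ ^ 2) / μ ≤ C) :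
    MemLp y 2 (volume.restrict (Set.Ici 0)) := by
  have hsq : IntegrableOn (fun x => ‖ζ x‖ ^ 2) (Set.Ici 0) :=
    (memLp_two_iff_integrable_sq_norm hζ.1).mp hζ
  refine memLp_two_Ici_of_bounded (fun X hX => (hy X hX).continuousOn)
    (C := C + (μ ^ 2)⁻¹ * ∫ t in Set.Ici (0 : ℝ), ‖ζ t‖ ^ 2) fun X hX => ?_
  have hp := ((hy X hX).conj.mul hX (hy X hX))
  have h1 := hp.integral_eq hX
  have h4 : ∀ t, (star (μ * y t + ζ t) * y t + star (y t) * (μ * y t + ζ t)) =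
      ((2 * μ * ‖y t‖ ^ 2 + 2 * (star (y t) * ζ t).re : ℝ) : ℂ) := by
    intro t
    rw [← Complex.normSq_eq_norm_sq, Complex.normSq_apply]
    apply Complex.ext
    · simp; ring
    · simp; ring
  have h5 : ∀ t, star (y t) * y t = ((‖y t‖ ^ 2 : ℝ) : ℂ) := fun t => by
    simp [← Complex.normSq_eq_conj_mul_self, Complex.normSq_eq_norm_sq]
  have hint := hp.integrable
  simp only [h4, h5] at h1 hint
  rw [intervalIntegral.integral_ofReal, ← Complex.ofReal_add, Complex.ofReal_inj] at h1
  have hint' : IntervalIntegrable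
      (fun t => 2 * μ * ‖y t‖ ^ 2 + 2 * (star (y t) * ζ t).re) volume 0 X := by
    exact ⟨by simpa only [RCLike.re_to_complex, Complex.ofReal_re, IntegrableOn] using hint.1.re,
      by simpa only [RCLike.re_to_complex, Complex.ofReal_re, IntegrableOn] using hint.2.re⟩
  have hyc : IntervalIntegrable (fun t => ‖y t‖ ^ 2) volume 0 X :=
    ContinuousOn.intervalIntegrable (by
      rw [Set.uIcc_of_le hX]; exact (hy X hX).continuousOn.norm.pow 2)
  have hζi : IntervalIntegrable (fun t => ‖ζ t‖ ^ 2) volume 0 X :=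
    (intervalIntegrable_iff_integrableOn_Ioc_of_le hX).mpr
      (hsq.mono_set (Set.Ioc_subset_Icc_self.trans Set.Icc_subset_Ici_self))
  have hmono := intervalIntegral.integral_mono_on hX hyc
    ((hint'.const_mul μ⁻¹).add (hζi.const_mul (μ ^ 2)⁻¹)) (fun t _ => by
      have h6 : ‖y t + (μ⁻¹ : ℝ) * ζ t‖ ^ 2 = ‖y t‖ ^ 2 + 2 * μ⁻¹ * (star (y t) * ζ t).re +
          (μ ^ 2)⁻¹ * ‖ζ t‖ ^ 2 := by
        simp only [← Complex.normSq_eq_norm_sq, Complex.normSq_apply]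
        simp
        field_simp
        ring
      have h7 : 0 ≤ ‖y t + (μ⁻¹ : ℝ) * ζ t‖ ^ 2 := by positivity
      have h8 : μ⁻¹ * (2 * μ * ‖y t‖ ^ 2 + 2 * (star (y t) * ζ t).re) =
          2 * ‖y t‖ ^ 2 + 2 * μ⁻¹ * (star (y t) * ζ t).re := by
        field_simp
      linarith)
  rw [intervalIntegral.integral_add (hint'.const_mul _) (hζi.const_mul _),
    intervalIntegral.integral_const_mul, intervalIntegral.integral_const_mul] at hmono
  have h9 : ∫ t in (0 : ℝ)..X, ‖ζ t‖ ^ 2 ≤ ∫ t in Set.Ici (0 : ℝ), ‖ζ t‖ ^ 2 := by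
    rw [intervalIntegral.integral_of_le hX]
    exact setIntegral_mono_set hsq (ae_of_all _ fun _ => by positivity)
      (Set.Ioc_subset_Icc_self.trans Set.Icc_subset_Ici_self).eventuallyLE
  have h10 : 0 ≤ (μ ^ 2)⁻¹ := by positivity
  have h11 := hC X hX
  rw [h1, add_sub_cancel_left, div_eq_inv_mul] at h11
  have h12 := mul_le_mul_of_nonneg_left h9 h10
  linarith

theorem isIndefiniteIntegral_variation_of_constants (μ : ℝ) (A : ℂ) {ζ : ℝ → ℂ} {X : ℝ}
    (hX : 0 ≤ X) (hζ : IntervalIntegrable ζ volume 0 X) :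
    IsIndefiniteIntegral X
      (fun x => ((Real.exp (μ * x) : ℝ) : ℂ) *
        (A + ∫ t in (0 : ℝ)..x, ((Real.exp (-μ * t) : ℝ) : ℂ) * ζ t))
      (fun x => μ * (((Real.exp (μ * x) : ℝ) : ℂ) *
        (A + ∫ t in (0 : ℝ)..x, ((Real.exp (-μ * t) : ℝ) : ℂ) * ζ t)) + ζ x) := by
  have hexp : IsIndefiniteIntegral X (fun x => ((Real.exp (μ * x) : ℝ) : ℂ))
      (fun x => ((μ * Real.exp (μ * x) : ℝ) : ℂ)) :=
    .of_hasDerivAt (fun y => (hasDerivAt_exp_mul μ y).ofReal_comp) (by fun_prop)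
  have hI : IsIndefiniteIntegral X
      (fun x => A + ∫ t in (0 : ℝ)..x, ((Real.exp (-μ * t) : ℝ) : ℂ) * ζ t)
      (fun t => ((Real.exp (-μ * t) : ℝ) : ℂ) * ζ t) :=
    ⟨hζ.continuousOn_mul (Continuous.continuousOn (by fun_prop)), fun x _ => by simp⟩
  refine (hexp.mul hX hI).congr hX (fun x _ => rfl) (ae_of_all _ fun x _ => ?_)
  have h5 : ((Real.exp (μ * x) : ℝ) : ℂ) * ((Real.exp (-μ * x) : ℝ) : ℂ) = 1 := by
    rw [← Complex.ofReal_mul, ← Real.exp_add]; simp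
  rw [← mul_assoc _ _ (ζ x), h5]
  push_cast
  ring

/-- The bounded solution of `g' = κ g - η`. -/
theorem exists_backward_solution {κ : ℝ} (hκ : 0 < κ) {η : ℝ → ℂ}
    (hη : MemLp η 2 (volume.restrict (Set.Ici 0))) :
    ∃ g : ℝ → ℂ, MemLp g 2 (volume.restrict (Set.Ici 0)) ∧
      ∀ X, 0 ≤ X → IsIndefiniteIntegral X g (fun t => κ * g t + -η t) := by
  have hint : IntegrableOn (fun t => ((Real.exp (-κ * t) : ℝ) : ℂ) * η t) (Set.Ici 0) :=
    (memLp_exp_neg hκ).integrable_mul_Ici hη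
  have hsq : IntegrableOn (fun x => ‖η x‖ ^ 2) (Set.Ici 0) :=
    (memLp_two_iff_integrable_sq_norm hη.1).mp hη
  -- The unique constant that cancels the growing mode: the solution becomes an integral over the
  -- tail `(x, ∞)`.
  set A := ∫ t in Set.Ioi (0 : ℝ), ((Real.exp (-κ * t) : ℝ) : ℂ) * η t with hA
  have hsol : ∀ X : ℝ, 0 ≤ X → _ := fun X hX => isIndefiniteIntegral_variation_of_constants κ A hX
    (hη.neg.intervalIntegrable hX Set.Icc_subset_Ici_self)
  refine ⟨_, ?_, hsol⟩
  set g : ℝ → ℂ := fun x => ((Real.exp (κ * x) : ℝ) : ℂ) *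
        (A + ∫ t in (0 : ℝ)..x, ((Real.exp (-κ * t) : ℝ) : ℂ) * (-η) t) with hg
  have hgx : ∀ x, 0 ≤ x → g x = ((Real.exp (κ * x) : ℝ) : ℂ) *
      ∫ t in Set.Ioi x, ((Real.exp (-κ * t) : ℝ) : ℂ) * η t := by
    intro x hx
    have h1 := intervalIntegral.integral_interval_add_Ioi (μ := volume) (a := 0) (b := x)
      (hint.mono_set Set.Ioi_subset_Ici_self)
      (hint.mono_set (fun y hy => hx.trans (le_of_lt hy)))
    simp only [hg, Pi.neg_apply, mul_neg, intervalIntegral.integral_neg]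
    rw [hA, ← h1]
    ring
  -- From `u v ≤ (u² + v²) / 2` with `u = exp (κ (x - t))`, whose square has integral `1 / (2κ)`
  -- over the tail.
  set K := 1 / (4 * κ) + (∫ t in Set.Ici (0 : ℝ), ‖η t‖ ^ 2) / 2 with hK
  have hbound : ∀ x, 0 ≤ x → ‖g x‖ ≤ K := by
    intro x hx
    have hsub : Set.Ioi x ⊆ Set.Ici 0 := fun y hy => hx.trans (le_of_lt hy)
    have hexp2 := integrableOn_exp_mul_Ioi (a := -(2 * κ)) (by linarith) x
    have hmaj : IntegrableOn (fun t => (Real.exp (2 * κ * x) * Real.exp (-(2 * κ) * t) +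
        ‖η t‖ ^ 2) / 2) (Set.Ioi x) :=
      ((hexp2.const_mul _).add (hsq.mono_set hsub)).div_const 2
    rw [hgx x hx, ← integral_const_mul]
    calc _ ≤ ∫ t in Set.Ioi x, ‖((Real.exp (κ * x) : ℝ) : ℂ) *
            (((Real.exp (-κ * t) : ℝ) : ℂ) * η t)‖ := norm_integral_le_integral_norm _
      _ ≤ ∫ t in Set.Ioi x, (Real.exp (2 * κ * x) * Real.exp (-(2 * κ) * t) + ‖η t‖ ^ 2) / 2 := by
          refine integral_mono ((hint.mono_set hsub).const_mul _).norm hmaj fun t => ?_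
          simp only [norm_mul, Complex.norm_real, Real.norm_eq_abs, Real.abs_exp]
          have h1 : Real.exp (2 * κ * x) * Real.exp (-(2 * κ) * t) =
              (Real.exp (κ * x) * Real.exp (-κ * t)) ^ 2 := by
            rw [mul_pow, ← Real.exp_nat_mul, ← Real.exp_nat_mul]
            congr 2 <;> (push_cast; ring)
          rw [h1]
          nlinarith [sq_nonneg (Real.exp (κ * x) * Real.exp (-κ * t) - ‖η t‖)]
      _ ≤ K := by
          rw [integral_div, integral_add (hexp2.const_mul _) (hsq.mono_set hsub),
            integral_const_mul, integral_exp_mul_Ioi (by linarith)]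
          have h1 : Real.exp (2 * κ * x) * (-Real.exp (-(2 * κ) * x) / -(2 * κ)) = 1 / (2 * κ) := by
            have : Real.exp (2 * κ * x) * Real.exp (-(2 * κ) * x) = 1 := by
              rw [← Real.exp_add]; simp
            rw [neg_div_neg_eq, ← mul_div_assoc, this]
          have h2 : ∫ t in Set.Ioi x, ‖η t‖ ^ 2 ≤ ∫ t in Set.Ici (0 : ℝ), ‖η t‖ ^ 2 :=
            setIntegral_mono_set hsq (ae_of_all _ fun _ => by positivity) hsub.eventuallyLE
          rw [h1, hK]
          have h3 : 1 / (4 * κ) = 1 / (2 * κ) / 2 := by field_simp; norm_num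
          rw [h3]
          linarith
  refine memLp_of_first_order hκ.ne' (ζ := -η) hsol hη.neg (C := K ^ 2 / κ) fun X hX => ?_
  refine div_le_div_of_nonneg_right ?_ hκ.le
  have h1 := pow_le_pow_left₀ (norm_nonneg _) (hbound X hX) 2
  have h2 : 0 ≤ ‖g 0‖ ^ 2 := by positivity
  linarith

/-- Solvability of `κ² f - f'' = η` on the half-line. -/
theorem exists_isSobolevTwo_Ici {κ : ℝ} (hκ : 0 < κ) {η : ℝ → ℂ}
    (hη : MemLp η 2 (volume.restrict (Set.Ici 0))) :
    ∃ f f₁ : ℝ → ℂ, IsSobolevTwo (Set.Ici 0) f f₁ (fun x => κ ^ 2 * f x - η x) := by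
  -- Factorization `κ² - ∂² = (κ - ∂)(κ + ∂)`: the equation for `g` is solved from infinity, then
  -- `f' = -κ f + g` is solved from `f 0 = 0`.
  obtain ⟨g, hgL, hg⟩ := exists_backward_solution hκ hη
  have hsol : ∀ X : ℝ, 0 ≤ X → _ := fun X hX => isIndefiniteIntegral_variation_of_constants (-κ) 0 hX
    (hgL.intervalIntegrable hX Set.Icc_subset_Ici_self)
  set f : ℝ → ℂ := fun x => ((Real.exp (-κ * x) : ℝ) : ℂ) *
        (0 + ∫ t in (0 : ℝ)..x, ((Real.exp (-(-κ) * t) : ℝ) : ℂ) * g t) with hf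
  have hf0 : f 0 = 0 := by simp [hf]
  have hfL : MemLp f 2 (volume.restrict (Set.Ici 0)) := by
    refine memLp_of_first_order (neg_ne_zero.mpr hκ.ne') hsol hgL (C := 0) fun X _ => ?_
    rw [hf0, norm_zero, div_neg, neg_nonpos]
    simp only [ne_eq, OfNat.ofNat_ne_zero, not_false_eq_true, zero_pow, sub_zero]
    positivity
  refine ⟨f, fun x => ((-κ : ℝ) : ℂ) * f x + g x, .of_isIndefiniteIntegral hfL
    ((hfL.const_mul _).sub hη) fun x hx => ⟨hx, hsol x hx, ?_⟩⟩
  refine (((hsol x hx).const_mul ((-κ : ℝ) : ℂ)).add (hg x hx)).congr hx (fun y _ => rfl)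
    (ae_of_all _ fun y _ => ?_)
  simp only [Complex.ofReal_neg]
  ring

/-- The equation `κ² f - f'' = η` on the half-line with a prescribed boundary value. -/
theorem exists_dirichlet_solution_Ici {κ : ℝ} (hκ : 0 < κ) {η : ℝ → ℂ}
    (hη : MemLp η 2 (volume.restrict (Set.Ici 0))) :
    ∃ d : ℂ, ∀ c : ℂ, ∃ f f₁ : ℝ → ℂ,
      IsSobolevTwo (Set.Ici 0) f f₁ (fun x => κ ^ 2 * f x - η x) ∧ f 0 = c ∧
        f₁ 0 = d - κ * c := by
  obtain ⟨p, p₁, hp⟩ := exists_isSobolevTwo_Ici hκ hη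
  have hs : ∀ x ∈ Set.Ici (0 : ℝ), 0 ≤ x ∧ Set.Icc 0 x ⊆ Set.Ici 0 := fun x hx =>
    ⟨hx, Set.Icc_subset_Ici_self⟩
  -- This combination is unchanged when multiples of `exp (-κ x)` are added, so it does not depend
  -- on the prescribed boundary value.
  refine ⟨p₁ 0 + κ * p 0, fun c => ?_⟩
  have h := hp.add hs ((isSobolevTwo_exp_neg hκ).const_mul hs (c - p 0))
  refine ⟨fun x => p x + (c - p 0) * ((Real.exp (-κ * x) : ℝ) : ℂ),
    fun x => p₁ x + (c - p 0) * (-κ * ((Real.exp (-κ * x) : ℝ) : ℂ)), ?_, ?_, ?_⟩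
  · convert h using 2
    ring
  · simp
  · simp; ring

theorem Continuous.memLp_two_Icc {φ : ℝ → ℂ} (hφ : Continuous φ) (a : ℝ) :
    MemLp φ 2 (volume.restrict (Set.Icc 0 a)) := by
  rw [memLp_two_iff_integrable_sq_norm hφ.aestronglyMeasurable]
  exact (hφ.norm.pow 2).integrableOn_Icc

/-- The equation `κ² f - f'' = η` on a bounded interval with prescribed boundary values. -/
theorem exists_dirichlet_solution_Icc {κ a : ℝ} (hκ : 0 < κ) (ha : 0 < a) {η : ℝ → ℂ}
    (hη : MemLp η 2 (volume.restrict (Set.Icc 0 a))) :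
    ∃ d₀ d₁ : ℂ, ∀ c₀ c₁ : ℂ, ∃ f f₁ : ℝ → ℂ,
      IsSobolevTwo (Set.Icc 0 a) f f₁
        (fun x => κ ^ 2 * f x - (Set.Icc 0 a).indicator η x) ∧ f 0 = c₀ ∧ f a = c₁ ∧
        f₁ 0 = d₀ - (((κ * Real.cosh (κ * a) / Real.sinh (κ * a) : ℝ) : ℂ) * c₀ -
          ((κ / Real.sinh (κ * a) : ℝ) : ℂ) * c₁) ∧
        -f₁ a = d₁ - (((κ * Real.cosh (κ * a) / Real.sinh (κ * a) : ℝ) : ℂ) * c₁ -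
          ((κ / Real.sinh (κ * a) : ℝ) : ℂ) * c₀) := by
  -- Extending `η` by zero reduces the particular solution to the half-line.
  have hη' : MemLp ((Set.Icc 0 a).indicator η) 2 (volume.restrict (Set.Ici 0)) := by
    rw [memLp_indicator_iff_restrict measurableSet_Icc,
      Measure.restrict_restrict measurableSet_Icc,
      Set.inter_eq_left.mpr Set.Icc_subset_Ici_self]
    exact hη
  obtain ⟨p, p₁, hp'⟩ := exists_isSobolevTwo_Ici hκ hη'
  have hmono : volume.restrict (Set.Icc 0 a) ≤ volume.restrict (Set.Ici (0 : ℝ)) :=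
    Measure.restrict_mono Set.Icc_subset_Ici_self le_rfl
  have hp : IsSobolevTwo (Set.Icc 0 a) p p₁
      (fun x => κ ^ 2 * p x - (Set.Icc 0 a).indicator η x) :=
    ⟨hp'.memLp.mono_measure hmono, hp'.memLp_second.mono_measure hmono,
      fun x hx => hp'.eq_integral x hx.1, fun x hx => hp'.first_eq_integral x hx.1⟩
  have hs : ∀ x ∈ Set.Icc (0 : ℝ) a, 0 ≤ x ∧ Set.Icc 0 x ⊆ Set.Icc 0 a := fun x hx =>
    ⟨hx.1, Set.Icc_subset_Icc_right hx.2⟩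
  have hu1 : IsSobolevTwo (Set.Icc 0 a) (fun x => ((Real.sinh (κ * x) : ℝ) : ℂ))
      (fun x => ((κ * Real.cosh (κ * x) : ℝ) : ℂ))
      (fun x => ((κ ^ 2 * Real.sinh (κ * x) : ℝ) : ℂ)) :=
    .of_hasDerivAt (fun x hx => hx.1) (fun x => (hasDerivAt_sinh_mul κ x).ofReal_comp)
      (fun x => (hasDerivAt_cosh_mul κ x).ofReal_comp) (by fun_prop)
      (Continuous.memLp_two_Icc (by fun_prop) a) (Continuous.memLp_two_Icc (by fun_prop) a)
  have hu0 : IsSobolevTwo (Set.Icc 0 a) (fun x => ((Real.sinh (κ * (a - x)) : ℝ) : ℂ))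
      (fun x => ((-(κ * Real.cosh (κ * (a - x))) : ℝ) : ℂ))
      (fun x => ((κ ^ 2 * Real.sinh (κ * (a - x)) : ℝ) : ℂ)) :=
    .of_hasDerivAt (fun x hx => hx.1) (fun x => (hasDerivAt_sinh_mul_sub κ a x).ofReal_comp)
      (fun x => (hasDerivAt_cosh_mul_sub κ a x).ofReal_comp) (by fun_prop)
      (Continuous.memLp_two_Icc (by fun_prop) a) (Continuous.memLp_two_Icc (by fun_prop) a)
  have hsa : 0 < Real.sinh (κ * a) := Real.sinh_pos_iff.mpr (by positivity)
  obtain ⟨S, hS⟩ : ∃ S, Real.sinh (κ * a) = S := ⟨_, rfl⟩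
  obtain ⟨Ch, hCh⟩ : ∃ Ch, Real.cosh (κ * a) = Ch := ⟨_, rfl⟩
  rw [hS] at hsa
  have hS' : (S : ℂ) ≠ 0 := by exact_mod_cast hsa.ne'
  rw [hS, hCh]
  -- These combinations vanish on homogeneous solutions, so they depend only on the particular
  -- solution `p`.
  refine ⟨p₁ 0 + ((κ * Ch / S : ℝ) : ℂ) * p 0 - ((κ / S : ℝ) : ℂ) * p a,
    -p₁ a + ((κ * Ch / S : ℝ) : ℂ) * p a - ((κ / S : ℝ) : ℂ) * p 0, fun c₀ c₁ => ?_⟩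
  have h := (hp.add hs (hu0.const_mul hs ((c₀ - p 0) / S))).add hs
    (hu1.const_mul hs ((c₁ - p a) / S))
  refine ⟨fun x => p x + (c₀ - p 0) / S * ((Real.sinh (κ * (a - x)) : ℝ) : ℂ) +
      (c₁ - p a) / S * ((Real.sinh (κ * x) : ℝ) : ℂ),
    fun x => p₁ x + (c₀ - p 0) / S * ((-(κ * Real.cosh (κ * (a - x))) : ℝ) : ℂ) +
      (c₁ - p a) / S * ((κ * Real.cosh (κ * x) : ℝ) : ℂ), ?_, ?_, ?_, ?_, ?_⟩
  · convert h using 2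
    push_cast
    ring
  · simp only [sub_zero, mul_zero, Real.sinh_zero, hS, Complex.ofReal_zero]
    field_simp
    ring
  · simp only [sub_self, mul_zero, Real.sinh_zero, hS, Complex.ofReal_zero]
    field_simp
    ring
  · simp only [sub_zero, mul_zero, Real.cosh_zero, hCh]
    push_cast
    field_simp
    ring
  · simp only [sub_self, mul_zero, Real.cosh_zero, hCh]
    push_cast
    field_simp
    ring

end Existence

/-! ### The Dirichlet-to-Neumann matrix and its deviation from a scalar. -/

section DirichletToNeumann

theorem div_sinh_le {κ a : ℝ} (hκ : 0 < κ) (ha : 0 < a) : κ / Real.sinh (κ * a) ≤ 1 / a := by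
  have hx : 0 < κ * a := by positivity
  rw [div_le_div_iff₀ (Real.sinh_pos_iff.mpr hx) ha, one_mul]
  exact Real.self_le_sinh_iff.mpr hx.le

theorem mul_cosh_div_sinh_eq {κ a : ℝ} (hκ : 0 < κ) (ha : 0 < a) :
    κ * Real.cosh (κ * a) / Real.sinh (κ * a) =
      κ + Real.exp (-(κ * a)) * (κ / Real.sinh (κ * a)) := by
  have hs : 0 < Real.sinh (κ * a) := Real.sinh_pos_iff.mpr (by positivity)
  rw [← Real.cosh_sub_sinh]
  field_simp
  ring

theorem le_mul_cosh_div_sinh {κ a : ℝ} (hκ : 0 < κ) (ha : 0 < a) :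
    κ ≤ κ * Real.cosh (κ * a) / Real.sinh (κ * a) := by
  have hs : 0 < Real.sinh (κ * a) := Real.sinh_pos_iff.mpr (by positivity)
  rw [mul_cosh_div_sinh_eq hκ ha, le_add_iff_nonneg_right]
  positivity

theorem mul_cosh_div_sinh_le {κ a : ℝ} (hκ : 0 < κ) (ha : 0 < a) :
    κ * Real.cosh (κ * a) / Real.sinh (κ * a) ≤ κ + 1 / a := by
  have hs : 0 < Real.sinh (κ * a) := Real.sinh_pos_iff.mpr (by positivity)
  rw [mul_cosh_div_sinh_eq hκ ha]
  have h1 : Real.exp (-(κ * a)) ≤ 1 := Real.exp_le_one_iff.mpr (by nlinarith)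
  have h2 : 0 ≤ κ / Real.sinh (κ * a) := by positivity
  have h3 := div_sinh_le hκ ha
  nlinarith

variable {I E : Type*}

/-- The Dirichlet-to-Neumann map of `-d²/dx² + κ²` on the edges, subtracted from the
scalar matrix `κ + b`. -/
noncomputable def dirichletToNeumannDefect (E : Type*) [DecidableEq I] [DecidableEq E] (a : I → ℝ) (b κ : ℝ) :
    Matrix (EdgeEnd I E) (EdgeEnd I E) ℝ :=
  Matrix.fromBlocks (Matrix.diagonal fun _ => b) 0 0
    (Matrix.fromBlocks
      (Matrix.diagonal fun i => κ + b - κ * Real.cosh (κ * a i) / Real.sinh (κ * a i))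
      (Matrix.diagonal fun i => κ / Real.sinh (κ * a i))
      (Matrix.diagonal fun i => κ / Real.sinh (κ * a i))
      (Matrix.diagonal fun i => κ + b - κ * Real.cosh (κ * a i) / Real.sinh (κ * a i)))

theorem dirichletToNeumannDefect_isSymm [DecidableEq I] [DecidableEq E] (a : I → ℝ) (b κ : ℝ) :
    (dirichletToNeumannDefect E a b κ).IsSymm := by
  simp [dirichletToNeumannDefect, Matrix.IsSymm, Matrix.fromBlocks_transpose]

theorem one_div_le_sum [Fintype I] {a : I → ℝ} (ha : ∀ i, 0 < a i) (i : I) : 1 / a i ≤ ∑ i, 1 / a i :=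
  Finset.single_le_sum (f := fun i => 1 / a i) (fun i _ => (one_div_pos.mpr (ha i)).le)
    (Finset.mem_univ i)

/-- Since `κ ≤ κ coth (κ a) ≤ κ + 1 / a` and `κ / sinh (κ a) ≤ 1 / a`, the shift by `∑ 1 / aᵢ` makes
all entries nonnegative, with a bound independent of `κ`. -/
theorem dirichletToNeumannDefect_mem_Icc [Fintype I] [DecidableEq I] [DecidableEq E] {a : I → ℝ}
    (ha : ∀ i, 0 < a i) {κ : ℝ} (hκ : 0 < κ)
    (h k : EdgeEnd I E) :
    dirichletToNeumannDefect E a (∑ i, 1 / a i) κ h k ∈ Set.Icc 0 (∑ i, 1 / a i) := by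
  have hb : 0 ≤ ∑ i, 1 / a i := Finset.sum_nonneg fun i _ => (one_div_pos.mpr (ha i)).le
  have hC : ∀ i, κ + ∑ i, 1 / a i - κ * Real.cosh (κ * a i) / Real.sinh (κ * a i) ∈
      Set.Icc 0 (∑ i, 1 / a i) := fun i => by
    have h1 := le_mul_cosh_div_sinh hκ (ha i)
    have h2 := mul_cosh_div_sinh_le hκ (ha i)
    have h3 := one_div_le_sum ha i
    constructor <;> linarith
  have hD : ∀ i, κ / Real.sinh (κ * a i) ∈ Set.Icc 0 (∑ i, 1 / a i) := fun i =>
    ⟨div_nonneg hκ.le (Real.sinh_nonneg_iff.mpr (mul_pos hκ (ha i)).le),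
      (div_sinh_le hκ (ha i)).trans (one_div_le_sum ha i)⟩
  have hdiag : ∀ {m : Type _} [DecidableEq m] (v : m → ℝ),
      (∀ i, v i ∈ Set.Icc 0 (∑ i, 1 / a i)) → ∀ i j,
        Matrix.diagonal v i j ∈ Set.Icc 0 (∑ i, 1 / a i) := fun v hv i j => by
    rw [Matrix.diagonal_apply]
    split_ifs
    exacts [hv i, ⟨le_rfl, hb⟩]
  have hdiagE : ∀ i j : E, Matrix.diagonal (fun _ => ∑ i, 1 / a i) i j ∈
      Set.Icc 0 (∑ i, 1 / a i) := fun i j => by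
    rw [Matrix.diagonal_apply]
    split_ifs
    exacts [⟨hb, le_rfl⟩, ⟨le_rfl, hb⟩]
  rcases h with h | h | h <;> rcases k with k | k | k
  · exact hdiagE h k
  · exact ⟨le_rfl, hb⟩
  · exact ⟨le_rfl, hb⟩
  · exact ⟨le_rfl, hb⟩
  · exact hdiag _ hC h k
  · exact hdiag _ hD h k
  · exact ⟨le_rfl, hb⟩
  · exact hdiag _ hD h k
  · exact hdiag _ hC h k

theorem dirichletToNeumannDefect_mulVec [Fintype I] [DecidableEq I] [Fintype E] [DecidableEq E]
    (a : I → ℝ) (b κ : ℝ) (c : EdgeEnd I E → ℂ) :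
    ((κ + b : ℝ) : ℂ) • c - (dirichletToNeumannDefect E a b κ).map Complex.ofReal *ᵥ c =
      Sum.elim (fun e => κ * c (Sum.inl e)) (Sum.elim
        (fun i => ((κ * Real.cosh (κ * a i) / Real.sinh (κ * a i) : ℝ) : ℂ) * c (.inr (.inl i)) -
          ((κ / Real.sinh (κ * a i) : ℝ) : ℂ) * c (.inr (.inr i)))
        (fun i => ((κ * Real.cosh (κ * a i) / Real.sinh (κ * a i) : ℝ) : ℂ) * c (.inr (.inr i)) -
          ((κ / Real.sinh (κ * a i) : ℝ) : ℂ) * c (.inr (.inl i)))) := by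
  ext h
  rcases h with e | i | i
  · simp [dirichletToNeumannDefect, Matrix.fromBlocks_map, Matrix.fromBlocks_mulVec,
      Matrix.diagonal_map]
    ring
  · simp [dirichletToNeumannDefect, Matrix.fromBlocks_map, Matrix.fromBlocks_mulVec,
      Matrix.diagonal_map, Matrix.mulVec_diagonal]
    ring
  · simp [dirichletToNeumannDefect, Matrix.fromBlocks_map, Matrix.fromBlocks_mulVec,
      Matrix.diagonal_map, Matrix.mulVec_diagonal]
    ring

end DirichletToNeumann

/-! ### Selfadjointness of the Laplacian. -/

section LaplaceGraph

variable {I E : Type*} {a : I → ℝ}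

theorem edgeSet_initial (j : E ⊕ I) :
    ∀ x ∈ edgeSet a j, 0 ≤ x ∧ Set.Icc 0 x ⊆ edgeSet a j := by
  rcases j with e | i
  · exact fun x hx => ⟨hx, Set.Icc_subset_Ici_self⟩
  · exact fun x hx => ⟨hx.1, Set.Icc_subset_Icc_right hx.2⟩

theorem boundaryValues_add (f f₁ g g₁ : E ⊕ I → ℝ → ℂ) :
    boundaryValues a (fun j x => f j x + g j x) (fun j x => f₁ j x + g₁ j x) =
      boundaryValues a f f₁ + boundaryValues a g g₁ := by
  refine Prod.ext (funext ?_) (funext ?_) <;> rintro (e | i | i) <;> simp [boundaryValues]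
  ring

theorem boundaryValues_const_mul (c : ℂ) (f f₁ : E ⊕ I → ℝ → ℂ) :
    boundaryValues a (fun j x => c * f j x) (fun j x => c * f₁ j x) =
      c • boundaryValues a f f₁ := by
  refine Prod.ext (funext ?_) (funext ?_) <;> rintro (e | i | i) <;> simp [boundaryValues]

theorem IsSobolevTwo.green_Ici {f f₁ f₂ g g₁ g₂ : ℝ → ℂ} (hf : IsSobolevTwo (Set.Ici 0) f f₁ f₂)
    (hg : IsSobolevTwo (Set.Ici 0) g g₁ g₂) :
    ∫ x in Set.Ici 0, (star (f₂ x) * g x - star (f x) * g₂ x) =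
      star (f 0) * g₁ 0 - star (f₁ 0) * g 0 :=
  (hf.conj fun _ hx => ⟨hx, Set.Icc_subset_Ici_self⟩).wronskian_integral hg

theorem IsSobolevTwo.green_Icc {b : ℝ} (hb : 0 < b) {f f₁ f₂ g g₁ g₂ : ℝ → ℂ}
    (hf : IsSobolevTwo (Set.Icc 0 b) f f₁ f₂) (hg : IsSobolevTwo (Set.Icc 0 b) g g₁ g₂) :
    ∫ x in Set.Icc 0 b, (star (f₂ x) * g x - star (f x) * g₂ x) =
      (star (f 0) * g₁ 0 - star (f₁ 0) * g 0) +
        (star (f b) * (-g₁ b) - star (-f₁ b) * g b) := by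
  have h := (IsIndefiniteIntegral.wronskian hb.le (hf.isIndefiniteIntegral hb.le subset_rfl).conj
    (hf.first_isIndefiniteIntegral hb.le subset_rfl).conj
    (hg.isIndefiniteIntegral hb.le subset_rfl)
    (hg.first_isIndefiniteIntegral hb.le subset_rfl)).integral_eq hb.le
  rw [integral_Icc_eq_integral_Ioc, ← intervalIntegral.integral_of_le hb.le, star_neg]
  linear_combination -h

variable [Fintype I] [Fintype E]

/-- Because derivatives point into the edge, initial and terminal ends contribute with the same
sign, and the boundary terms add up to `ω`. -/
theorem sum_green (ha : ∀ i, 0 < a i) {f f₁ f₂ g g₁ g₂ : E ⊕ I → ℝ → ℂ}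
    (hf : ∀ j, IsSobolevTwo (edgeSet a j) (f j) (f₁ j) (f₂ j))
    (hg : ∀ j, IsSobolevTwo (edgeSet a j) (g j) (g₁ j) (g₂ j)) :
    ∑ j, ∫ x in edgeSet a j, (star (f₂ j x) * g j x - star (f j x) * g₂ j x) =
      sympForm (boundaryValues a f f₁) (boundaryValues a g g₁) := by
  have hE : ∀ e : E, ∫ x in edgeSet a (.inl e),
      (star (f₂ (.inl e) x) * g (.inl e) x - star (f (.inl e) x) * g₂ (.inl e) x) = _ :=
    fun e => (hf (.inl e)).green_Ici (hg (.inl e))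
  have hI : ∀ i : I, ∫ x in edgeSet a (.inr i : E ⊕ I),
      (star (f₂ (.inr i) x) * g (.inr i) x - star (f (.inr i) x) * g₂ (.inr i) x) = _ :=
    fun i => (hf (.inr i)).green_Icc (ha i) (hg (.inr i))
  simp only [Fintype.sum_sum_type, hE, hI, sympForm, dotProduct, boundaryValues, Pi.star_apply,
    Sum.elim_inl, Sum.elim_inr, Finset.sum_add_distrib, Finset.sum_sub_distrib]
  ring

theorem GraphL2.inner_eq {ψ φ : GraphL2 E a} {f g : E ⊕ I → ℝ → ℂ}
    (hf : ∀ j, (ψ j : ℝ → ℂ) =ᵐ[volume.restrict (edgeSet a j)] f j)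
    (hg : ∀ j, (φ j : ℝ → ℂ) =ᵐ[volume.restrict (edgeSet a j)] g j) :
    inner ℂ ψ φ = ∑ j, ∫ x in edgeSet a j, star (f j x) * g j x := by
  rw [PiLp.inner_apply]
  refine Finset.sum_congr rfl fun j _ => ?_
  rw [L2.inner_def]
  refine integral_congr_ae ?_
  filter_upwards [hf j, hg j] with x h1 h2
  rw [h1, h2, RCLike.inner_apply', Complex.star_def]

theorem LaplaceGraph.add {M : Submodule ℂ (Double (EdgeEnd I E))} {ψ φ ψ' φ' : GraphL2 E a}
    (h : LaplaceGraph a M ψ φ) (h' : LaplaceGraph a M ψ' φ') :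
    LaplaceGraph a M (ψ + ψ') (φ + φ') := by
  obtain ⟨f, f₁, f₂, hf, hψ, hφ, hM⟩ := h
  obtain ⟨g, g₁, g₂, hg, hψ', hφ', hM'⟩ := h'
  refine ⟨_, _, _, fun j => (hf j).add (edgeSet_initial j) (hg j), fun j => ?_, fun j => ?_, ?_⟩
  · filter_upwards [Lp.coeFn_add (ψ j) (ψ' j), hψ j, hψ' j] with x h1 h2 h3
    rw [PiLp.add_apply, h1, Pi.add_apply, h2, h3]
  · filter_upwards [Lp.coeFn_add (φ j) (φ' j), hφ j, hφ' j] with x h1 h2 h3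
    rw [PiLp.add_apply, h1, Pi.add_apply, h2, h3]
  · rw [boundaryValues_add]
    exact M.add_mem hM hM'

theorem LaplaceGraph.smul {M : Submodule ℂ (Double (EdgeEnd I E))} {ψ φ : GraphL2 E a}
    (c : ℂ) (h : LaplaceGraph a M ψ φ) : LaplaceGraph a M (c • ψ) (c • φ) := by
  obtain ⟨f, f₁, f₂, hf, hψ, hφ, hM⟩ := h
  refine ⟨_, _, _, fun j => (hf j).const_mul (edgeSet_initial j) c, fun j => ?_, fun j => ?_, ?_⟩
  · filter_upwards [Lp.coeFn_smul c (ψ j), hψ j] with x h1 h2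
    rw [PiLp.smul_apply, h1, Pi.smul_apply, h2, smul_eq_mul]
  · filter_upwards [Lp.coeFn_smul c (φ j), hφ j] with x h1 h2
    rw [PiLp.smul_apply, h1, Pi.smul_apply, h2, smul_eq_mul]
  · rw [boundaryValues_const_mul]
    exact M.smul_mem c hM

theorem LaplaceGraph.symm (ha : ∀ i, 0 < a i) {M : Submodule ℂ (Double (EdgeEnd I E))}
    (hM : IsIsotropic M) {ψ φ ψ' φ' : GraphL2 E a}
    (h : LaplaceGraph a M ψ φ) (h' : LaplaceGraph a M ψ' φ') :
    inner ℂ φ ψ' = inner ℂ ψ φ' := by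
  obtain ⟨f, f₁, f₂, hf, hψ, hφ, hbv⟩ := h
  obtain ⟨g, g₁, g₂, hg, hψ', hφ', hbv'⟩ := h'
  rw [GraphL2.inner_eq hφ hψ', GraphL2.inner_eq hψ hφ', ← sub_eq_zero, ← Finset.sum_sub_distrib,
    ← hM _ hbv _ hbv', ← sum_green ha hf hg]
  refine Finset.sum_congr rfl fun j _ => (integral_sub ?_ ?_).symm
  · exact (hf j).memLp_second.star.integrable_mul (hg j).memLp
  · exact (hf j).memLp.star.integrable_mul (hg j).memLp_second

theorem LaplaceGraph.eq_zero (ha : ∀ i, 0 < a i) {M : Submodule ℂ (Double (EdgeEnd I E))}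
    {φ : GraphL2 E a} (h : LaplaceGraph a M 0 φ) : φ = 0 := by
  obtain ⟨f, f₁, f₂, hf, hψ, hφ, -⟩ := h
  ext j : 1
  rw [PiLp.zero_apply]
  refine Lp.ext ?_
  have h0 : ∀ᵐ x ∂volume.restrict (edgeSet a j), f j x = 0 := by
    filter_upwards [hψ j, Lp.coeFn_zero ℂ 2 (volume.restrict (edgeSet a j))] with x h1 h2
    rw [← h1, PiLp.zero_apply, h2, Pi.zero_apply]
  have h2 : ∀ᵐ x, x ∈ edgeSet a j → f₂ j x = 0 := by
    rcases j with e | i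
    · have hn : ∀ n : ℕ, ∀ᵐ x, x ∈ Set.Icc (0 : ℝ) (n + 1) → f₂ (.inl e) x = 0 := fun n =>
        (hf (.inl e)).second_ae_eq_zero (by positivity) Set.Icc_subset_Ici_self h0
      filter_upwards [ae_all_iff.mpr hn] with x hx hx0
      obtain ⟨n, hn⟩ := exists_nat_ge x
      exact hx n ⟨hx0, by linarith⟩
    · exact (hf (.inr i)).second_ae_eq_zero (ha i) subset_rfl h0
  have hmeas : MeasurableSet (edgeSet a j) := by
    rcases j with e | i
    exacts [measurableSet_Ici, measurableSet_Icc]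
  filter_upwards [hφ j, Lp.coeFn_zero ℂ 2 (volume.restrict (edgeSet a j)),
    (ae_restrict_iff' hmeas).mpr h2] with x h1 h3 h4
  rw [h1, h3, h4, Pi.zero_apply]

/-- On each edge the equation is solvable for arbitrary boundary values `c`, with inward derivatives
`d - Λ c`. The vertex conditions thus become a finite system for `c`, solvable for large `κ` because
`Λ` is a large scalar minus a bounded symmetric matrix. -/
theorem LaplaceGraph.exists_resolvent (ha : ∀ i, 0 < a i)
    {M : Submodule ℂ (Double (EdgeEnd I E))} (hM : IsMaximalIsotropic M) :
    ∃ l₀ : ℝ, ∀ l : ℝ, l₀ ≤ l → ∀ η : GraphL2 E a,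
      ∃ ψ, LaplaceGraph a M ψ ((l : ℂ) • ψ - η) := by
  classical
  obtain ⟨κ₀, hκ₀⟩ := hM.exists_solution (∑ i, 1 / a i)
  -- The `1` ensures that `κ = √l` is positive.
  refine ⟨(max κ₀ 1) ^ 2, fun l hl η => ?_⟩
  obtain ⟨κ, hκl⟩ : ∃ κ, κ = Real.sqrt l := ⟨_, rfl⟩
  have hκ1 : max κ₀ 1 ≤ κ := hκl ▸ Real.le_sqrt_of_sq_le hl
  have hκ : 0 < κ := lt_of_lt_of_le one_pos ((le_max_right _ _).trans hκ1)
  have hl2 : (l : ℂ) = (κ : ℂ) ^ 2 := by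
    rw [hκl, ← Complex.ofReal_pow, Real.sq_sqrt ((sq_nonneg _).trans hl)]
  have hb : 0 ≤ ∑ i, 1 / a i := Finset.sum_nonneg fun i _ => (one_div_pos.mpr (ha i)).le
  choose dE fE fE₁ hE using fun e : E => exists_dirichlet_solution_Ici hκ (Lp.memLp (η (.inl e)))
  choose d₀ d₁ fI fI₁ hI using fun i : I =>
    exists_dirichlet_solution_Icc hκ (ha i) (Lp.memLp (η (.inr i)))
  obtain ⟨c, hc⟩ := hκ₀ (κ + ∑ i, 1 / a i)
    (by linarith [(le_max_left κ₀ 1).trans hκ1]) _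
    (dirichletToNeumannDefect_isSymm (E := E) a (∑ i, 1 / a i) κ)
    (fun h k => by
      have := dirichletToNeumannDefect_mem_Icc ha hκ h k
      rw [abs_of_nonneg this.1]
      exact this.2)
    (Sum.elim dE (Sum.elim d₀ d₁))
  rw [dirichletToNeumannDefect_mulVec] at hc
  let f : E ⊕ I → ℝ → ℂ := Sum.elim (fun e => fE e (c (.inl e)))
    (fun i => fI i (c (.inr (.inl i))) (c (.inr (.inr i))))
  let f₁ : E ⊕ I → ℝ → ℂ := Sum.elim (fun e => fE₁ e (c (.inl e)))
    (fun i => fI₁ i (c (.inr (.inl i))) (c (.inr (.inr i))))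
  let f₂ : E ⊕ I → ℝ → ℂ := Sum.elim (fun e x => κ ^ 2 * fE e (c (.inl e)) x - η (.inl e) x)
    (fun i x => κ ^ 2 * fI i (c (.inr (.inl i))) (c (.inr (.inr i))) x -
      (Set.Icc 0 (a i)).indicator (η (.inr i)) x)
  have hf : ∀ j, IsSobolevTwo (edgeSet a j) (f j) (f₁ j) (f₂ j) := by
    rintro (e | i)
    exacts [(hE e _).1, (hI i _ _).1]
  have hf₂ : ∀ j, ∀ᵐ x ∂volume.restrict (edgeSet a j), f₂ j x = κ ^ 2 * f j x - η j x := by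
    rintro (e | i)
    · exact ae_of_all _ fun x => rfl
    · filter_upwards [ae_restrict_mem measurableSet_Icc] with x hx
      simp only [f₂, f, Sum.elim_inr]
      rw [Set.indicator_of_mem (s := Set.Icc 0 (a i)) hx]
  have hψ : ∀ j, _ =ᵐ[volume.restrict (edgeSet a j)] f j := fun j => (hf j).memLp.coeFn_toLp
  refine ⟨WithLp.toLp 2 fun j => (hf j).memLp.toLp, f, f₁, f₂, hf, hψ, fun j => ?_, ?_⟩
  · filter_upwards [hf₂ j, hψ j, Lp.coeFn_smul (l : ℂ) ((hf j).memLp.toLp),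
      Lp.coeFn_sub ((l : ℂ) • (hf j).memLp.toLp) (η j)] with x h1 h2 h3 h4
    rw [h1, PiLp.sub_apply, PiLp.smul_apply, h4, Pi.sub_apply, h3, Pi.smul_apply, h2, hl2,
      smul_eq_mul]
  · convert hc using 1
    refine Prod.ext (funext ?_) (funext ?_)
    · rintro (e | i | i)
      exacts [(hE e _).2.1, (hI i _ _).2.1, (hI i _ _).2.2.1]
    · rintro (e | i | i)
      exacts [(hE e _).2.2, (hI i _ _).2.2.2.1, (hI i _ _).2.2.2.2]

/-- The Laplace operator is self-adjoint and semibounded. -/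
theorem exists_isSelfAdjointGraph (ha : ∀ i, 0 < a i)
    {M : Submodule ℂ (Double (EdgeEnd I E))} (hM : IsMaximalIsotropic M) :
    ∃ l₀, IsSelfAdjointGraph (LaplaceGraph a M) l₀ := by
  obtain ⟨l₀, hl₀⟩ := LaplaceGraph.exists_resolvent ha hM
  exact ⟨l₀, LaplaceGraph.add, fun c _ _ => LaplaceGraph.smul c, LaplaceGraph.symm ha hM.prop,
    LaplaceGraph.eq_zero ha, hl₀⟩

end LaplaceGraph

/-! ### Positivity of the resolvent and of the semigroup. -/

section Positivity

variable {I E : Type*} {a : I → ℝ} [Fintype I] [Fintype E]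

/-- A convergent sequence in `L²` has a subsequence converging almost everywhere. -/
theorem MeasureTheory.Lp.isClosed_ae_nonneg {α : Type*} {m : MeasurableSpace α} (μ : Measure α) :
    IsClosed {φ : Lp ℂ 2 μ | ∀ᵐ x ∂μ, 0 ≤ (φ : α → ℂ) x} := by
  refine IsSeqClosed.isClosed fun φ ψ hφ hlim => ?_
  obtain ⟨ns, -, hns⟩ := (tendstoInMeasure_of_tendsto_Lp hlim).exists_seq_tendsto_ae
  filter_upwards [hns, ae_all_iff.mpr fun n => hφ (ns n)] with x h1 h2
  exact ge_of_tendsto' h1 h2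

theorem isClosed_isNonnegative : IsClosed {ψ : GraphL2 E a | IsNonnegative ψ} := by
  simp only [IsNonnegative, Set.ofPred_forall]
  exact isClosed_iInter fun j =>
    (Lp.isClosed_ae_nonneg (volume.restrict (edgeSet a j))).preimage
      (PiLp.continuous_apply 2 (fun j : E ⊕ I => Lp ℂ 2 (volume.restrict (edgeSet a j))) j)

theorem IsNonnegative.smul {ψ : GraphL2 E a} (hψ : IsNonnegative ψ) {c : ℝ} (hc : 0 ≤ c) :
    IsNonnegative ((c : ℂ) • ψ) := fun j => by
  filter_upwards [hψ j, Lp.coeFn_smul (c : ℂ) (ψ j)] with x h1 h2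
  rw [PiLp.smul_apply, h2]
  exact mul_nonneg (Complex.zero_le_real.mpr hc) h1

/-- The resolvent of the Laplace operator preserves positivity if the boundary conditions have a
nonnegative response for large `κ`. -/
theorem LaplaceGraph.isNonnegative_of_resolvent (ha : ∀ i, 0 < a i)
    {M : Submodule ℂ (Double (EdgeEnd I E))} (hM : IsMaximalIsotropic M)
    (hresp : ∀ᶠ κ in atTop, HasNonnegResponse M κ) :
    ∃ l₁ : ℝ, ∀ l : ℝ, l₁ ≤ l → ∀ ψ η : GraphL2 E a, LaplaceGraph a M ψ ((l : ℂ) • ψ - η) →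
      IsNonnegative η → IsNonnegative ψ := by
  classical
  obtain ⟨κ₀, hκ₀⟩ := HasNonnegResponse.perturb hM (∑ i, 1 / a i)
  obtain ⟨N, hN⟩ := eventually_atTop.mp hresp
  refine ⟨(max (max κ₀ N) 1) ^ 2, fun l hl ψ η ⟨f, f₁, f₂, hf, hψ, hφ, hbv⟩ hη => ?_⟩
  obtain ⟨κ, hκl⟩ : ∃ κ, κ = Real.sqrt l := ⟨_, rfl⟩
  have hκ1 : max (max κ₀ N) 1 ≤ κ := hκl ▸ Real.le_sqrt_of_sq_le hl
  have hκ : 0 < κ := lt_of_lt_of_le one_pos ((le_max_right _ _).trans hκ1)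
  have hκ2 : max κ₀ N ≤ κ := (le_max_left _ _).trans hκ1
  have hl2 : (l : ℂ) = (κ : ℂ) ^ 2 := by
    rw [hκl, ← Complex.ofReal_pow, Real.sq_sqrt ((sq_nonneg _).trans hl)]
  have hb : 0 ≤ ∑ i, 1 / a i := Finset.sum_nonneg fun i _ => (one_div_pos.mpr (ha i)).le
  have hpos : ∀ j, ∀ᵐ x ∂volume.restrict (edgeSet a j), 0 ≤ (κ : ℂ) ^ 2 * f j x - f₂ j x := by
    intro j
    filter_upwards [hη j, hψ j, hφ j, Lp.coeFn_smul (l : ℂ) (ψ j),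
      Lp.coeFn_sub ((l : ℂ) • ψ j) (η j)] with x h0 h1 h2 h3 h4
    rw [PiLp.sub_apply, PiLp.smul_apply, h4, Pi.sub_apply, h3, Pi.smul_apply, h1, hl2,
      smul_eq_mul] at h2
    rwa [← h2, sub_sub_cancel]
  have hE := fun e : E => maximum_principle_Ici hκ (hf (.inl e))
    ((ae_restrict_iff' measurableSet_Ici).mp (hpos (.inl e)))
  have hI := fun i : I => maximum_principle_Icc (ha i) hκ
    ((hf (.inr i)).isIndefiniteIntegral (ha i).le subset_rfl)
    ((hf (.inr i)).first_isIndefiniteIntegral (ha i).le subset_rfl)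
    ((ae_restrict_iff' measurableSet_Icc).mp (hpos (.inr i)))
  obtain ⟨p, hp⟩ : ∃ p, p = boundaryValues a f f₁ := ⟨_, rfl⟩
  have hκb := dirichletToNeumannDefect_mulVec a (∑ i, 1 / a i) κ p.1
  -- The data are `d = p.2 + Λ p.1`; their nonnegativity is exactly the set of derivative
  -- inequalities in the maximum principles.
  have hc : ∀ h, 0 ≤ p.1 h := by
    refine hκ₀ (κ + ∑ i, 1 / a i) (by linarith [(le_max_left κ₀ N).trans hκ2])
      (hN _ (by linarith [(le_max_right κ₀ N).trans hκ2]))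
      (dirichletToNeumannDefect E a (∑ i, 1 / a i) κ)
      (fun h k => (dirichletToNeumannDefect_mem_Icc ha hκ h k).1)
      (fun h k => (dirichletToNeumannDefect_mem_Icc ha hκ h k).2) p.1
      (p.2 + (((κ + ∑ i, 1 / a i : ℝ) : ℂ) • p.1 -
        (dirichletToNeumannDefect E a (∑ i, 1 / a i) κ).map Complex.ofReal *ᵥ p.1)) ?_ ?_
    · rw [add_sub_cancel_right, hp]
      exact hbv
    · rw [hκb, hp]
      rintro (e | i | i)
      · exact (hE e).1
      · have := (hI i).1
        rwa [add_sub_assoc] at this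
      · have := (hI i).2.1
        rwa [add_sub_assoc] at this
  rw [hp] at hc
  rintro (e | i)
  · filter_upwards [hψ (.inl e), ae_restrict_mem measurableSet_Ici] with x h1 hx
    rw [h1]
    exact (hE e).2 (hc (.inl e)) x hx
  · filter_upwards [hψ (.inr i), ae_restrict_mem measurableSet_Icc] with x h1 hx
    rw [h1]
    exact (hI i).2.2 (hc (.inr (.inl i))) (hc (.inr (.inr i))) x hx

theorem isPositivityPreserving_semigroup (ha : ∀ i, 0 < a i)
    {M : Submodule ℂ (Double (EdgeEnd I E))} (hM : IsMaximalIsotropic M)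
    {T : ℝ≥0 → GraphL2 E a →L[ℂ] GraphL2 E a}
    (hT : IsSemigroupGeneratedBy T (LaplaceGraph a M))
    (hresp : ∀ᶠ κ in atTop, HasNonnegResponse M κ) {t : ℝ≥0} (ht : 0 < t) :
    IsPositivityPreserving (T t) := by
  obtain ⟨l₀, h⟩ := exists_isSelfAdjointGraph ha hM
  obtain ⟨l₁, hl₁⟩ := LaplaceGraph.isNonnegative_of_resolvent ha hM hresp
  exact fun ψ hψ => h.semigroup_mem_cone hT isClosed_isNonnegative
    (fun c hc ψ hψ => IsNonnegative.smul hψ hc) hl₁ ht hψ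

end Positivity

theorem theorem3 {V I E : Type*} [Fintype V] [DecidableEq V] [Fintype I] [DecidableEq I]
    [Fintype E] [DecidableEq E] (G : QGraph V I E) (hG : G.IsConnected)
    (a : I → ℝ) (ha : ∀ i, 0 < a i)
    (M : Submodule ℂ (Double (EdgeEnd I E))) (hM : IsMaximalIsotropic M) :
    (∃! T : ℝ≥0 → GraphL2 E a →L[ℂ] GraphL2 E a,
        IsSemigroupGeneratedBy T (LaplaceGraph a M)) ∧
    ∀ T : ℝ≥0 → GraphL2 E a →L[ℂ] GraphL2 E a,
      IsSemigroupGeneratedBy T (LaplaceGraph a M) →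
        (IsStrictlyPositiveBC M → ∀ t, 0 < t → IsPositivityPreserving (T t)) ∧
        (IsEmpty I → IsPositiveBC M → ∀ t, 0 < t → IsPositivityPreserving (T t)) ∧
        (G.IsLocallyStrictlyPositive M → G.NoTadpoles →
          ∀ t, 0 < t → IsPositivityPreserving (T t)) := by
  obtain ⟨l₀, h⟩ := exists_isSelfAdjointGraph ha hM
  refine ⟨h.existsUnique_semigroup, fun T hT => ⟨fun hpos t ht => ?_, fun _ hpos t ht => ?_,
    fun hpos _ t ht => ?_⟩⟩
  · exact isPositivityPreserving_semigroup ha hM hT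
      hpos.isPositiveBC.eventually_hasNonnegResponse ht
  · exact isPositivityPreserving_semigroup ha hM hT hpos.eventually_hasNonnegResponse ht
  · exact isPositivityPreserving_semigroup ha hM hT hpos.eventually_hasNonnegResponse ht
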